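/- Let $\mathbb H_q=\mathbb H\times\mathbb R^3$ be the quaternionic Heisenberg group with product $(u,v)(r,s)=(u+r,\;v+s-2\,\mathrm{Im}(\bar r u))$ and Haar measure $du\,dt$ (Lebesgue measure). Let $K$ be the group of unit quaternions, acting by the automorphisms $k\cdot(u,t)=(ku,t)$. Let $L^{p,\#}$ be the space of $K$-invariant elements of $L^p(\mathbb H_q)$, and put $(f*g)(x)=\int_{\mathbb H_q}f(y)g(y^{-1}x)\,dy$. For $\lambda\in\mathbb R^3\setminus\{0\}$ and $n\in\mathbb N$ let $$\varphi_{\lambda,n}(u,t)=\tfrac1{n+1}e^{i\langle\lambda,t\rangle}e^{-|\lambda||u|^2}L^1_n(2|\lambda||u|^2),$$ where $L_n^1$ is the Laguerre polynomial of degree $n$ and order $1$. Let $\hat f(\lambda,n)=\int_{\mathbb H_q} f\varphi_{\lambda,n}$ for $f\in L^{1,\#}$, and let $\nu$ be the measure $\frac{1}{2\pi^5}(n+1)|\lambda|^2d\lambda$ on the pairs $(\lambda,n)$. For $F\in L^{2,\#}$ let $\hat F\in L^2(\nu)$ be its Plancherel transform, the $L^2(\nu)$-limit of $\hat h_j$ for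 $h_j\in L^{1,\#}\cap L^{2,\#}$ with $h_j\to F$ in $L^2$ and $(\hat h_j)$ convergent in $L^2(\nu)$. Extend the transform additively to $L^{1,\#}+L^{2,\#}$. For a bounded measurable function $\mathfrak m$ of $(\lambda,n)$, the spherical Fourier multiplier $T_{\mathfrak m}$ is defined on those $f\in L^{1,\#}+L^{2,\#}$ for which there is $F\in L^{1,\#}+L^{2,\#}$ with $\hat F=\mathfrak m\hat f$ $\nu$-almost everywhere, and then $T_{\mathfrak m}f=F$. **Theorem.** Let $\mathfrak m,\mathfrak m_1,\mathfrak m_2$ be bounded measurable functions of $(\lambda,n)$. Then $T_{\mathfrak m}f$ is uniquely determined (a.e.) whenever it exists; $T_{\mathfrak m}$ is defined on all of $L^{2,\#}$, maps it to itself, and $\|T_{\mathfrak m}f\|_2\le \sup|\mathfrak m|\,\|f\|_2$ there. Let $f,g\in L^{1,\#}$. 1. If $T_{\mathfrak m}f$ exists, then $T_{\mathfrak m}(f*g)$ exists, the convolution $(T_{\mathfrak m}f)*g$ converges absolutely almost everywhere, and $$T_{\mathfrak m}(f*g)=(T_{\mathfrak m}f)*g\quad\text{a.e.}$$ 2. If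 $T_{\mathfrak m_1}f$ and $T_{\mathfrak m_2}g$ exist, then $T_{\mathfrak m_1\mathfrak m_2}(f*g)$ exists, the convolution $T_{\mathfrak m_1}f*T_{\mathfrak m_2}g$ converges absolutely almost everywhere, and $$T_{\mathfrak m_1}f*T_{\mathfrak m_2}g=T_{\mathfrak m_1\mathfrak m_2}(f*g)\quad\text{a.e.}$$ 3. For all $f,g\in L^{1,\#}$, without a condition on existence, both identities hold as identities of convolution operators. That is, let $\mathcal T_{\mathfrak m,f}h=T_{\mathfrak m}(f*h)$ for $h\in L^{2,\#}$ (here $f*h\in L^{2,\#}$); if $T_{\mathfrak m}f$ exists, this is $(T_{\mathfrak m}f)*h$, an a.e. absolutely convergent convolution. For every $h\in L^{2,\#}$, almost everywhere, $$\mathcal T_{\mathfrak m,\,f*g}h=\mathcal T_{\mathfrak m,f}(g*h),\qquad \mathcal T_{\mathfrak m_1,f}\,\mathcal T_{\mathfrak m_2,g}h=\mathcal T_{\mathfrak m_1\mathfrak m_2,\,f*g}h.$$ -/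

import Mathlib

open MeasureTheory Filter Topology
open scoped ENNReal NNReal Quaternion

noncomputable section

namespace QHeis

/-- The Borel sigma-algebra on the quaternions. Together with the Euclidean inner product it makes
`volume` on `ℍ[ℝ]` the Lebesgue measure of `ℝ⁴`. -/
instance : MeasurableSpace ℍ[ℝ] := borel ℍ[ℝ]

instance : BorelSpace ℍ[ℝ] := ⟨rfl⟩

/-- `ℝ³` with its Euclidean structure. -/
abbrev E3 : Type := EuclideanSpace ℝ (Fin 3)

/-- The imaginary part of a quaternion, as a vector of `ℝ³`. -/
def im3 (q : ℍ[ℝ]) : E3 := !₂[q.imI, q.imJ, q.imK]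

/-- The underlying set `ℍ × ℝ³` of the quaternionic Heisenberg group. -/
@[ext]
structure Hq where
  /-- the component in `ℍ` -/
  u : ℍ[ℝ]
  /-- the central component in `ℝ³` -/
  t : E3

/-- The identification with the product `ℍ × ℝ³`. -/
def equivProd : Hq ≃ ℍ[ℝ] × E3 where
  toFun x := (x.u, x.t)
  invFun p := ⟨p.1, p.2⟩
  left_inv _ := rfl
  right_inv _ := rfl

/-- The group law `(u, v) (r, s) = (u + r, v + s - 2 Im (r̄ u))`. -/
instance : Mul Hq := ⟨fun x y => ⟨x.u + y.u, x.t + y.t - (2 : ℝ) • im3 (star y.u * x.u)⟩⟩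

instance : One Hq := ⟨⟨0, 0⟩⟩

instance : Inv Hq := ⟨fun x => ⟨-x.u, -x.t⟩⟩

theorem mul_def (x y : Hq) :
    x * y = ⟨x.u + y.u, x.t + y.t - (2 : ℝ) • im3 (star y.u * x.u)⟩ := rfl

theorem one_def : (1 : Hq) = ⟨0, 0⟩ := rfl

theorem inv_def (x : Hq) : x⁻¹ = ⟨-x.u, -x.t⟩ := rfl

instance : Group Hq :=
  Group.ofLeftAxioms
    (by
      intro x y z
      refine Hq.ext (add_assoc _ _ _) ?_
      ext i
      fin_cases i <;> simp [mul_def, im3] <;> ring)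
    (by
      intro x
      refine Hq.ext (zero_add _) ?_
      ext i
      fin_cases i <;> simp [mul_def, one_def, im3])
    (by
      intro x
      refine Hq.ext (neg_add_cancel _) ?_
      ext i
      fin_cases i <;> simp [mul_def, one_def, inv_def, im3] <;> ring)

instance : MeasurableSpace Hq := MeasurableSpace.comap equivProd inferInstance

/-- Lebesgue measure `du dt` on `ℍ × ℝ³`, which is the Haar measure of the group. -/
instance : MeasureSpace Hq :=
  ⟨Measure.map equivProd.symm (volume : Measure (ℍ[ℝ] × E3))⟩

/-- The compact group `K` of unit quaternions. -/
abbrev K : Type := Metric.sphere (0 : ℍ[ℝ]) 1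

/-- The automorphism `(u, t) ↦ (k u, t)` of the quaternionic Heisenberg group. -/
def act (k : K) (x : Hq) : Hq := ⟨(k : ℍ[ℝ]) * x.u, x.t⟩

theorem act_mul (k : K) (x y : Hq) : act k (x * y) = act k x * act k y := by
  have hk : star (k : ℍ[ℝ]) * (k : ℍ[ℝ]) = 1 := by
    rw [Quaternion.star_mul_self, Quaternion.normSq_eq_norm_mul_self]
    simp
  have h : star ((k : ℍ[ℝ]) * y.u) * ((k : ℍ[ℝ]) * x.u) = star y.u * x.u := by
    rw [star_mul, mul_assoc, ← mul_assoc (star (k : ℍ[ℝ])), hk, one_mul]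
  refine Hq.ext (mul_add _ _ _) ?_
  simp only [act, mul_def]
  rw [h]

/-- `K`-invariance (radiality in `u`) of a function considered up to null sets. -/
def KInvariant (f : Hq → ℂ) : Prop := ∀ k : K, ∀ᵐ x : Hq, f (act k x) = f x

/-- `f` represents an element of `L^{1,#}`: integrable and `K`-invariant. -/
def L1sharp (f : Hq → ℂ) : Prop := Integrable f ∧ KInvariant f

/-- `f` represents an element of `L^{2,#}`: square integrable and `K`-invariant. -/
def L2sharp (f : Hq → ℂ) : Prop := MemLp f 2 ∧ KInvariant f

/-- Convolution on the group: `(f * g)(x) = ∫ f(y) g(y⁻¹ x) dy`. -/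
def conv (f g : Hq → ℂ) (x : Hq) : ℂ := ∫ y : Hq, f y * g (y⁻¹ * x)

/-- The convolution integral of `f` and `g` converges absolutely almost everywhere. -/
def ConvExists (f g : Hq → ℂ) : Prop :=
  ∀ᵐ x : Hq, Integrable (fun y : Hq => f y * g (y⁻¹ * x))

/-- The Laguerre polynomial `L_n^1`. -/
def laguerre1 (n : ℕ) (x : ℝ) : ℝ :=
  ∑ j ∈ Finset.range (n + 1),
    (-1) ^ j * (Nat.choose (n + 1) (n - j) : ℝ) * x ^ j / (Nat.factorial j : ℝ)

/-- Parameters `(lam, n)` of the spherical functions (those with `lam = 0` form a null set for the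
Plancherel measure below). -/
abbrev Dual : Type := E3 × ℕ

/-- The bounded spherical function
`φ_{lam,n}(u,t) = (1/(n+1)) e^{i⟨lam,t⟩} e^{-|lam||u|²} L_n^1(2|lam||u|²)`,
normalised by `φ_{lam,n}(0,0) = 1`. -/
def phi (p : Dual) (x : Hq) : ℂ :=
  Complex.exp (Complex.I * ((inner ℝ p.1 x.t : ℝ) : ℂ)) *
    ((Real.exp (-(‖p.1‖ * ‖x.u‖ ^ 2)) * laguerre1 p.2 (2 * ‖p.1‖ * ‖x.u‖ ^ 2) / (p.2 + 1) : ℝ) : ℂ)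

/-- The spherical Fourier transform `f̂(lam,n) = ∫ f φ_{lam,n}` of an integrable function. -/
def sphericalTransform (f : Hq → ℂ) (p : Dual) : ℂ := ∫ x : Hq, f x * phi p x

/-- The Plancherel measure `(2π⁵)⁻¹ (n+1) |lam|² d(lam)` on the parameters `(lam, n)`. -/
def nu : Measure Dual :=
  ((volume : Measure E3).prod (Measure.count : Measure ℕ)).withDensity
    (fun p => ENNReal.ofReal ((p.2 + 1) * ‖p.1‖ ^ 2 / (2 * Real.pi ^ 5)))

/-- `a` is the spherical Plancherel transform of `F ∈ L^{2,#}`: the `L²` limit of the spherical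
transforms of functions in `L^{1,#} ∩ L^{2,#}` that converge to `F` in `L²`. -/
def HasPlancherelTransform (F : Hq → ℂ) (a : Dual → ℂ) : Prop :=
  L2sharp F ∧ MemLp a 2 nu ∧ ∃ h : ℕ → Hq → ℂ,
    (∀ j, L1sharp (h j) ∧ L2sharp (h j)) ∧
    Tendsto (fun j => eLpNorm (fun x => h j x - F x) 2 volume) atTop (𝓝 0) ∧
    Tendsto (fun j => eLpNorm (fun p => sphericalTransform (h j) p - a p) 2 nu) atTop (𝓝 0)

/-- `a` is the spherical transform of `F ∈ L^{1,#} + L^{2,#}`. -/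
def HasTransform (F : Hq → ℂ) (a : Dual → ℂ) : Prop :=
  ∃ (F₁ F₂ : Hq → ℂ) (a₂ : Dual → ℂ), L1sharp F₁ ∧ HasPlancherelTransform F₂ a₂ ∧
    (∀ᵐ x : Hq, F x = F₁ x + F₂ x) ∧
    (∀ᵐ p ∂nu, a p = sphericalTransform F₁ p + a₂ p)

/-- Bounded measurable functions of the spherical functions `φ_{lam,n}`, `lam ≠ 0`. -/
def IsSymbol (m : Dual → ℂ) : Prop :=
  Measurable m ∧ ∃ C : ℝ, ∀ lam : E3, lam ≠ 0 → ∀ n : ℕ, ‖m (lam, n)‖ ≤ C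

/-- `F = T_m f` in `L^{1,#} + L^{2,#}`, that is, the transform of `F` is `m` times that of `f`. -/
def IsMultiplierImage (m : Dual → ℂ) (f F : Hq → ℂ) : Prop :=
  ∃ a : Dual → ℂ, HasTransform f a ∧ HasTransform F (fun p => m p * a p)

/-- `T_m f` exists as an element of `L^{1,#} + L^{2,#}`. -/
def InDomain (m : Dual → ℂ) (f : Hq → ℂ) : Prop := ∃ F : Hq → ℂ, IsMultiplierImage m f F

open Classical in
/-- The spherical Fourier multiplier `T_m` (with value `0` off its domain). -/
def T (m : Dual → ℂ) (f : Hq → ℂ) : Hq → ℂ :=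
  if h : InDomain m f then h.choose else 0

/-- For `f ∈ L^{1,#}`, the convolution operator `h ↦ T_m (f * h)` on `L^{2,#}` with symbol `m f̂`.
It represents `T_m f` also where that is not a function in `L^{1,#} + L^{2,#}`. -/
def TOp (m : Dual → ℂ) (f h : Hq → ℂ) : Hq → ℂ := T m (conv f h)

end QHeis

end

noncomputable section

namespace QHeis

/-! On `K`-invariant functions the spherical transform turns convolution into multiplication, and it
is an `L²` isometry onto `L²(ν)`. Granted this, every identity of the theorem is a comparison of
transforms: both sides have the same one, and the transform determines the function. The only
delicate point is that a multiplier image lies merely in `L¹ + L²`, so a convolution of two of them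
contains an `L² * L²` term, which a priori is only a bounded function. Its transform is nevertheless
in `L²(ν)`, because `m f̂` is bounded when `f` is integrable. Approximating the second factor then
identifies the term with an honest `L²` function; this is `HasTransform.conv`.

The harmonic analysis is built from the tensors `exp (-a|u|²) h(t)`. Their transform is a Fourier
integral of `h` times `gam a |λ| n`, which is geometric in `n` with ratio `(a - |λ|) / (a + |λ|)`.
Four facts follow. The Laguerre generating function sums these geometric sequences against the
spherical functions. This gives inversion (`integral_phi_mul_tau`) and Parseval
(`integral_mul_sig`). The twisted convolution of two Gaussians is a Gaussian, and the ratios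
multiply. Hence the transform is multiplicative on Gaussian tensors. On the group side,
`K`-invariant functions are radial in `u`, and after the substitution `y = exp (-|u|²)` the
Weierstrass theorem shows that those orthogonal to all Gaussian tensors vanish. In particular
multiplicativity passes to all of `L^{1,#}`. On the dual side, orthogonality to the geometric
sequences says that a power series vanishes at points accumulating at `0`, so its coefficients
vanish.

The bound `|φ| ≤ 1`, needed uniformly in `n` for Fubini, is deduced from multiplicativity by a
spectral radius argument (`norm_phi_le_one`).

Uniqueness is handled by `WeakTransform`, the Parseval relation against test functions. It holds on
`L¹`, on `L²` and on the sum, and by the two completeness facts each member of a pair determines the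
other. The Plancherel theorem is obtained by closing the graph of the transform on the test
functions. Parseval makes both projections isometric, hence with closed range, and completeness
makes them onto. -/

/-! ### The group as a measure space and its automorphisms. -/

/-- The identification of the group with `ℍ × ℝ³`, as a measurable equivalence. -/
def measEquiv : Hq ≃ᵐ ℍ[ℝ] × E3 where
  toEquiv := equivProd
  measurable_toFun := comap_measurable _
  measurable_invFun := by
    rintro s ⟨t, ht, rfl⟩
    exact ht

theorem measurePreserving_measEquiv : MeasurePreserving measEquiv := by
  refine MeasurePreserving.symm measEquiv.symm ⟨measEquiv.symm.measurable, rfl⟩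

theorem measurable_u : Measurable Hq.u := measurable_fst.comp measEquiv.measurable

theorem measurable_t : Measurable Hq.t := measurable_snd.comp measEquiv.measurable

theorem measurable_mk {α : Type*} [MeasurableSpace α] {f : α → ℍ[ℝ]} {g : α → E3}
    (hf : Measurable f) (hg : Measurable g) : Measurable fun a => (⟨f a, g a⟩ : Hq) :=
  measEquiv.symm.measurable.comp (hf.prodMk hg)

@[fun_prop]
theorem continuous_im3 : Continuous im3 := by
  unfold im3
  refine (PiLp.continuous_toLp 2 _).comp (continuous_pi fun i => ?_)
  fin_cases i
  · exact Quaternion.continuous_imI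
  · exact Quaternion.continuous_imJ
  · exact Quaternion.continuous_imK

instance : SigmaFinite (volume : Measure Hq) :=
  measEquiv.symm.sigmaFinite_map (μ := (volume : Measure (ℍ[ℝ] × E3)))

instance : MeasurableMul₂ Hq where
  measurable_mul := by
    have h : Measurable fun p : (ℍ[ℝ] × E3) × (ℍ[ℝ] × E3) =>
        (p.1.1 + p.2.1, p.1.2 + p.2.2 - (2 : ℝ) • im3 (star p.2.1 * p.1.1)) := by
      refine Continuous.measurable ?_
      fun_prop
    exact measEquiv.symm.measurable.comp
      (h.comp (measEquiv.measurable.prodMap measEquiv.measurable))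

instance : MeasurableInv Hq where
  measurable_inv := measurable_mk measurable_u.neg measurable_t.neg

/-- Transport of measure preservation from `ℍ × ℝ³` to the group. -/
theorem measurePreserving_of_prod {φ : Hq → Hq} {ψ : ℍ[ℝ] × E3 → ℍ[ℝ] × E3}
    (hψ : MeasurePreserving ψ) (h : ∀ x, measEquiv (φ x) = ψ (measEquiv x)) :
    MeasurePreserving φ := by
  have := (measurePreserving_measEquiv.symm).comp (hψ.comp measurePreserving_measEquiv)
  convert this using 1
  ext1 x
  simp [← h]

/-- A left translation is a shear: a translation in `u`, and for each fixed `u` a translation in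
`t`. -/
theorem measurePreserving_mul_left' (x : Hq) : MeasurePreserving (fun y : Hq => x * y) := by
  have h : MeasurePreserving (fun p : ℍ[ℝ] × E3 =>
      (x.u + p.1, (x.t - (2 : ℝ) • im3 (star p.1 * x.u)) + p.2)) := by
    refine (measurePreserving_add_left (volume : Measure ℍ[ℝ]) x.u).skew_product
      (μc := (volume : Measure E3)) (μd := (volume : Measure E3))
      (g := fun a b => (x.t - (2 : ℝ) • im3 (star a * x.u)) + b) ?_ ?_
    · refine Continuous.measurable ?_
      simp only [Function.uncurry_def]
      fun_prop
    · exact ae_of_all _ fun a =>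
        (measurePreserving_add_left (volume : Measure E3) _).map_eq
  refine measurePreserving_of_prod h fun y => ?_
  refine Prod.ext rfl ?_
  change x.t + y.t - (2 : ℝ) • im3 (star y.u * x.u) = (x.t - (2 : ℝ) • im3 (star y.u * x.u)) + y.t
  abel

theorem measurePreserving_inv' : MeasurePreserving (fun y : Hq => y⁻¹) := by
  have h : MeasurePreserving (Prod.map Neg.neg Neg.neg : ℍ[ℝ] × E3 → ℍ[ℝ] × E3) :=
    (Measure.measurePreserving_neg (volume : Measure ℍ[ℝ])).prod
      (Measure.measurePreserving_neg (volume : Measure E3))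
  exact measurePreserving_of_prod h fun y => rfl

instance : (volume : Measure Hq).IsMulLeftInvariant :=
  ⟨fun x => (measurePreserving_mul_left' x).map_eq⟩

instance : (volume : Measure Hq).IsInvInvariant := ⟨measurePreserving_inv'.map_eq⟩

theorem measurable_act (k : K) : Measurable (act k) := by
  refine measurable_mk ?_ measurable_t
  exact (continuous_const_mul (k : ℍ[ℝ])).measurable.comp measurable_u

/-- Left multiplication by a unit quaternion, as a linear isometry. -/
def leftIsom (k : K) : ℍ[ℝ] ≃ₗᵢ[ℝ] ℍ[ℝ] :=
  LinearIsometry.toLinearIsometryEquiv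
    ⟨LinearMap.mulLeft ℝ (k : ℍ[ℝ]), fun x => by simp⟩ rfl

/-- Right multiplication by a unit quaternion, as a linear isometry. -/
def rightIsom (k : K) : ℍ[ℝ] ≃ₗᵢ[ℝ] ℍ[ℝ] :=
  LinearIsometry.toLinearIsometryEquiv
    ⟨LinearMap.mulRight ℝ (k : ℍ[ℝ]), fun x => by simp⟩ rfl

theorem measurePreserving_act (k : K) : MeasurePreserving (act k) := by
  have h : MeasurePreserving (Prod.map (leftIsom k) id : ℍ[ℝ] × E3 → ℍ[ℝ] × E3) :=
    ((leftIsom k).measurePreserving).prod (MeasurePreserving.id _)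
  exact measurePreserving_of_prod h fun y => rfl

theorem measurePreserving_inv_mul (x : Hq) : MeasurePreserving (fun y : Hq => y⁻¹ * x) := by
  have h := (Measure.measurePreserving_inv (volume : Measure Hq)).comp
    (measurePreserving_mul_left (volume : Measure Hq) x⁻¹)
  have e : (Inv.inv ∘ fun y : Hq => x⁻¹ * y) = fun y : Hq => y⁻¹ * x := by
    ext1 y
    simp
  rwa [e] at h

/-! ### Convolution -/

/-- By left invariance `(x, y) ↦ (y, y⁻¹ x)` preserves the product measure. So the convolution
kernel inherits measurability, and below integrability, from the tensor product of `f` and `g`. -/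
theorem aestronglyMeasurable_kernel {f g : Hq → ℂ} (hf : AEStronglyMeasurable f)
    (hg : AEStronglyMeasurable g) :
    AEStronglyMeasurable (fun p : Hq × Hq => f p.2 * g (p.2⁻¹ * p.1)) (volume.prod volume) :=
  (hf.comp_fst.mul hg.comp_snd).comp_measurePreserving
    (measurePreserving_prod_inv_mul_swap volume volume)

theorem aestronglyMeasurable_conv {f g : Hq → ℂ} (hf : AEStronglyMeasurable f)
    (hg : AEStronglyMeasurable g) : AEStronglyMeasurable (conv f g) :=
  (aestronglyMeasurable_kernel hf hg).integral_prod_right'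

theorem aestronglyMeasurable_comp_inv_mul {g : Hq → ℂ} (hg : AEStronglyMeasurable g) (x : Hq) :
    AEStronglyMeasurable (fun y => g (y⁻¹ * x)) :=
  hg.comp_measurePreserving (measurePreserving_inv_mul x)

theorem integrable_kernel {f g : Hq → ℂ} (hf : Integrable f) (hg : Integrable g) :
    Integrable (fun p : Hq × Hq => f p.2 * g (p.2⁻¹ * p.1)) (volume.prod volume) :=
  (measurePreserving_prod_inv_mul_swap volume volume).integrable_comp_of_integrable
    (hf.mul_prod hg)

theorem convExists_of_integrable {f g : Hq → ℂ} (hf : Integrable f) (hg : Integrable g) :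
    ConvExists f g :=
  (integrable_kernel hf hg).prod_right_ae

theorem integrable_conv {f g : Hq → ℂ} (hf : Integrable f) (hg : Integrable g) :
    Integrable (conv f g) :=
  (integrable_kernel hf hg).integral_prod_left

theorem integral_norm_conv_le {f g : Hq → ℂ} (hf : Integrable f) (hg : Integrable g) :
    ∫ x, ‖conv f g x‖ ≤ (∫ x, ‖f x‖) * ∫ x, ‖g x‖ := by
  have hk := (integrable_kernel hf hg).norm
  calc ∫ x, ‖conv f g x‖ ≤ ∫ x, ∫ y, ‖f y * g (y⁻¹ * x)‖ := by
        refine integral_mono (integrable_conv hf hg).norm hk.integral_prod_left fun x => ?_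
        exact norm_integral_le_integral_norm _
    _ = ∫ p : Hq × Hq, ‖f p.2 * g (p.2⁻¹ * p.1)‖ ∂(volume.prod volume) :=
        (integral_prod _ hk).symm
    _ = ∫ p : Hq × Hq, ‖f p.1 * g p.2‖ ∂(volume.prod volume) := by
        have h := measurePreserving_prod_inv_mul_swap (volume : Measure Hq) (volume : Measure Hq)
        have := integral_map (μ := (volume : Measure Hq).prod (volume : Measure Hq))
          h.measurable.aemeasurable
          (f := fun p : Hq × Hq => ‖f p.1 * g p.2‖)
          (by rw [h.map_eq]; exact (hf.mul_prod hg).aestronglyMeasurable.norm)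
        rw [h.map_eq] at this
        exact this.symm
    _ = _ := by
        simp_rw [norm_mul]
        exact integral_prod_mul (fun x => ‖f x‖) (fun x => ‖g x‖)

theorem sq_eLpNorm_two {α : Type*} [MeasurableSpace α] {μ : Measure α} (f : α → ℂ) :
    eLpNorm f 2 μ ^ 2 = ∫⁻ x, ‖f x‖ₑ ^ 2 ∂μ := by
  have := eLpNorm_nnreal_pow_eq_lintegral (f := f) (μ := μ) (p := 2) two_ne_zero
  simpa using this

/-- The Cauchy–Schwarz step of Young's inequality. -/
theorem sq_lintegral_mul_le {α : Type*} [MeasurableSpace α] {μ : Measure α} {f g : α → ℝ≥0∞}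
    (hf : AEMeasurable f μ) (hg : AEMeasurable g μ) :
    (∫⁻ a, f a * g a ∂μ) ^ 2 ≤ (∫⁻ a, f a ∂μ) * ∫⁻ a, f a * g a ^ 2 ∂μ := by
  have h := ENNReal.lintegral_mul_norm_pow_le (μ := μ) hf (hf.mul (hg.pow_const 2))
    (p := 1 / 2) (q := 1 / 2) (by norm_num) (by norm_num) (by norm_num)
  have e : ∀ a, f a ^ (1 / 2 : ℝ) * (f a * g a ^ 2) ^ (1 / 2 : ℝ) = f a * g a := by
    intro a
    rw [ENNReal.mul_rpow_of_nonneg _ _ (by norm_num), ← mul_assoc,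
      ← ENNReal.rpow_add_of_nonneg _ _ (by norm_num) (by norm_num),
      ← ENNReal.rpow_natCast, ← ENNReal.rpow_mul]
    norm_num
  have e2 : ∀ c : ℝ≥0∞, (c ^ (1 / 2 : ℝ)) ^ 2 = c := by
    intro c
    rw [← ENNReal.rpow_natCast, ← ENNReal.rpow_mul]
    norm_num
  simp only [Pi.mul_apply, e] at h
  calc _ ≤ ((∫⁻ a, f a ∂μ) ^ (1 / 2 : ℝ) * (∫⁻ a, f a * g a ^ 2 ∂μ) ^ (1 / 2 : ℝ)) ^ 2 := by
        gcongr
    _ = _ := by rw [mul_pow, e2, e2]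

/-- Cauchy–Schwarz for the measure `|f| dy`, followed by Tonelli. The absolute value stands inside
the inner integral, so the estimate yields both Young's inequality and absolute convergence almost
everywhere. -/
theorem lintegral_kernel_sq_le {f h : Hq → ℂ} (hf : Integrable f) (hh : AEStronglyMeasurable h) :
    ∫⁻ x, (∫⁻ y, ‖f y * h (y⁻¹ * x)‖ₑ) ^ 2 ≤ (eLpNorm f 1 volume * eLpNorm h 2 volume) ^ 2 := by
  have hfm := hf.aestronglyMeasurable
  have hk : AEMeasurable (fun p : Hq × Hq => ‖f p.1‖ₑ * ‖h p.2‖ₑ ^ 2) (volume.prod volume) :=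
    hfm.comp_fst.enorm.mul (hh.comp_snd.enorm.pow_const 2)
  have hmp := measurePreserving_prod_inv_mul_swap (volume : Measure Hq) (volume : Measure Hq)
  calc ∫⁻ x, (∫⁻ y, ‖f y * h (y⁻¹ * x)‖ₑ) ^ 2
      ≤ ∫⁻ x, eLpNorm f 1 volume * ∫⁻ y, ‖f y‖ₑ * ‖h (y⁻¹ * x)‖ₑ ^ 2 := by
        refine lintegral_mono fun x => ?_
        simp only [enorm_mul, eLpNorm_one_eq_lintegral_enorm]
        exact sq_lintegral_mul_le hfm.enorm (aestronglyMeasurable_comp_inv_mul hh x).enorm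
    _ = eLpNorm f 1 volume * ∫⁻ x, ∫⁻ y, ‖f y‖ₑ * ‖h (y⁻¹ * x)‖ₑ ^ 2 :=
        lintegral_const_mul' _ _ (by
          rw [eLpNorm_one_eq_lintegral_enorm]
          exact hf.hasFiniteIntegral.ne)
    _ = eLpNorm f 1 volume *
          ∫⁻ p : Hq × Hq, ‖f p.2‖ₑ * ‖h (p.2⁻¹ * p.1)‖ₑ ^ 2 ∂(volume.prod volume) := by
        congr 1
        exact (lintegral_prod _
          (hk.comp_quasiMeasurePreserving hmp.quasiMeasurePreserving)).symm
    _ = eLpNorm f 1 volume *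
          ∫⁻ p : Hq × Hq, ‖f p.1‖ₑ * ‖h p.2‖ₑ ^ 2 ∂(volume.prod volume) := by
        have := lintegral_map' (μ := (volume : Measure Hq).prod (volume : Measure Hq))
          (f := fun p : Hq × Hq => ‖f p.1‖ₑ * ‖h p.2‖ₑ ^ 2)
          (by rw [hmp.map_eq]; exact hk) hmp.measurable.aemeasurable
        rw [hmp.map_eq] at this
        rw [this]
    _ = eLpNorm f 1 volume * (eLpNorm f 1 volume * eLpNorm h 2 volume ^ 2) := by
        rw [lintegral_prod_mul hfm.enorm (hh.enorm.pow_const 2), sq_eLpNorm_two,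
          eLpNorm_one_eq_lintegral_enorm]
    _ = _ := by ring

theorem eLpNorm_conv_le {f h : Hq → ℂ} (hf : Integrable f) (hh : AEStronglyMeasurable h) :
    eLpNorm (conv f h) 2 volume ≤ eLpNorm f 1 volume * eLpNorm h 2 volume := by
  rw [← ENNReal.pow_le_pow_left_iff (n := 2) two_ne_zero, sq_eLpNorm_two]
  refine le_trans (lintegral_mono fun x => ?_) (lintegral_kernel_sq_le hf hh)
  gcongr
  exact enorm_integral_le_lintegral_enorm _

theorem memLp_conv {f h : Hq → ℂ} (hf : Integrable f) (hh : MemLp h 2) :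
    MemLp (conv f h) 2 :=
  ⟨aestronglyMeasurable_conv hf.aestronglyMeasurable hh.1,
    (eLpNorm_conv_le hf hh.1).trans_lt
      (ENNReal.mul_lt_top (memLp_one_iff_integrable.2 hf).2 hh.2)⟩

theorem convExists_L1_L2 {f h : Hq → ℂ} (hf : Integrable f) (hh : MemLp h 2) :
    ConvExists f h := by
  have hk := aestronglyMeasurable_kernel hf.aestronglyMeasurable hh.1
  have hfin : ∫⁻ x, (∫⁻ y, ‖f y * h (y⁻¹ * x)‖ₑ) ^ 2 ≠ ∞ :=
    ((lintegral_kernel_sq_le hf hh.1).trans_lt (ENNReal.pow_lt_top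
      (ENNReal.mul_lt_top (memLp_one_iff_integrable.2 hf).2 hh.2))).ne
  have hae := ae_lt_top' (hk.enorm.lintegral_prod_right'.pow_const 2) hfin
  filter_upwards [hae] with x hx
  refine ⟨hf.aestronglyMeasurable.mul (aestronglyMeasurable_comp_inv_mul hh.1 x), ?_⟩
  exact (ENNReal.pow_lt_top_iff.1 hx).resolve_right two_ne_zero

/-- Reflection `x ↦ f x⁻¹`. -/
def reflect (f : Hq → ℂ) (x : Hq) : ℂ := f x⁻¹

/-- Inversion is a measure-preserving anti-automorphism. This reduces `L² * L¹` to `L¹ * L²`. -/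
theorem conv_eq_reflect (F g : Hq → ℂ) (x : Hq) :
    conv F g x = conv (reflect g) (reflect F) x⁻¹ := by
  have h := integral_mul_left_eq_self (μ := (volume : Measure Hq))
    (fun y : Hq => F y * g (y⁻¹ * x)) x
  rw [conv, ← h, conv]
  simp [reflect, mul_comm]

theorem measurePreserving_inv : MeasurePreserving (fun y : Hq => y⁻¹) :=
  Measure.measurePreserving_inv volume

theorem integrable_reflect {f : Hq → ℂ} (hf : Integrable f) : Integrable (reflect f) :=
  measurePreserving_inv.integrable_comp_of_integrable hf

theorem memLp_reflect {f : Hq → ℂ} (hf : MemLp f 2) : MemLp (reflect f) 2 :=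
  hf.comp_measurePreserving measurePreserving_inv

theorem memLp_conv' {F g : Hq → ℂ} (hF : MemLp F 2) (hg : Integrable g) :
    MemLp (conv F g) 2 := by
  rw [funext (conv_eq_reflect F g)]
  exact memLp_reflect (memLp_conv (integrable_reflect hg) (memLp_reflect hF))

theorem eLpNorm_conv_le' {F g : Hq → ℂ} (hF : MemLp F 2) (hg : Integrable g) :
    eLpNorm (conv F g) 2 volume ≤ eLpNorm F 2 volume * eLpNorm g 1 volume := by
  have e : ∀ (f : Hq → ℂ) (p : ℝ≥0∞), AEStronglyMeasurable f →
      eLpNorm (reflect f) p volume = eLpNorm f p volume := fun f p hf =>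
    eLpNorm_comp_measurePreserving hf measurePreserving_inv
  rw [funext (conv_eq_reflect F g), ← e F 2 hF.1, ← e g 1 hg.aestronglyMeasurable, mul_comm]
  refine (e (conv (reflect g) (reflect F)) 2 ?_).le.trans
    (eLpNorm_conv_le (integrable_reflect hg) (memLp_reflect hF).1)
  exact aestronglyMeasurable_conv (integrable_reflect hg).aestronglyMeasurable (memLp_reflect hF).1

theorem convExists_L2_L1 {F g : Hq → ℂ} (hF : MemLp F 2) (hg : Integrable g) :
    ConvExists F g := by
  have h := measurePreserving_inv.quasiMeasurePreserving.ae
    (convExists_L1_L2 (integrable_reflect hg) (memLp_reflect hF))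
  filter_upwards [h] with x hx
  have := (measurePreserving_mul_left (volume : Measure Hq) x⁻¹).integrable_comp_of_integrable hx
  refine this.congr (ae_of_all _ fun y => ?_)
  simp [reflect, mul_comm]

theorem integrable_kernel_L2 {F G : Hq → ℂ} (hF : MemLp F 2) (hG : MemLp G 2) (x : Hq) :
    Integrable (fun y : Hq => F y * G (y⁻¹ * x)) :=
  hF.integrable_mul (hG.comp_measurePreserving (measurePreserving_inv_mul x))

theorem convExists_L2_L2 {F G : Hq → ℂ} (hF : MemLp F 2) (hG : MemLp G 2) : ConvExists F G :=
  ae_of_all _ fun x => integrable_kernel_L2 hF hG x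

theorem enorm_conv_le_L2 {F G : Hq → ℂ} (hF : MemLp F 2) (hG : MemLp G 2) (x : Hq) :
    ‖conv F G x‖ₑ ≤ eLpNorm F 2 volume * eLpNorm G 2 volume := by
  have hmp := measurePreserving_inv_mul x
  rw [← eLpNorm_comp_measurePreserving hG.1 hmp]
  refine (enorm_integral_le_lintegral_enorm _).trans ?_
  rw [← eLpNorm_one_eq_lintegral_enorm]
  refine eLpNorm_le_eLpNorm_mul_eLpNorm_of_nnnorm (p := 2) (q := 2) (r := 1) hF.1
    (hG.1.comp_measurePreserving hmp) (fun a b : ℂ => a * b) 1 (ae_of_all _ fun y => ?_) |>.trans ?_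
  · simp
  · simp

/-! ### Invariance -/

theorem KInvariant.congr {f g : Hq → ℂ} (hf : KInvariant f) (h : f =ᵐ[volume] g) :
    KInvariant g := by
  intro k
  filter_upwards [hf k, h, (measurePreserving_act k).quasiMeasurePreserving.ae h] with x h1 h2 h3
  rw [← h3, h1, h2]

theorem KInvariant.add {f g : Hq → ℂ} (hf : KInvariant f) (hg : KInvariant g) :
    KInvariant (fun x => f x + g x) := by
  intro k
  filter_upwards [hf k, hg k] with x h1 h2
  rw [h1, h2]

theorem KInvariant.const_mul {f : Hq → ℂ} (hf : KInvariant f) (c : ℂ) :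
    KInvariant (fun x => c * f x) := by
  intro k
  filter_upwards [hf k] with x h1
  rw [h1]

theorem act_inv (k : K) (x : Hq) : act k x⁻¹ = (act k x)⁻¹ := by
  refine Hq.ext ?_ rfl
  simp [act, inv_def]

theorem actEmbedding (k : K) : MeasurableEmbedding (act k) := by
  have hk : (k : ℍ[ℝ]) ≠ 0 := norm_ne_zero_iff.1 (by simp)
  let e : Hq ≃ᵐ Hq := {
    toFun := act k
    invFun := act k⁻¹
    left_inv := fun x => Hq.ext (by simp [act, hk]) rfl
    right_inv := fun x => Hq.ext (by simp [act, hk]) rfl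
    measurable_toFun := measurable_act k
    measurable_invFun := measurable_act k⁻¹ }
  exact e.measurableEmbedding

/-- `K` acts by measure-preserving automorphisms, so the action can be moved into the integration
variable. -/
theorem KInvariant.conv {f g : Hq → ℂ} (hf : KInvariant f) (hg : KInvariant g) :
    KInvariant (conv f g) := by
  intro k
  refine ae_of_all _ fun x => ?_
  rw [QHeis.conv, ← (measurePreserving_act k).integral_comp (actEmbedding k), QHeis.conv]
  refine integral_congr_ae ?_
  filter_upwards [hf k, (measurePreserving_inv_mul x).quasiMeasurePreserving.ae (hg k)] with y h1 h2
  rw [h1, ← act_inv, ← act_mul, h2]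

/-! ### Radial functions -/

theorem integral_eq_prod {E : Type*} [NormedAddCommGroup E] [NormedSpace ℝ E]
    (φ : ℍ[ℝ] × E3 → E) : ∫ x : Hq, φ (x.u, x.t) = ∫ p, φ p :=
  measurePreserving_measEquiv.integral_comp' (g := φ)

theorem integrable_iff_prod {E : Type*} [NormedAddCommGroup E] (φ : ℍ[ℝ] × E3 → E) :
    Integrable (fun x : Hq => φ (x.u, x.t)) ↔ Integrable φ :=
  measurePreserving_measEquiv.integrable_comp_emb measEquiv.measurableEmbedding

theorem ae_iff_prod {p : ℍ[ℝ] × E3 → Prop} :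
    (∀ᵐ x : Hq, p (x.u, x.t)) ↔ ∀ᵐ q, p q := by
  have h := measEquiv.measurableEmbedding.ae_map_iff (μ := (volume : Measure Hq)) (p := p)
  rw [measurePreserving_measEquiv.map_eq] at h
  exact h.symm

theorem ae_u_ne_zero : ∀ᵐ x : Hq, x.u ≠ 0 := by
  refine (ae_iff_prod (p := fun q => q.1 ≠ 0)).2 ?_
  exact Measure.quasiMeasurePreserving_fst.ae (Measure.ae_ne volume (0 : ℍ[ℝ]))

/-- The unit quaternion `‖w‖⁻¹ w`. -/
def unitOf (w : ℍ[ℝ]) (hw : w ≠ 0) : K := ⟨‖w‖⁻¹ • w, by simp [norm_smul, hw]⟩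

/-- Invariance is known only almost everywhere for each `k`, so `f` is averaged over all directions
`w / ‖w‖`, with Lebesgue measure on the unit ball of `ℍ` in place of Haar measure on `K`. By Fubini,
for almost every `x` nearly all rotations of `x` give the same value. -/
theorem exists_radial {F : Hq → ℂ} (hF : AEStronglyMeasurable F) (hK : KInvariant F) :
    ∃ F₀ : ℝ × E3 → ℂ, StronglyMeasurable F₀ ∧ ∀ᵐ x : Hq, F x = F₀ (‖x.u‖, x.t) := by
  set f := hF.mk F with hf
  have hfm : StronglyMeasurable f := hF.stronglyMeasurable_mk
  have hfK : KInvariant f := hK.congr hF.ae_eq_mk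
  set γ : Measure ℍ[ℝ] := volume.restrict (Metric.ball 0 1) with hγ
  have hc : γ.real Set.univ ≠ 0 := by
    rw [hγ, measureReal_restrict_apply_univ]
    exact (ENNReal.toReal_pos (Metric.measure_ball_pos _ _ one_pos).ne'
      measure_ball_lt_top.ne).ne'
  have hfin : IsFiniteMeasure γ := ⟨by
    rw [hγ, Measure.restrict_apply_univ]
    exact measure_ball_lt_top⟩
  have hnorm : Measurable fun w : ℍ[ℝ] => ‖w‖⁻¹ • w := measurable_norm.inv.smul measurable_id
  let F₀ : ℝ × E3 → ℂ := fun q =>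
    (γ.real Set.univ : ℂ)⁻¹ * ∫ w, f ⟨q.1 • (‖w‖⁻¹ • w), q.2⟩ ∂γ
  refine ⟨F₀, ?_, ?_⟩
  · refine StronglyMeasurable.const_mul ?_ _
    have : StronglyMeasurable fun q : (ℝ × E3) × ℍ[ℝ] =>
        f ⟨q.1.1 • (‖q.2‖⁻¹ • q.2), q.1.2⟩ :=
      hfm.comp_measurable (measurable_mk
        (measurable_fst.fst.smul (hnorm.comp measurable_snd)) measurable_fst.snd)
    exact this.integral_prod_right'
  · have hset : MeasurableSet {q : Hq × ℍ[ℝ] |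
        f ⟨(‖q.2‖⁻¹ • q.2) * q.1.u, q.1.t⟩ = f q.1} := by
      refine measurableSet_eq_fun (hfm.measurable.comp (measurable_mk ?_ ?_))
        (hfm.measurable.comp measurable_fst)
      · exact (hnorm.comp measurable_snd).mul (measurable_u.comp measurable_fst)
      · exact measurable_t.comp measurable_fst
    have h1 : ∀ᵐ w ∂γ, ∀ᵐ x : Hq, f ⟨(‖w‖⁻¹ • w) * x.u, x.t⟩ = f x := by
      have : ∀ᵐ w : ℍ[ℝ], w ≠ 0 := Measure.ae_ne volume (0 : ℍ[ℝ])
      filter_upwards [ae_restrict_of_ae this] with w hw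
      exact hfK (unitOf w hw)
    have h2 := (Measure.ae_ae_comm (μ := (volume : Measure Hq)) (ν := γ)
      (p := fun x w => f ⟨(‖w‖⁻¹ • w) * x.u, x.t⟩ = f x) hset).2 h1
    filter_upwards [h2, ae_u_ne_zero, hF.ae_eq_mk] with x hx hu hFx
    -- Right multiplication by `x.u / ‖x.u‖` preserves the ball. It carries the average over points
    -- `‖x.u‖ (w / ‖w‖)`, which depends on `‖x.u‖` only, to the average over the left rotations `(w
    -- / ‖w‖) x.u`.
    rw [hFx]
    set k := unitOf x.u hu with hk
    have hmp : MeasurePreserving (rightIsom k) γ γ := by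
      have := (rightIsom k).measurePreserving.restrict_preimage
        (s := Metric.ball (0 : ℍ[ℝ]) 1) measurableSet_ball
      rwa [LinearIsometryEquiv.preimage_ball, map_zero] at this
    have h3 := hmp.integral_comp (rightIsom k).toHomeomorph.measurableEmbedding
      (fun w => f ⟨‖x.u‖ • (‖w‖⁻¹ • w), x.t⟩)
    have h4 : ∀ w : ℍ[ℝ], ‖x.u‖ • (‖rightIsom k w‖⁻¹ • rightIsom k w) = (‖w‖⁻¹ • w) * x.u := by
      intro w
      rw [LinearIsometryEquiv.norm_map]
      change ‖x.u‖ • (‖w‖⁻¹ • (w * (‖x.u‖⁻¹ • x.u))) = _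
      rw [mul_smul_comm, smul_comm (‖w‖⁻¹), smul_smul, mul_inv_cancel₀ (norm_ne_zero_iff.2 hu),
        one_smul, smul_mul_assoc]
    simp only [h4] at h3
    rw [integral_congr_ae hx] at h3
    change f x = (γ.real Set.univ : ℂ)⁻¹ * ∫ w, f ⟨‖x.u‖ • (‖w‖⁻¹ • w), x.t⟩ ∂γ
    rw [← h3, integral_const, Complex.real_smul, inv_mul_cancel_left₀]
    exact_mod_cast hc

/-- A radial function on `ℍ` that is orthogonal to all `exp (-k |u|²)` vanishes. -/
theorem radial_eq_zero {A₀ : ℝ → ℂ} (hA : Measurable A₀)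
    (hint : Integrable fun u : ℍ[ℝ] => A₀ ‖u‖ * (Real.exp (-‖u‖ ^ 2) : ℂ))
    (h : ∀ k : ℕ, ∫ u : ℍ[ℝ], A₀ ‖u‖ * (Real.exp (-((k + 1 : ℕ) * ‖u‖ ^ 2)) : ℂ) = 0) :
    ∀ᵐ u : ℍ[ℝ], A₀ ‖u‖ = 0 := by
  set Θ : ℍ[ℝ] → ℝ := fun u => Real.exp (-‖u‖ ^ 2) with hΘ
  have hΘm : Measurable Θ := by fun_prop
  -- In the variable `y = exp (-‖u‖²) ∈ (0, 1]` the hypotheses become vanishing moments of `b` for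
  -- the image measure. One factor `y` is put into `b` to make it integrable.
  set b : ℝ → ℂ := fun y => A₀ (Real.sqrt (-Real.log y)) * y with hb
  have hbm : Measurable b :=
    (hA.comp (Real.measurable_log.neg.sqrt)).mul Complex.measurable_ofReal
  have hbΘ : ∀ u, b (Θ u) = A₀ ‖u‖ * (Θ u : ℂ) := by
    intro u
    simp only [hb, hΘ, Real.log_exp, neg_neg, Real.sqrt_sq (norm_nonneg u)]
  have hbint : Integrable b (Measure.map Θ volume) := by
    rw [integrable_map_measure hbm.aestronglyMeasurable hΘm.aemeasurable]
    exact hint.congr (ae_of_all _ fun u => (hbΘ u).symm)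
  have hbint' : Integrable fun u => b (Θ u) :=
    hint.congr (ae_of_all _ fun u => (hbΘ u).symm)
  have hΘ1 : ∀ u, Θ u ∈ Set.Icc (0 : ℝ) 1 := fun u =>
    ⟨(Real.exp_pos _).le, Real.exp_le_one_iff.2 (by simp)⟩
  have hmulint : ∀ χ : ℝ → ℝ, Continuous χ → Integrable fun u => (χ (Θ u) : ℂ) * b (Θ u) := by
    intro χ hχ
    obtain ⟨C, hC⟩ := isCompact_Icc.exists_bound_of_continuousOn
      (hχ.continuousOn (s := Set.Icc (0 : ℝ) 1))
    refine hbint'.bdd_mul (c := C) ?_ (ae_of_all _ fun u => ?_)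
    · exact (Complex.measurable_ofReal.comp (hχ.measurable.comp hΘm)).aestronglyMeasurable
    · rw [Complex.norm_real]
      exact hC _ (hΘ1 u)
  have hpoly : ∀ p : Polynomial ℝ, ∫ u, ((p.eval (Θ u) : ℝ) : ℂ) * b (Θ u) = 0 := by
    intro p
    induction p using Polynomial.induction_on' with
    | add p q hp hq =>
      simp only [Polynomial.eval_add, Complex.ofReal_add, add_mul]
      rw [integral_add (hmulint _ p.continuous) (hmulint _ q.continuous), hp, hq, add_zero]
    | monomial n a =>
      simp only [Polynomial.eval_monomial, Complex.ofReal_mul, mul_assoc]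
      rw [integral_const_mul, ← mul_zero (a : ℂ), ← h n]
      congr 1
      refine integral_congr_ae (ae_of_all _ fun u => ?_)
      simp only [hbΘ]
      have : Real.exp (-((n + 1 : ℕ) * ‖u‖ ^ 2)) = Θ u ^ n * Θ u := by
        rw [← pow_succ, hΘ, ← Real.exp_nat_mul]
        ring_nf
      rw [this]
      push_cast
      ring
  -- Weierstrass approximation on `[0, 1]`, which contains the range of `Θ`.
  have hcont : ∀ χ : ℝ → ℝ, Continuous χ → ∫ u, (χ (Θ u) : ℂ) * b (Θ u) = 0 := by
    intro χ hχ
    rw [← norm_le_zero_iff]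
    refine le_of_forall_pos_le_add fun ε hε => ?_
    set N := ∫ u, ‖b (Θ u)‖ with hN
    have hN0 : 0 ≤ N := integral_nonneg fun _ => norm_nonneg _
    obtain ⟨p, hp⟩ := exists_polynomial_near_of_continuousOn 0 1 χ hχ.continuousOn
      (ε / (N + 1)) (by positivity)
    calc ‖∫ u, (χ (Θ u) : ℂ) * b (Θ u)‖
        = ‖∫ u, ((χ (Θ u) : ℂ) * b (Θ u) - ((p.eval (Θ u) : ℝ) : ℂ) * b (Θ u))‖ := by
          rw [integral_sub (hmulint _ hχ) (hmulint _ p.continuous), hpoly, sub_zero]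
      _ ≤ ∫ u, ε / (N + 1) * ‖b (Θ u)‖ := by
          refine norm_integral_le_of_norm_le (hbint'.norm.const_mul _) (ae_of_all _ fun u => ?_)
          rw [← sub_mul, norm_mul, ← Complex.ofReal_sub, Complex.norm_real, norm_sub_rev]
          gcongr
          exact (hp _ (hΘ1 u)).le
      _ = ε / (N + 1) * N := by rw [integral_const_mul]
      _ ≤ 0 + ε := by
          rw [zero_add, div_mul_eq_mul_div, div_le_iff₀ (by positivity)]
          nlinarith
  have hb0 := ae_eq_zero_of_integral_contDiff_smul_eq_zero hbint.locallyIntegrable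
    (fun χ hχ _ => by
      rw [integral_map hΘm.aemeasurable]
      · simpa [Complex.real_smul] using hcont χ hχ.continuous
      · exact (hχ.continuous.measurable.smul hbm).aestronglyMeasurable)
  filter_upwards [ae_of_ae_map hΘm.aemeasurable hb0] with u hu
  rw [hbΘ] at hu
  exact (mul_eq_zero.1 hu).resolve_right (by exact_mod_cast (Real.exp_pos _).ne')

/-! ### Completeness of the Gaussian tensors on the group. -/

/-- Polynomial weight on the centre. -/
def weight (t : E3) : ℝ := (1 + ‖t‖ ^ 2)⁻¹ ^ 2

theorem weight_pos (t : E3) : 0 < weight t := by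
  unfold weight
  positivity

theorem contDiff_weight : ContDiff ℝ (⊤ : ℕ∞) weight := by
  unfold weight
  refine ContDiff.pow (ContDiff.inv (contDiff_const.add (contDiff_norm_sq ℝ)) fun t => ?_) 2
  positivity

/-- The Gaussian `exp (-a |u|²)` times a function of the central variable. -/
def gaussTensor (a : ℝ) (h : E3 → ℂ) (x : Hq) : ℂ := (Real.exp (-(a * ‖x.u‖ ^ 2)) : ℂ) * h x.t

/-- A `K`-invariant function orthogonal to all `exp (-a |u|²) χ(t)` vanishes. -/
theorem eq_zero_of_integral_gaussTensor {F : Hq → ℂ} (hF : AEStronglyMeasurable F)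
    (hK : KInvariant F)
    (hint : ∀ a : ℝ, 0 < a → Integrable fun x => F x * gaussTensor a (fun t => weight t) x)
    (h0 : ∀ a : ℝ, 0 < a → ∀ χ : E3 → ℝ, ContDiff ℝ (⊤ : ℕ∞) χ → HasCompactSupport χ →
      ∫ x, F x * gaussTensor a (fun t => χ t) x = 0) :
    F =ᵐ[volume] 0 := by
  obtain ⟨F₀, hF₀, hFF₀⟩ := exists_radial hF hK
  let e : ℕ → ℍ[ℝ] → ℂ := fun k u => (Real.exp (-((k + 1 : ℕ) * ‖u‖ ^ 2)) : ℂ)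
  have hk : ∀ k : ℕ, (0 : ℝ) < (k + 1 : ℕ) := fun k => by positivity
  have hi : ∀ k, Integrable (fun p : ℍ[ℝ] × E3 =>
      F₀ (‖p.1‖, p.2) * (e k p.1 * (weight p.2 : ℂ))) (volume.prod volume) := by
    intro k
    refine (integrable_iff_prod _).1 ((hint _ (hk k)).congr ?_)
    filter_upwards [hFF₀] with x hx
    rw [hx]
    rfl
  -- For fixed `k` integrate out `u`. The resulting function of `t` vanishes against every bump `χ`,
  -- since `χ * weight` is again an admissible test function.
  have hG : ∀ k, ∀ᵐ t : E3, ∫ u : ℍ[ℝ], F₀ (‖u‖, t) * (e k u * (weight t : ℂ)) = 0 := by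
    intro k
    refine ae_eq_zero_of_integral_contDiff_smul_eq_zero
      (hi k).integral_prod_right.locallyIntegrable fun χ hχ hχs => ?_
    have hw := h0 _ (hk k) (fun t => χ t * weight t) (hχ.mul contDiff_weight) hχs.mul_right
    have hχi : Integrable (fun p : ℍ[ℝ] × E3 =>
        (χ p.2 : ℂ) * (F₀ (‖p.1‖, p.2) * (e k p.1 * (weight p.2 : ℂ)))) (volume.prod volume) := by
      obtain ⟨C, hC⟩ := hχs.exists_bound_of_continuous hχ.continuous
      refine (hi k).bdd_mul (c := C) ?_ (ae_of_all _ fun p => ?_)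
      · exact (Complex.measurable_ofReal.comp
          (hχ.continuous.measurable.comp measurable_snd)).aestronglyMeasurable
      · rw [Complex.norm_real]
        exact hC _
    have h1 : ∫ t, χ t • ∫ u : ℍ[ℝ], F₀ (‖u‖, t) * (e k u * (weight t : ℂ)) =
        ∫ p : ℍ[ℝ] × E3, (χ p.2 : ℂ) * (F₀ (‖p.1‖, p.2) * (e k p.1 * (weight p.2 : ℂ))) := by
      rw [Measure.volume_eq_prod, integral_prod_symm _ hχi]
      refine integral_congr_ae (ae_of_all _ fun t => ?_)
      simp only [Complex.real_smul, integral_const_mul]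
    rw [h1, ← integral_eq_prod, ← hw]
    refine integral_congr_ae ?_
    filter_upwards [hFF₀] with x hx
    rw [hx]
    simp only [gaussTensor, e]
    push_cast
    ring
  have ht : ∀ᵐ t : E3, ∀ᵐ u : ℍ[ℝ], F₀ (‖u‖, t) = 0 := by
    filter_upwards [ae_all_iff.2 hG, (hi 0).prod_left_ae] with t h1 h2
    have hwt : (weight t : ℂ) ≠ 0 := by exact_mod_cast (weight_pos t).ne'
    refine radial_eq_zero (A₀ := fun r => F₀ (r, t))
      (hF₀.measurable.comp measurable_prodMk_right) ?_ fun k => ?_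
    · refine (h2.mul_const (weight t : ℂ)⁻¹).congr (ae_of_all _ fun u => ?_)
      simp only [e]
      field_simp
      simp
    · have := h1 k
      simp only [← mul_assoc, integral_mul_const] at this
      exact (mul_eq_zero.1 this).resolve_right hwt
  have hm : MeasurableSet {p : ℍ[ℝ] × E3 | F₀ (‖p.1‖, p.2) = 0} :=
    (hF₀.measurable.comp (measurable_fst.norm.prodMk measurable_snd)) (measurableSet_singleton 0)
  have hp : ∀ᵐ p : ℍ[ℝ] × E3, F₀ (‖p.1‖, p.2) = 0 := by
    rw [Measure.volume_eq_prod, Measure.ae_prod_iff_ae_ae hm]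
    exact (Measure.ae_ae_comm (p := fun (u : ℍ[ℝ]) (t : E3) => F₀ (‖u‖, t) = 0) hm).2 ht
  filter_upwards [hFF₀, ae_iff_prod.2 hp] with x h1 h2
  rw [h1, h2]
  rfl

/-! ### Laguerre polynomials and Gaussian integrals -/

open Real in
theorem integrable_pow_mul_gauss {b : ℝ} (hb : 0 < b) (j : ℕ) :
    Integrable fun v : ℍ[ℝ] => ‖v‖ ^ (2 * j) * exp (-(b * ‖v‖ ^ 2)) := by
  have h := integrable_fun_norm_addHaar (volume : Measure ℍ[ℝ])
    (f := fun r => r ^ (2 * j) * exp (-(b * r ^ 2)))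
  rw [h, Quaternion.finrank_eq_four]
  have h2 := integrableOn_rpow_mul_exp_neg_mul_rpow (p := 2) (s := (2 * j + 3 : ℕ)) (b := b)
    (by have : (0 : ℝ) ≤ (2 * j + 3 : ℕ) := Nat.cast_nonneg _
        linarith) two_pos hb
  refine h2.congr_fun (fun x _ => ?_) measurableSet_Ioi
  simp only [rpow_natCast, smul_eq_mul, rpow_ofNat]
  ring_nf

open Real in
theorem integral_pow_mul_gauss {b : ℝ} (hb : 0 < b) (j : ℕ) :
    ∫ v : ℍ[ℝ], ‖v‖ ^ (2 * j) * exp (-(b * ‖v‖ ^ 2)) =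
      π ^ 2 * (j + 1).factorial / b ^ (j + 2) := by
  have h := integral_fun_norm_addHaar (volume : Measure ℍ[ℝ])
    (fun r => r ^ (2 * j) * exp (-(b * r ^ 2)))
  have hball : (volume : Measure ℍ[ℝ]).real (Metric.ball 0 1) = π ^ 2 / 2 := by
    rw [measureReal_def, InnerProductSpace.volume_ball_of_dim_even (k := 2)
      (by rw [Quaternion.finrank_eq_four])]
    simp [Nat.factorial, ENNReal.toReal_ofReal (by positivity : (0 : ℝ) ≤ π ^ 2 / 2)]
  have h2 := integral_rpow_mul_exp_neg_mul_rpow (p := 2) (q := (2 * j + 3 : ℕ)) (b := b) two_pos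
    (by have : (0 : ℝ) ≤ (2 * j + 3 : ℕ) := Nat.cast_nonneg _
        linarith) hb
  have e1 : (((2 * j + 3 : ℕ) : ℝ) + 1) / 2 = ((j + 1 : ℕ) : ℝ) + 1 := by
    push_cast
    ring
  have e2 : -(((2 * j + 3 : ℕ) : ℝ) + 1) / 2 = -((j + 2 : ℕ) : ℝ) := by
    push_cast
    ring
  rw [e1, e2, Gamma_nat_eq_factorial, rpow_neg hb.le, rpow_natCast] at h2
  rw [h, Quaternion.finrank_eq_four, hball]
  have h3 : ∫ y in Set.Ioi (0 : ℝ), y ^ (4 - 1) • (y ^ (2 * j) * exp (-(b * y ^ 2))) =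
      ∫ x in Set.Ioi (0 : ℝ), x ^ ((2 * j + 3 : ℕ) : ℝ) * exp (-b * x ^ (2 : ℝ)) := by
    refine setIntegral_congr_fun measurableSet_Ioi fun x _ => ?_
    simp only [rpow_natCast, smul_eq_mul, rpow_ofNat]
    ring_nf
  rw [h3, h2]
  simp only [nsmul_eq_mul, smul_eq_mul]
  push_cast
  field_simp
  ring

/-- The spherical transform of `exp (-a |u|²)` at a character of norm `l`. -/
def gam (a l : ℝ) (n : ℕ) : ℝ := Real.pi ^ 2 / (a + l) ^ 2 * ((a - l) / (a + l)) ^ n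

/-- The radial part `exp (-l ρ) L_n^1(2 l ρ) / (n + 1)` of a spherical function. -/
def psi (l : ℝ) (n : ℕ) (ρ : ℝ) : ℝ :=
  Real.exp (-(l * ρ)) * laguerre1 n (2 * l * ρ) / (n + 1)

theorem phi_eq (p : Dual) (x : Hq) :
    phi p x = Complex.exp (Complex.I * ((inner ℝ p.1 x.t : ℝ) : ℂ)) *
      (psi ‖p.1‖ p.2 (‖x.u‖ ^ 2) : ℂ) := by
  simp only [phi, psi]

-- Integrating the Laguerre polynomial termwise against Gaussian moments leaves the binomial
-- expansion of `(1 - 2l/(a+l))^n = ((a-l)/(a+l))^n`, thanks to `(j+1) C(n+1, j+1) = (n+1) C(n, j)`.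
open Real in
theorem hasIntegral_gauss_mul_psi {a l : ℝ} (ha : 0 < a) (hl : 0 ≤ l) (n : ℕ) :
    Integrable (fun v : ℍ[ℝ] => exp (-(a * ‖v‖ ^ 2)) * psi l n (‖v‖ ^ 2)) ∧
    ∫ v : ℍ[ℝ], exp (-(a * ‖v‖ ^ 2)) * psi l n (‖v‖ ^ 2) = gam a l n := by
  have hb : 0 < a + l := by linarith
  have e : ∀ v : ℍ[ℝ], exp (-(a * ‖v‖ ^ 2)) * psi l n (‖v‖ ^ 2) =
      ∑ j ∈ Finset.range (n + 1), ((-1) ^ j * (Nat.choose (n + 1) (n - j) : ℝ) * (2 * l) ^ j /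
        (j.factorial : ℝ) / (n + 1)) * (‖v‖ ^ (2 * j) * exp (-((a + l) * ‖v‖ ^ 2))) := by
    intro v
    rw [psi, laguerre1, Finset.mul_sum, Finset.sum_div, Finset.mul_sum]
    refine Finset.sum_congr rfl fun j _ => ?_
    rw [show -((a + l) * ‖v‖ ^ 2) = -(a * ‖v‖ ^ 2) + -(l * ‖v‖ ^ 2) by ring, exp_add, mul_pow _ (‖v‖ ^ 2), pow_mul]
    ring
  simp only [e]
  constructor
  · exact integrable_finsetSum _ fun j _ => (integrable_pow_mul_gauss hb j).const_mul _
  · rw [integral_finsetSum _ fun j _ => (integrable_pow_mul_gauss hb j).const_mul _]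
    simp only [integral_const_mul, integral_pow_mul_gauss hb]
    rw [gam, show (a - l) / (a + l) = -(2 * l / (a + l)) + 1 by field_simp; ring,
      add_pow (-(2 * l / (a + l))) 1 n, Finset.mul_sum]
    refine Finset.sum_congr rfl fun j hj => ?_
    have hjn : j ≤ n := Nat.lt_succ_iff.1 (Finset.mem_range.1 hj)
    have hc : ((n + 1).choose (n - j) : ℝ) * (j + 1) = (n + 1) * (n.choose j : ℝ) := by
      have h1 : (n + 1).choose (n - j) = (n + 1).choose (j + 1) := by
        rw [← Nat.choose_symm_of_eq_add]
        omega
      rw [h1]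
      exact_mod_cast (Nat.add_one_mul_choose_eq n j).symm
    rw [Nat.factorial_succ, neg_pow (2 * l / (a + l)), div_pow, one_pow, pow_add]
    push_cast
    have : (j.factorial : ℝ) ≠ 0 := by positivity
    have hn : (n : ℝ) + 1 ≠ 0 := by positivity
    field_simp
    linear_combination (2 * l) ^ j * hc

/-- The generating function of the Laguerre polynomials. -/
theorem hasSum_laguerre1 {r : ℝ} (hr : |r| < 1) (x : ℝ) :
    HasSum (fun n => laguerre1 n x * r ^ n) (1 / (1 - r) ^ 2 * Real.exp (-(r * x / (1 - r)))) := by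
  -- The double series is indexed by `(j, m)` with `n = j + m`. Summing over `m` first is the
  -- negative binomial series and leaves an exponential series in `j`; summing along antidiagonals
  -- gives the Laguerre polynomials. The comparison series `T |x| |r|` justifies the rearrangement.
  let T : ℝ → ℝ → ℕ × ℕ → ℝ := fun x r q =>
    x ^ q.1 / (q.1.factorial : ℝ) * r ^ q.1 * (((q.2 + (q.1 + 1)).choose (q.1 + 1) : ℝ) * r ^ q.2)
  have hrow : ∀ {s : ℝ} (_ : |s| < 1) (y : ℝ) (j : ℕ), HasSum (fun m => T y s (j, m))
      (1 / (1 - s) ^ 2 * ((s * y / (1 - s)) ^ j / (j.factorial : ℝ))) := by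
    intro s hs y j
    have h := (hasSum_choose_mul_geometric_of_norm_lt_one (j + 1) (r := s)
      (by simpa using hs)).mul_left (y ^ j / (j.factorial : ℝ) * s ^ j)
    convert! h using 1
    have : 1 - s ≠ 0 := by
      have := (abs_lt.1 hs).2
      linarith
    rw [div_pow, mul_pow]
    field_simp
    ring
  have hnn : ∀ q, 0 ≤ T |x| |r| q := fun q => by positivity
  have habs : Summable (T |x| |r|) := by
    refine (summable_prod_of_nonneg hnn).2 ⟨fun j => (hrow (by simpa using hr) _ j).summable, ?_⟩
    simp only [fun j => (hrow (s := |r|) (by simpa using hr) |x| j).tsum_eq]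
    exact (Real.summable_pow_div_factorial _).mul_left _
  have hsum : Summable (T (-x) r) := by
    refine Summable.of_norm_bounded habs fun q => ?_
    simp only [T, norm_mul, norm_div, norm_pow, Real.norm_eq_abs, abs_neg, Nat.abs_cast]
    exact le_rfl
  have h1 : ∑' q, T (-x) r q = 1 / (1 - r) ^ 2 * Real.exp (-(r * x / (1 - r))) := by
    rw [hsum.tsum_prod' fun j => (hrow hr _ j).summable]
    simp only [fun j => (hrow hr (-x) j).tsum_eq]
    rw [tsum_mul_left, Real.exp_eq_exp_ℝ, NormedSpace.exp_eq_tsum_div]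
    congr 2
    ext j
    congr 2
    ring
  have h2 : HasSum (T (-x) r) (1 / (1 - r) ^ 2 * Real.exp (-(r * x / (1 - r)))) :=
    h1 ▸ hsum.hasSum
  rw [← Finset.HasAntidiagonal.sigmaAntidiagonalEquivProd.hasSum_iff] at h2
  have h3 := h2.sigma fun n => hasSum_fintype _
  convert! h3 using 1
  ext n
  rw [Finset.univ_eq_attach]
  refine Eq.trans ?_ (Finset.sum_attach (Finset.HasAntidiagonal.antidiagonal n)
    (fun q => T (-x) r q)).symm
  rw [Finset.Nat.sum_antidiagonal_eq_sum_range_succ_mk, laguerre1, Finset.sum_mul]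
  refine Finset.sum_congr rfl fun j hj => ?_
  have hjn : j ≤ n := Nat.lt_succ_iff.1 (Finset.mem_range.1 hj)
  have hc : (n + 1).choose (n - j) = (n - j + (j + 1)).choose (j + 1) := by
    rw [show n - j + (j + 1) = n + 1 by omega, ← Nat.choose_symm_of_eq_add]
    omega
  simp only [T]
  rw [hc, neg_pow x, show r ^ n = r ^ j * r ^ (n - j) by rw [← pow_add]; congr 1; omega]
  ring

/-- Summation of spherical functions against the transform of a Gaussian. -/
theorem hasSum_gam_mul_psi {a l : ℝ} (ha : 0 < a) (hl : 0 < l) (ρ : ℝ) :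
    HasSum (fun n : ℕ => (n + 1) * l ^ 2 * (gam a l n * psi l n ρ))
      (Real.pi ^ 2 / 4 * Real.exp (-(a * ρ))) := by
  have hal : 0 < a + l := by linarith
  have hr : |(a - l) / (a + l)| < 1 := by
    rw [abs_div, abs_of_pos hal, div_lt_one hal, abs_lt]
    constructor <;> linarith
  -- The generating function at `r = (a-l)/(a+l)`, where `1 - r = 2l/(a+l)`: its prefactor cancels
  -- the `l²` of the density, and the exponents combine to `-aρ`.
  have h := (hasSum_laguerre1 hr (2 * l * ρ)).mul_left
    (l ^ 2 * (Real.pi ^ 2 / (a + l) ^ 2) * Real.exp (-(l * ρ)))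
  have e : 1 - (a - l) / (a + l) = 2 * l / (a + l) := by
    field_simp
    ring
  convert! h using 1
  · ext n
    have hn : (n : ℝ) + 1 ≠ 0 := by positivity
    rw [gam, psi]
    field_simp
  · rw [e]
    have e2 : -(a * ρ) = -(l * ρ) + -((a - l) / (a + l) * (2 * l * ρ) / (2 * l / (a + l))) := by
      field_simp
      ring
    rw [e2, Real.exp_add]
    field_simp
    ring

/-- A crude bound from `x^j / j! ≤ exp x`. It depends on `n` but not on `l` or `ρ`, and suffices
until `norm_phi_le_one` improves it to `1`. -/
theorem norm_psi_le_exists (n : ℕ) :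
    ∃ C : ℝ, 0 ≤ C ∧ ∀ l ρ : ℝ, 0 ≤ l → 0 ≤ ρ → |psi l n ρ| ≤ C := by
  refine ⟨∑ j ∈ Finset.range (n + 1), (Nat.choose (n + 1) (n - j) : ℝ) * 2 ^ j,
    Finset.sum_nonneg fun j _ => by positivity, fun l ρ hl hρ => ?_⟩
  have hx : 0 ≤ l * ρ := mul_nonneg hl hρ
  rw [psi, abs_div, abs_of_nonneg (by positivity : (0 : ℝ) ≤ n + 1), abs_mul,
    abs_of_pos (Real.exp_pos _)]
  refine (div_le_self (by positivity) (by linarith [(Nat.cast_nonneg n : (0 : ℝ) ≤ n)])).trans ?_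
  rw [laguerre1]
  refine (mul_le_mul_of_nonneg_left (Finset.abs_sum_le_sum_abs _ _) (Real.exp_pos _).le).trans ?_
  rw [Finset.mul_sum]
  refine Finset.sum_le_sum fun j _ => ?_
  have h1 := Real.pow_div_factorial_le_exp _ hx j
  rw [abs_div, abs_mul, abs_mul, abs_pow, abs_neg, abs_one, one_pow, one_mul, Nat.abs_cast,
    Nat.abs_cast, abs_of_nonneg (by positivity : (0 : ℝ) ≤ (2 * l * ρ) ^ j)]
  have h2 : Real.exp (-(l * ρ)) * ((l * ρ) ^ j / (j.factorial : ℝ)) ≤ 1 := by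
    rw [Real.exp_neg, inv_mul_le_iff₀ (Real.exp_pos _), mul_one]
    exact h1
  calc _ = (Nat.choose (n + 1) (n - j) : ℝ) * 2 ^ j *
        (Real.exp (-(l * ρ)) * ((l * ρ) ^ j / (j.factorial : ℝ))) := by
        rw [mul_assoc 2 l ρ, mul_pow]
        ring
    _ ≤ _ := mul_le_of_le_one_right (by positivity) h2

/-! ### Twisted convolution of Gaussians. -/

/-- The purely imaginary quaternion with given imaginary part. -/
def pureQuat (s : E3) : ℍ[ℝ] := ⟨0, s 0, s 1, s 2⟩

theorem norm_pureQuat (s : E3) : ‖pureQuat s‖ = ‖s‖ := by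
  rw [← sq_eq_sq₀ (norm_nonneg _) (norm_nonneg _), EuclideanSpace.norm_sq_eq, sq,
    ← Quaternion.normSq_eq_norm_mul_self, Quaternion.normSq_def']
  simp [pureQuat, Fin.sum_univ_three]

/-- Writes the phase of the group law as a linear functional of `w`. By `im3_star_self` the vector
representing it is orthogonal to `v`. -/
theorem inner_im3 (s : E3) (v w : ℍ[ℝ]) :
    inner ℝ s (im3 (star w * v)) = inner ℝ (-(v * pureQuat s)) w := by
  have h0 : (pureQuat s).re = 0 := rfl
  have h1 : (pureQuat s).imI = s 0 := rfl
  have h2 : (pureQuat s).imJ = s 1 := rfl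
  have h3 : (pureQuat s).imK = s 2 := rfl
  simp [im3, PiLp.inner_apply, Fin.sum_univ_three, Quaternion.inner_def, h0, h1, h2, h3]
  ring

theorem im3_star_self (v : ℍ[ℝ]) : im3 (star v * v) = 0 := by
  ext i
  fin_cases i <;> simp [im3] <;> ring

/-- The twisted convolution of two Gaussians is a Gaussian. -/
theorem integral_twisted_gauss {a b : ℝ} (ha : 0 < a) (hb : 0 < b) (s : E3) (v : ℍ[ℝ]) :
    ∫ w : ℍ[ℝ], (Real.exp (-(a * ‖v - w‖ ^ 2)) : ℂ) * (Real.exp (-(b * ‖w‖ ^ 2)) : ℂ) *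
        Complex.exp (-(2 * Complex.I * ((inner ℝ s (im3 (star w * v)) : ℝ) : ℂ))) =
      ((Real.pi / (a + b)) ^ 2 : ℝ) *
        (Real.exp (-((a * b + ‖s‖ ^ 2) / (a + b) * ‖v‖ ^ 2)) : ℂ) := by
  have hab : 0 < a + b := by linarith
  have hab' : (a : ℂ) + b ≠ 0 := by exact_mod_cast hab.ne'
  have hG := GaussianFourier.integral_cexp_neg_mul_sq_norm_add (V := ℍ[ℝ]) (b := ((a + b : ℝ) : ℂ))
    (by simpa using hab) (-(2 * Complex.I)) (-(v * pureQuat s))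
  -- The shift that completes the square. It is a multiple of `v`, so by orthogonality it leaves the
  -- phase unchanged.
  set z : ℍ[ℝ] := (a / (a + b)) • v with hz
  rw [← integral_add_right_eq_self _ z]
  have key : ∀ w : ℍ[ℝ],
      (Real.exp (-(a * ‖v - (w + z)‖ ^ 2)) : ℂ) * (Real.exp (-(b * ‖w + z‖ ^ 2)) : ℂ) *
        Complex.exp (-(2 * Complex.I * ((inner ℝ s (im3 (star (w + z) * v)) : ℝ) : ℂ))) =
      (Real.exp (-(a * b / (a + b) * ‖v‖ ^ 2)) : ℂ) *
        Complex.exp (-((a + b : ℝ) : ℂ) * (‖w‖ : ℂ) ^ 2 +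
          -(2 * Complex.I) * ((inner ℝ (-(v * pureQuat s)) w : ℝ) : ℂ)) := by
    intro w
    have h1 : inner ℝ s (im3 (star (w + z) * v)) = inner ℝ (-(v * pureQuat s)) w := by
      have : inner ℝ (-(v * pureQuat s)) z = 0 := by
        rw [hz, inner_smul_right, ← inner_im3, im3_star_self, inner_zero_right, mul_zero]
      rw [inner_im3, inner_add_right, this, add_zero]
    have h2 : a * ‖v - (w + z)‖ ^ 2 + b * ‖w + z‖ ^ 2 =
        a * b / (a + b) * ‖v‖ ^ 2 + (a + b) * ‖w‖ ^ 2 := by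
      rw [norm_sub_sq_real, norm_add_sq_real, inner_add_right, hz, inner_smul_right,
        inner_smul_right, real_inner_self_eq_norm_sq, norm_smul, Real.norm_eq_abs, mul_pow, sq_abs,
        real_inner_comm w v]
      field_simp
      ring
    rw [h1, ← Complex.ofReal_mul, ← Real.exp_add, ← neg_add, h2, neg_add, Real.exp_add,
      Complex.ofReal_mul, mul_assoc]
    congr 1
    rw [Complex.ofReal_exp, ← Complex.exp_add]
    congr 1
    push_cast
    ring
  simp only [key]
  rw [integral_const_mul, hG, Quaternion.finrank_eq_four]
  have e1 : ((4 : ℕ) / 2 : ℂ) = (2 : ℕ) := by norm_num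
  rw [e1, Complex.cpow_natCast, norm_neg, norm_mul, norm_pureQuat, mul_left_comm,
    Complex.ofReal_exp, Complex.ofReal_exp, ← Complex.exp_add]
  push_cast
  congr 2
  have hI : Complex.I ^ 2 = -1 := Complex.I_sq
  field_simp
  rw [hI]
  ring

/-- With `c = (ab + l²)/(a + b)` one has `c ± l = (a ± l)(b ± l)/(a + b)`, so the ratios
`(a-l)/(a+l)` multiply. This is why the transform of a twisted product of Gaussians is the product
of their transforms. -/
theorem gam_mul_gam {a b l : ℝ} (ha : 0 < a) (hb : 0 < b) (hl : 0 ≤ l) (n : ℕ) :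
    (Real.pi / (a + b)) ^ 2 * gam ((a * b + l ^ 2) / (a + b)) l n = gam a l n * gam b l n := by
  have h1 : a + b ≠ 0 := by positivity
  have h2 : a + l ≠ 0 := by positivity
  have h3 : b + l ≠ 0 := by positivity
  have e1 : (a * b + l ^ 2) / (a + b) + l = (a + l) * (b + l) / (a + b) := by
    field_simp
    ring
  have e2 : (a * b + l ^ 2) / (a + b) - l = (a - l) * (b - l) / (a + b) := by
    field_simp
    ring
  have e3 : ((a - l) * (b - l) / (a + b)) / ((a + l) * (b + l) / (a + b)) =
      ((a - l) / (a + l)) * ((b - l) / (b + l)) := by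
    field_simp
  rw [gam, gam, gam, e1, e2, e3, mul_pow ((a - l) / (a + l))]
  field_simp

/-! ### Spherical functions and the spherical transform -/

theorem continuous_psi (n : ℕ) : Continuous fun q : ℝ × ℝ => psi q.1 n q.2 := by
  unfold psi laguerre1
  fun_prop

theorem measurable_phi : Measurable fun q : Dual × Hq => phi q.1 q.2 := by
  have h : Measurable fun q : ℕ × (E3 × Hq) => phi (q.2.1, q.1) q.2.2 := by
    refine measurable_from_prod_countable_right fun n => ?_
    have hc : Continuous fun r : E3 × (ℍ[ℝ] × E3) =>
        Complex.exp (Complex.I * ((inner ℝ r.1 r.2.2 : ℝ) : ℂ)) *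
          (psi ‖r.1‖ n (‖r.2.1‖ ^ 2) : ℂ) := by
      have := (continuous_psi n).comp (f := fun r : E3 × (ℍ[ℝ] × E3) => (‖r.1‖, ‖r.2.1‖ ^ 2))
        (by fun_prop)
      have h2 := Complex.continuous_ofReal.comp this
      exact Continuous.mul (by fun_prop) h2
    have := hc.measurable.comp (measurable_fst.prodMk
      (measEquiv.measurable.comp (measurable_snd (α := E3) (β := Hq))))
    simp only [phi_eq]
    exact this
  have h2 : Measurable fun q : Dual × Hq => (q.1.2, (q.1.1, q.2)) :=
    measurable_fst.snd.prodMk (measurable_fst.fst.prodMk measurable_snd)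
  have h3 := h.comp h2
  simpa only [Function.comp_def, Prod.mk.eta] using h3

theorem measurable_phi_right (p : Dual) : Measurable (phi p) :=
  Measurable.of_uncurry_left (f := phi) (x := p) measurable_phi

theorem norm_phi (p : Dual) (x : Hq) : ‖phi p x‖ = |psi ‖p.1‖ p.2 (‖x.u‖ ^ 2)| := by
  rw [phi_eq, norm_mul, mul_comm Complex.I, Complex.norm_exp_ofReal_mul_I, one_mul,
    Complex.norm_real, Real.norm_eq_abs]

theorem norm_phi_le_exists (n : ℕ) :
    ∃ C : ℝ, 0 ≤ C ∧ ∀ (lam : E3) (x : Hq), ‖phi (lam, n) x‖ ≤ C := by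
  obtain ⟨C, hC0, hC⟩ := norm_psi_le_exists n
  refine ⟨C, hC0, fun lam x => ?_⟩
  rw [norm_phi]
  exact hC _ _ (norm_nonneg _) (by positivity)

theorem norm_act_u (k : K) (x : Hq) : ‖(act k x).u‖ = ‖x.u‖ := by
  simp [act]

theorem phi_act (p : Dual) (k : K) (x : Hq) : phi p (act k x) = phi p x := by
  rw [phi_eq, phi_eq, norm_act_u]
  rfl

theorem integrable_mul_phi {f : Hq → ℂ} (hf : Integrable f) (p : Dual) :
    Integrable fun x => f x * phi p x := by
  obtain ⟨C, -, hC⟩ := norm_phi_le_exists p.2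
  exact hf.mul_bdd (c := C) (measurable_phi_right p).aestronglyMeasurable
    (ae_of_all _ fun x => hC p.1 x)

theorem gaussTensor_act (a : ℝ) (h : E3 → ℂ) (k : K) (x : Hq) :
    gaussTensor a h (act k x) = gaussTensor a h x := by
  rw [gaussTensor, gaussTensor, norm_act_u]
  rfl

theorem integrable_gauss {a : ℝ} (ha : 0 < a) :
    Integrable fun u : ℍ[ℝ] => Real.exp (-(a * ‖u‖ ^ 2)) := by
  simpa using integrable_pow_mul_gauss ha 0

theorem integrable_gaussTensor {a : ℝ} (ha : 0 < a) {h : E3 → ℂ} (hh : Integrable h) :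
    Integrable (gaussTensor a h) :=
  (integrable_iff_prod (fun q => (Real.exp (-(a * ‖q.1‖ ^ 2)) : ℂ) * h q.2)).2
    ((integrable_gauss ha).ofReal.mul_prod hh)

theorem L1sharp_gaussTensor {a : ℝ} (ha : 0 < a) {h : E3 → ℂ} (hh : Integrable h) :
    L1sharp (gaussTensor a h) :=
  ⟨integrable_gaussTensor ha hh, fun k => ae_of_all _ (gaussTensor_act a h k)⟩

theorem sphericalTransform_gaussTensor {a : ℝ} (ha : 0 < a) (h : E3 → ℂ) (p : Dual) :
    sphericalTransform (gaussTensor a h) p = (gam a ‖p.1‖ p.2 : ℂ) *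
      ∫ t, h t * Complex.exp (Complex.I * ((inner ℝ p.1 t : ℝ) : ℂ)) := by
  have h1 := integral_eq_prod (fun q : ℍ[ℝ] × E3 =>
    ((Real.exp (-(a * ‖q.1‖ ^ 2)) * psi ‖p.1‖ p.2 (‖q.1‖ ^ 2) : ℝ) : ℂ) *
      (h q.2 * Complex.exp (Complex.I * ((inner ℝ p.1 q.2 : ℝ) : ℂ))))
  rw [Measure.volume_eq_prod, integral_prod_mul (fun u : ℍ[ℝ] =>
    ((Real.exp (-(a * ‖u‖ ^ 2)) * psi ‖p.1‖ p.2 (‖u‖ ^ 2) : ℝ) : ℂ))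
    (fun t => h t * Complex.exp (Complex.I * ((inner ℝ p.1 t : ℝ) : ℂ))), integral_complex_ofReal,
    (hasIntegral_gauss_mul_psi ha (norm_nonneg _) _).2] at h1
  rw [← h1, sphericalTransform]
  refine integral_congr_ae (ae_of_all _ fun x => ?_)
  simp only [gaussTensor, phi_eq]
  push_cast
  ring

theorem integrable_weight : Integrable weight := by
  have := integrable_rpow_neg_one_add_norm_sq (E := E3) (μ := volume) (r := 4) (by simp; norm_num)
  refine this.congr (ae_of_all _ fun t => ?_)
  have h : (0 : ℝ) < 1 + ‖t‖ ^ 2 := by positivity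
  simp only [weight]
  rw [show (-4 / 2 : ℝ) = -((2 : ℕ) : ℝ) by norm_num, Real.rpow_neg h.le, Real.rpow_natCast, inv_pow]

theorem eq_zero_of_bounded {F : Hq → ℂ} (hF : AEStronglyMeasurable F) (hK : KInvariant F)
    {C : ℝ} (hC : ∀ x, ‖F x‖ ≤ C)
    (h0 : ∀ a : ℝ, 0 < a → ∀ χ : E3 → ℝ, ContDiff ℝ (⊤ : ℕ∞) χ → HasCompactSupport χ →
      ∫ x, F x * gaussTensor a (fun t => χ t) x = 0) :
    F =ᵐ[volume] 0 := by
  refine eq_zero_of_integral_gaussTensor hF hK (fun a ha => ?_) h0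
  exact (integrable_gaussTensor ha integrable_weight.ofReal).bdd_mul hF (ae_of_all _ hC)

/-- After the substitution `u = v - w` the factor `psi` depends on `v` alone, and the phase is
unchanged because `im3 (star w * w) = 0`. The inner integral is then a twisted convolution of
Gaussians, and `gam_mul_gam` finishes. -/
theorem integral_twisted_psi {a b : ℝ} (ha : 0 < a) (hb : 0 < b) (s : E3) (n : ℕ) :
    ∫ u : ℍ[ℝ], (Real.exp (-(a * ‖u‖ ^ 2)) : ℂ) * ∫ w : ℍ[ℝ], (Real.exp (-(b * ‖w‖ ^ 2)) : ℂ) *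
      (Complex.exp (-(2 * Complex.I * ((inner ℝ s (im3 (star w * u)) : ℝ) : ℂ))) *
        (psi ‖s‖ n (‖u + w‖ ^ 2) : ℂ)) = (gam a ‖s‖ n : ℂ) * (gam b ‖s‖ n : ℂ) := by
  let B : ℍ[ℝ] × ℍ[ℝ] → ℂ := fun q =>
    Complex.exp (-(2 * Complex.I * ((inner ℝ s (im3 (star q.2 * q.1)) : ℝ) : ℂ))) *
        (psi ‖s‖ n (‖q.1 + q.2‖ ^ 2) : ℂ)
  let A : ℍ[ℝ] × ℍ[ℝ] → ℂ := fun q => ((Real.exp (-(a * ‖q.1‖ ^ 2)) : ℂ) *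
    (Real.exp (-(b * ‖q.2‖ ^ 2)) : ℂ)) * B q
  have hBc : Continuous B := by
    refine Continuous.mul (by fun_prop) (Complex.continuous_ofReal.comp ?_)
    exact (continuous_psi n).comp (f := fun q : ℍ[ℝ] × ℍ[ℝ] => (‖s‖, ‖q.1 + q.2‖ ^ 2))
      (by fun_prop)
  have hA : Integrable A (volume.prod volume) := by
    obtain ⟨C, hC0, hC⟩ := norm_psi_le_exists n
    refine ((integrable_gauss ha).ofReal.mul_prod (integrable_gauss hb).ofReal).mul_bdd (c := C)
      hBc.measurable.aestronglyMeasurable (ae_of_all _ fun q => ?_)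
    have e : -(2 * Complex.I * ((inner ℝ s (im3 (star q.2 * q.1)) : ℝ) : ℂ)) =
        ((-2 * inner ℝ s (im3 (star q.2 * q.1)) : ℝ) : ℂ) * Complex.I := by
      push_cast
      ring
    rw [norm_mul, e, Complex.norm_exp_ofReal_mul_I, one_mul, Complex.norm_real]
    exact hC _ _ (norm_nonneg _) (by positivity)
  have hmp := measurePreserving_sub_prod (volume : Measure ℍ[ℝ]) (volume : Measure ℍ[ℝ])
  have hmap : ∫ q, A q ∂(volume.prod volume) =
      ∫ q : ℍ[ℝ] × ℍ[ℝ], A (q.1 - q.2, q.2) ∂(volume.prod volume) := by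
    conv_lhs => rw [← hmp.map_eq]
    exact integral_map hmp.measurable.aemeasurable
      (by rw [hmp.map_eq]; exact hA.aestronglyMeasurable)
  have hA' : Integrable (fun q : ℍ[ℝ] × ℍ[ℝ] => A (q.1 - q.2, q.2)) (volume.prod volume) :=
    hmp.integrable_comp_of_integrable hA
  have h1 : ∀ v : ℍ[ℝ], ∫ w : ℍ[ℝ], A (v - w, w) = ((Real.pi / (a + b)) ^ 2 : ℝ) *
      ((Real.exp (-((a * b + ‖s‖ ^ 2) / (a + b) * ‖v‖ ^ 2)) * psi ‖s‖ n (‖v‖ ^ 2) : ℝ) : ℂ) := by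
    intro v
    have e : ∀ w, A (v - w, w) = ((Real.exp (-(a * ‖v - w‖ ^ 2)) : ℂ) *
        (Real.exp (-(b * ‖w‖ ^ 2)) : ℂ) *
        Complex.exp (-(2 * Complex.I * ((inner ℝ s (im3 (star w * v)) : ℝ) : ℂ)))) *
          (psi ‖s‖ n (‖v‖ ^ 2) : ℂ) := by
      intro w
      have h2 : inner ℝ s (im3 (star w * (v - w))) = inner ℝ s (im3 (star w * v)) := by
        have : inner ℝ (-(w * pureQuat s)) w = 0 := by
          rw [← inner_im3, im3_star_self, inner_zero_right]
        have h3 : im3 (star w * (v - w)) = im3 (star w * v) - im3 (star w * w) := by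
          rw [mul_sub]
          ext i
          fin_cases i <;> simp [im3]
        rw [h3, im3_star_self, sub_zero]
      simp only [A, B, h2, sub_add_cancel]
      ring
    simp only [e, integral_mul_const, integral_twisted_gauss ha hb]
    push_cast
    ring
  calc _ = ∫ u : ℍ[ℝ], ∫ w : ℍ[ℝ], A (u, w) := by
        refine integral_congr_ae (ae_of_all _ fun u => ?_)
        simp only [← integral_const_mul]
        refine integral_congr_ae (ae_of_all _ fun w => ?_)
        simp only [A, B]
        ring
    _ = ∫ q, A q ∂(volume.prod volume) := (integral_prod _ hA).symm
    _ = ∫ v : ℍ[ℝ], ∫ w : ℍ[ℝ], A (v - w, w) := by rw [hmap, integral_prod _ hA']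
    _ = _ := by
        have hc : 0 < (a * b + ‖s‖ ^ 2) / (a + b) := by positivity
        simp only [h1]
        rw [integral_const_mul, integral_complex_ofReal,
          (hasIntegral_gauss_mul_psi hc (norm_nonneg s) n).2, ← Complex.ofReal_mul,
          gam_mul_gam ha hb (norm_nonneg s), Complex.ofReal_mul]

theorem integral_gaussTensor_mul_phi_mul {a b : ℝ} (ha : 0 < a) (hb : 0 < b) (h k : E3 → ℂ)
    (p : Dual) :
    ∫ y, gaussTensor a h y * ∫ z, gaussTensor b k z * phi p (y * z) =
      sphericalTransform (gaussTensor a h) p * sphericalTransform (gaussTensor b k) p := by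
  let e : E3 → ℂ := fun t => Complex.exp (Complex.I * ((inner ℝ p.1 t : ℝ) : ℂ))
  let Q : ℍ[ℝ] → ℂ := fun u => ∫ w : ℍ[ℝ], (Real.exp (-(b * ‖w‖ ^ 2)) : ℂ) *
      (Complex.exp (-(2 * Complex.I * ((inner ℝ p.1 (im3 (star w * u)) : ℝ) : ℂ))) *
        (psi ‖p.1‖ p.2 (‖u + w‖ ^ 2) : ℂ))
  have h1 : ∀ y : Hq, ∫ z, gaussTensor b k z * phi p (y * z) = e y.t * (Q y.u * ∫ t, k t * e t) := by
    intro y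
    have h2 := integral_eq_prod (fun q : ℍ[ℝ] × E3 => ((Real.exp (-(b * ‖q.1‖ ^ 2)) : ℂ) *
      (Complex.exp (-(2 * Complex.I * ((inner ℝ p.1 (im3 (star q.1 * y.u)) : ℝ) : ℂ))) *
        (psi ‖p.1‖ p.2 (‖y.u + q.1‖ ^ 2) : ℂ))) * (k q.2 * e q.2))
    rw [Measure.volume_eq_prod, integral_prod_mul (fun w : ℍ[ℝ] =>
      (Real.exp (-(b * ‖w‖ ^ 2)) : ℂ) *
      (Complex.exp (-(2 * Complex.I * ((inner ℝ p.1 (im3 (star w * y.u)) : ℝ) : ℂ))) *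
        (psi ‖p.1‖ p.2 (‖y.u + w‖ ^ 2) : ℂ))) (fun t => k t * e t)] at h2
    rw [← h2, ← integral_const_mul]
    refine integral_congr_ae (ae_of_all _ fun z => ?_)
    simp only [gaussTensor, phi_eq, mul_def, e]
    have h3 : Complex.exp (Complex.I * ((inner ℝ p.1
          (y.t + z.t - (2 : ℝ) • im3 (star z.u * y.u)) : ℝ) : ℂ)) =
        Complex.exp (Complex.I * ((inner ℝ p.1 y.t : ℝ) : ℂ)) *
        Complex.exp (Complex.I * ((inner ℝ p.1 z.t : ℝ) : ℂ)) *
        Complex.exp (-(2 * Complex.I * ((inner ℝ p.1 (im3 (star z.u * y.u)) : ℝ) : ℂ))) := by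
      rw [← Complex.exp_add, ← Complex.exp_add, inner_sub_right, inner_add_right, inner_smul_right]
      congr 1
      push_cast
      ring
    rw [h3]
    ring
  simp only [h1]
  have h2 := integral_eq_prod (fun q : ℍ[ℝ] × E3 =>
    ((Real.exp (-(a * ‖q.1‖ ^ 2)) : ℂ) * Q q.1) * (h q.2 * e q.2))
  rw [Measure.volume_eq_prod, integral_prod_mul (fun u : ℍ[ℝ] =>
    (Real.exp (-(a * ‖u‖ ^ 2)) : ℂ) * Q u) (fun t => h t * e t), integral_twisted_psi ha hb] at h2
  rw [sphericalTransform_gaussTensor ha, sphericalTransform_gaussTensor hb]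
  calc _ = (∫ x : Hq, ((Real.exp (-(a * ‖x.u‖ ^ 2)) : ℂ) * Q x.u) * (h x.t * e x.t)) *
        ∫ t, k t * e t := by
        rw [← integral_mul_const]
        refine integral_congr_ae (ae_of_all _ fun x => ?_)
        simp only [gaussTensor]
        ring
    _ = _ := by
        rw [h2]
        ring

/-! ### Multiplicativity of the spherical transform -/

theorem sphericalTransform_conv_eq {f g : Hq → ℂ} (hf : Integrable f) (hg : Integrable g)
    (p : Dual) :
    sphericalTransform (conv f g) p = ∫ y, f y * ∫ z, g z * phi p (y * z) := by
  obtain ⟨C, -, hC⟩ := norm_phi_le_exists p.2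
  have hH : Integrable (fun q : Hq × Hq => f q.1 * g q.2 * phi p (q.1 * q.2))
      (volume.prod volume) :=
    (hf.mul_prod hg).mul_bdd (c := C)
      ((measurable_phi_right p).comp measurable_mul).aestronglyMeasurable
      (ae_of_all _ fun q => hC p.1 _)
  have hmp := measurePreserving_prod_inv_mul_swap (volume : Measure Hq) (volume : Measure Hq)
  have hH' : Integrable (fun q : Hq × Hq => f q.2 * g (q.2⁻¹ * q.1) * phi p q.1)
      (volume.prod volume) := by
    refine (hmp.integrable_comp_of_integrable hH).congr (ae_of_all _ fun q => ?_)
    simp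
  have h1 : ∫ q : Hq × Hq, f q.1 * g q.2 * phi p (q.1 * q.2) ∂(volume.prod volume) =
      ∫ q : Hq × Hq, f q.2 * g (q.2⁻¹ * q.1) * phi p q.1 ∂(volume.prod volume) := by
    conv_lhs => rw [← hmp.map_eq]
    rw [integral_map hmp.measurable.aemeasurable
      (by rw [hmp.map_eq]; exact hH.aestronglyMeasurable)]
    simp
  calc _ = ∫ x, ∫ y, f y * g (y⁻¹ * x) * phi p x := by
        simp only [sphericalTransform, conv, integral_mul_const]
    _ = ∫ y, ∫ z, f y * g z * phi p (y * z) := by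
        rw [← integral_prod _ hH', ← h1, integral_prod _ hH]
    _ = _ := by simp only [mul_assoc, integral_const_mul]

/-- Pairing a `K`-invariant integrable function with a bounded `K`-invariant kernel. -/
theorem kernel_pairing {κ : Hq → Hq → ℂ} (hκ : Measurable fun q : Hq × Hq => κ q.1 q.2) {C : ℝ}
    (hC : ∀ y z, ‖κ y z‖ ≤ C) (hκK : ∀ k y z, κ (act k y) (act k z) = κ y z)
    {g : Hq → ℂ} (hg : L1sharp g) :
    AEStronglyMeasurable (fun y => ∫ z, g z * κ y z) ∧ KInvariant (fun y => ∫ z, g z * κ y z) ∧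
      ∀ y, ‖∫ z, g z * κ y z‖ ≤ C * ∫ z, ‖g z‖ := by
  refine ⟨?_, fun k => ae_of_all _ fun y => ?_, fun y => ?_⟩
  · exact (hg.1.aestronglyMeasurable.comp_snd.mul hκ.aestronglyMeasurable).integral_prod_right'
  · change ∫ z, g z * κ (act k y) z = ∫ z, g z * κ y z
    rw [← (measurePreserving_act k).integral_comp (actEmbedding k)]
    refine integral_congr_ae ?_
    filter_upwards [hg.2 k] with z hz
    rw [hz, hκK]
  · rw [← integral_const_mul]
    refine norm_integral_le_of_norm_le (hg.1.norm.const_mul _) (ae_of_all _ fun z => ?_)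
    rw [norm_mul, mul_comm]
    exact mul_le_mul_of_nonneg_right (hC y z) (norm_nonneg _)

/-- A bounded `K`-invariant kernel that annihilates pairs of Gaussian tensors annihilates all pairs
of `K`-invariant integrable functions. -/
theorem kernel_pairing_eq_zero {κ : Hq → Hq → ℂ} (hκ : Measurable fun q : Hq × Hq => κ q.1 q.2)
    {C : ℝ} (hC : ∀ y z, ‖κ y z‖ ≤ C) (hκK : ∀ k y z, κ (act k y) (act k z) = κ y z)
    (h0 : ∀ a b : ℝ, 0 < a → 0 < b → ∀ h k : E3 → ℂ, Integrable h → Integrable k →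
      ∫ y, gaussTensor a h y * ∫ z, gaussTensor b k z * κ y z = 0)
    {f g : Hq → ℂ} (hf : L1sharp f) (hg : L1sharp g) :
    ∫ y, f y * ∫ z, g z * κ y z = 0 := by
  have hint : ∀ {f g : Hq → ℂ}, L1sharp f → L1sharp g →
      Integrable (fun q : Hq × Hq => f q.1 * (g q.2 * κ q.1 q.2)) (volume.prod volume) := by
    intro f g hf hg
    refine ((hf.1.mul_prod hg.1).mul_bdd (c := C) hκ.aestronglyMeasurable
      (ae_of_all _ fun q => hC _ _)).congr (ae_of_all _ fun q => ?_)
    simp only [mul_assoc]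
  have hswap : ∀ {f g : Hq → ℂ}, L1sharp f → L1sharp g →
      ∫ y, f y * ∫ z, g z * κ y z = ∫ z, g z * ∫ y, f y * κ y z := by
    intro f g hf hg
    simp only [← integral_const_mul]
    rw [integral_integral_swap (hint hf hg)]
    refine integral_congr_ae (ae_of_all _ fun z => integral_congr_ae (ae_of_all _ fun y => ?_))
    simp only
    ring
  have hχ1 : ∀ {χ : E3 → ℝ}, ContDiff ℝ (⊤ : ℕ∞) χ → HasCompactSupport χ →
      Integrable (fun t => (χ t : ℂ)) := fun hχ hs =>
    (hχ.continuous.integrable_of_hasCompactSupport hs).ofReal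
  -- One factor is generalised at a time. With a Gaussian tensor in the second slot, the inner
  -- integral is a bounded `K`-invariant function orthogonal to all Gaussian tensors, hence zero
  -- almost everywhere. After exchanging the roles the same argument frees the second slot.
  have hf1 : ∀ {b : ℝ} (_ : 0 < b) {k : E3 → ℂ} (_ : Integrable k),
      ∫ y, f y * ∫ z, gaussTensor b k z * κ y z = 0 := by
    intro b hb k hk
    obtain ⟨h1, h2, h3⟩ := kernel_pairing hκ hC hκK (L1sharp_gaussTensor hb hk)
    have := eq_zero_of_bounded h1 h2 h3 fun a ha χ hχ hs => by
      simp only [mul_comm _ (gaussTensor a _ _)]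
      exact h0 a b ha hb _ k (hχ1 hχ hs) hk
    rw [integral_congr_ae (g := fun _ => 0)]
    · simp
    · filter_upwards [this] with y hy
      rw [hy]
      simp
  rw [hswap hf hg]
  obtain ⟨h1, h2, h3⟩ := kernel_pairing (κ := fun z y => κ y z)
    (hκ.comp measurable_swap) (fun z y => hC y z) (fun k z y => hκK k y z) hf
  have := eq_zero_of_bounded h1 h2 h3 fun b hb χ hχ hs => by
    simp only [mul_comm _ (gaussTensor b _ _)]
    rw [← hswap hf (L1sharp_gaussTensor hb (hχ1 hχ hs))]
    exact hf1 hb (hχ1 hχ hs)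
  rw [integral_congr_ae (g := fun _ => 0)]
  · simp
  · filter_upwards [this] with y hy
    rw [hy]
    simp

/-- The kernel `phi (y z) - phi y phi z` need not vanish, but it is bounded, invariant under the
diagonal action of `K`, and annihilates pairs of Gaussian tensors. By completeness it annihilates
all `K`-invariant pairs. -/
theorem sphericalTransform_conv {f g : Hq → ℂ} (hf : L1sharp f) (hg : L1sharp g) (p : Dual) :
    sphericalTransform (conv f g) p = sphericalTransform f p * sphericalTransform g p := by
  obtain ⟨C, hC0, hC⟩ := norm_phi_le_exists p.2
  have hm := measurable_phi_right p
  have hsplit : ∀ {f g : Hq → ℂ}, Integrable f → Integrable g →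
      ∫ y, f y * ∫ z, g z * (phi p (y * z) - phi p y * phi p z) =
        (∫ y, f y * ∫ z, g z * phi p (y * z)) -
          sphericalTransform f p * sphericalTransform g p := by
    intro f g hf hg
    have hz : ∀ y, Integrable fun z => g z * phi p (y * z) := fun y =>
      hg.mul_bdd (c := C) (hm.comp (measurable_const_mul y)).aestronglyMeasurable
        (ae_of_all _ fun z => hC p.1 _)
    have hy : Integrable fun y => f y * ∫ z, g z * phi p (y * z) := by
      have : Integrable (fun q : Hq × Hq => f q.1 * g q.2 * phi p (q.1 * q.2))
          (volume.prod volume) :=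
        (hf.mul_prod hg).mul_bdd (c := C) (hm.comp measurable_mul).aestronglyMeasurable
          (ae_of_all _ fun q => hC p.1 _)
      simpa only [mul_assoc, integral_const_mul] using this.integral_prod_left
    have e : ∀ y, f y * ∫ z, g z * (phi p (y * z) - phi p y * phi p z) =
        f y * (∫ z, g z * phi p (y * z)) - f y * phi p y * sphericalTransform g p := by
      intro y
      have : ∀ z, g z * (phi p (y * z) - phi p y * phi p z) =
          g z * phi p (y * z) - phi p y * (g z * phi p z) := fun z => by ring
      simp only [this]
      rw [integral_sub (hz y) ((integrable_mul_phi hg p).const_mul _), integral_const_mul,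
        sphericalTransform]
      ring
    simp only [e]
    rw [integral_sub hy ((integrable_mul_phi hf p).mul_const _), integral_mul_const]
    rfl
  have h := kernel_pairing_eq_zero (κ := fun y z => phi p (y * z) - phi p y * phi p z)
    (C := C + C * C)
    ((hm.comp measurable_mul).sub ((hm.comp measurable_fst).mul (hm.comp measurable_snd)))
    (fun y z => (norm_sub_le _ _).trans (by
      rw [norm_mul]
      gcongr <;> exact hC p.1 _))
    (fun k y z => by rw [← act_mul, phi_act, phi_act, phi_act])
    (fun a b ha hb h k hh hk => by
      rw [hsplit (integrable_gaussTensor ha hh) (integrable_gaussTensor hb hk),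
        integral_gaussTensor_mul_phi_mul ha hb, sub_self])
    hf hg
  rw [hsplit hf.1 hg.1, sub_eq_zero] at h
  rw [sphericalTransform_conv_eq hf.1 hg.1, h]

theorem L1sharp.conv {f g : Hq → ℂ} (hf : L1sharp f) (hg : L1sharp g) : L1sharp (conv f g) :=
  ⟨integrable_conv hf.1 hg.1, hf.2.conv hg.2⟩

/-- Spectral radius argument: applied to convolution powers, the crude bound gives `|f̂|^(n+1) ≤ C
‖f‖₁^(n+1)` for all `n`, which removes the constant. -/
theorem norm_sphericalTransform_le_of_L1sharp {f : Hq → ℂ} (hf : L1sharp f) (p : Dual) :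
    ‖sphericalTransform f p‖ ≤ ∫ x, ‖f x‖ := by
  obtain ⟨C, hC0, hC⟩ := norm_phi_le_exists p.2
  set N := ∫ x, ‖f x‖ with hN
  have hN0 : 0 ≤ N := integral_nonneg fun _ => norm_nonneg _
  have hcrude : ∀ g : Hq → ℂ, L1sharp g → ‖sphericalTransform g p‖ ≤ C * ∫ x, ‖g x‖ := by
    intro g hg
    rw [← integral_const_mul]
    refine norm_integral_le_of_norm_le (hg.1.norm.const_mul _) (ae_of_all _ fun z => ?_)
    rw [norm_mul, mul_comm]
    exact mul_le_mul_of_nonneg_right (hC p.1 z) (norm_nonneg _)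
  have hpow : ∀ n : ℕ, ∃ g, L1sharp g ∧ (∫ x, ‖g x‖) ≤ N ^ (n + 1) ∧
      sphericalTransform g p = sphericalTransform f p ^ (n + 1) := by
    intro n
    induction n with
    | zero => exact ⟨f, hf, by simp [hN], by simp⟩
    | succ n ih =>
      obtain ⟨g, hg, hg1, hg2⟩ := ih
      refine ⟨QHeis.conv g f, hg.conv hf, ?_, ?_⟩
      · refine (integral_norm_conv_le hg.1 hf.1).trans ?_
        rw [pow_succ N (n + 1)]
        exact mul_le_mul_of_nonneg_right hg1 hN0
      · rw [sphericalTransform_conv hg hf, hg2, ← pow_succ]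
  by_contra! hlt
  have hz : 0 < ‖sphericalTransform f p‖ := hN0.trans_lt hlt
  have hle : ∀ n : ℕ, ‖sphericalTransform f p‖ ^ (n + 1) ≤ C * N ^ (n + 1) := by
    intro n
    obtain ⟨g, hg, hg1, hg2⟩ := hpow n
    rw [← norm_pow, ← hg2]
    exact (hcrude g hg).trans (mul_le_mul_of_nonneg_left hg1 hC0)
  have hr : N / ‖sphericalTransform f p‖ < 1 := (div_lt_one hz).2 hlt
  have hlim : Tendsto (fun n : ℕ => C * (N / ‖sphericalTransform f p‖) ^ (n + 1)) atTop (𝓝 0) := by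
    have := (tendsto_pow_atTop_nhds_zero_of_lt_one (by positivity) hr).const_mul C
    rw [mul_zero] at this
    exact this.comp (tendsto_add_atTop_nat 1)
  have : (1 : ℝ) ≤ 0 := ge_of_tendsto' hlim fun n => by
    rw [div_pow, ← mul_div_assoc, le_div_iff₀ (by positivity), one_mul]
    exact hle n
  linarith

theorem norm_phi_le_one (p : Dual) (x : Hq) : ‖phi p x‖ ≤ 1 := by
  have hm := measurable_phi_right p
  obtain ⟨C, hC0, hC⟩ := norm_phi_le_exists p.2
  set w : Hq → ℝ := fun x => Real.exp (-(1 * ‖x.u‖ ^ 2)) * weight x.t with hw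
  have hw0 : ∀ x, 0 < w x := fun x => mul_pos (Real.exp_pos _) (weight_pos _)
  set E : Set Hq := {x | 1 < ‖phi p x‖} with hE
  have hEm : MeasurableSet E := measurableSet_lt measurable_const hm.norm
  -- If `|phi| > 1` on a set of positive measure, this `f` would satisfy `f̂ > ‖f‖₁` at `p`,
  -- contradicting the contraction property.
  set f : Hq → ℂ := fun x => gaussTensor 1 (fun t => weight t) x *
    E.indicator (fun x => star (phi p x)) x with hf
  have hgw : ∀ x, gaussTensor 1 (fun t => weight t) x = (w x : ℂ) := fun x => by
    simp [gaussTensor, hw]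
  have hfL : L1sharp f := by
    refine ⟨(integrable_gaussTensor one_pos integrable_weight.ofReal).mul_bdd (c := C)
      ((continuous_star.measurable.comp hm).indicator hEm).aestronglyMeasurable (ae_of_all _ fun x => ?_), fun k => ae_of_all _
      fun x => ?_⟩
    · refine (norm_indicator_le_norm_self _ _).trans ?_
      rw [norm_star]
      exact hC p.1 x
    · simp only [hf, gaussTensor_act, Set.indicator, hE, Set.mem_ofPred_eq, phi_act]
  have h1 := norm_sphericalTransform_le_of_L1sharp hfL p
  have e1 : sphericalTransform f p =
      ((∫ x, w x * E.indicator (fun x => ‖phi p x‖ ^ 2) x : ℝ) : ℂ) := by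
    rw [← integral_complex_ofReal, sphericalTransform]
    refine integral_congr_ae (ae_of_all _ fun x => ?_)
    simp only [hf, hgw, Set.indicator]
    split_ifs
    · rw [mul_assoc, ← starRingEnd_apply, Complex.conj_mul']
      push_cast
      ring
    · simp
  have e2 : ∀ x, ‖f x‖ = w x * E.indicator (fun x => ‖phi p x‖) x := by
    intro x
    simp only [hf, hgw, norm_mul, Complex.norm_real, Real.norm_eq_abs, abs_of_pos (hw0 x),
      Set.indicator]
    split_ifs <;> simp
  have hi2 : Integrable fun x => w x * E.indicator (fun x => ‖phi p x‖) x :=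
    hfL.1.norm.congr (ae_of_all _ e2)
  have hi1 : Integrable fun x => w x * E.indicator (fun x => ‖phi p x‖ ^ 2) x := by
    refine (hi2.mul_bdd (c := C) hm.norm.aestronglyMeasurable (ae_of_all _ fun x => ?_)).congr
      (ae_of_all _ fun x => ?_)
    · rw [norm_norm]
      exact hC p.1 x
    · simp only [Set.indicator]
      split_ifs <;> ring
  have h2 : ∫ x, (w x * E.indicator (fun x => ‖phi p x‖ ^ 2) x -
      w x * E.indicator (fun x => ‖phi p x‖) x) ≤ 0 := by
    rw [integral_sub hi1 hi2, sub_nonpos]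
    simp only [e2] at h1
    refine le_trans ?_ h1
    rw [e1, Complex.norm_real]
    exact le_abs_self _
  have h3 : ∀ x, 0 ≤ w x * E.indicator (fun x => ‖phi p x‖ ^ 2) x -
      w x * E.indicator (fun x => ‖phi p x‖) x := by
    intro x
    rw [← mul_sub]
    refine mul_nonneg (hw0 x).le ?_
    by_cases hx : x ∈ E
    · simp only [Set.indicator_of_mem hx]
      have : 1 < ‖phi p x‖ := hx
      nlinarith
    · simp [Set.indicator_of_notMem hx]
  have h4 := (integral_eq_zero_iff_of_nonneg h3 (hi1.sub hi2)).1
    (le_antisymm h2 (integral_nonneg h3))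
  have h5 : ∀ᵐ x : Hq, |psi ‖p.1‖ p.2 (‖x.u‖ ^ 2)| ≤ 1 := by
    filter_upwards [h4] with x hx
    rw [← norm_phi]
    by_contra! hlt
    have hxE : x ∈ E := hlt
    simp only [Set.indicator_of_mem hxE, Pi.zero_apply, ← mul_sub] at hx
    have := (mul_eq_zero.1 hx).resolve_left (hw0 x).ne'
    nlinarith
  -- The bound holds almost everywhere, hence on a dense set, hence everywhere by continuity.
  have h6 := (ae_iff_prod (p := fun q => |psi ‖p.1‖ p.2 (‖q.1‖ ^ 2)| ≤ 1)).1 h5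
  have hcl : IsClosed {q : ℍ[ℝ] × E3 | |psi ‖p.1‖ p.2 (‖q.1‖ ^ 2)| ≤ 1} := by
    refine isClosed_le ?_ continuous_const
    exact ((continuous_psi p.2).comp (f := fun q : ℍ[ℝ] × E3 => (‖p.1‖, ‖q.1‖ ^ 2))
      (by fun_prop)).abs
  have h7 := (Measure.dense_of_ae h6).closure_eq
  rw [hcl.closure_eq] at h7
  rw [norm_phi]
  have : (x.u, x.t) ∈ {q : ℍ[ℝ] × E3 | |psi ‖p.1‖ p.2 (‖q.1‖ ^ 2)| ≤ 1} := h7 ▸ Set.mem_univ _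
  exact this

theorem stronglyMeasurable_sphericalTransform {f : Hq → ℂ} (hf : AEStronglyMeasurable f) :
    StronglyMeasurable (sphericalTransform f) := by
  have h1 : sphericalTransform f = sphericalTransform (hf.mk f) := by
    ext p
    refine integral_congr_ae ?_
    filter_upwards [hf.ae_eq_mk] with x hx
    rw [hx]
  rw [h1]
  have h2 : StronglyMeasurable fun q : Dual × Hq => hf.mk f q.2 * phi q.1 q.2 :=
    (hf.stronglyMeasurable_mk.comp_measurable measurable_snd).mul measurable_phi.stronglyMeasurable
  exact h2.integral_prod_right'

open scoped SchwartzMap FourierTransform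

/-! ### The Plancherel measure -/

/-- The density of the Plancherel measure. -/
def dens (p : Dual) : ℝ := (p.2 + 1) * ‖p.1‖ ^ 2 / (2 * Real.pi ^ 5)

theorem dens_nonneg (p : Dual) : 0 ≤ dens p := by
  unfold dens
  positivity

theorem measurable_cast_snd : Measurable fun p : Dual => (p.2 : ℝ) :=
  (measurable_from_top (f := fun n : ℕ => (n : ℝ))).comp measurable_snd

theorem measurable_dens : Measurable dens := by
  unfold dens
  have := measurable_cast_snd
  fun_prop

instance : SFinite nu :=
  inferInstanceAs (SFinite (((volume : Measure E3).prod (Measure.count : Measure ℕ)).withDensity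
    (fun p => ENNReal.ofReal (dens p))))

theorem integrable_nu_iff {g : Dual → ℂ} :
    Integrable g nu ↔ Integrable (fun p => (dens p : ℂ) * g p)
      ((volume : Measure E3).prod (Measure.count : Measure ℕ)) := by
  have h := integrable_withDensity_iff_integrable_smul' (E := ℂ)
    (μ := (volume : Measure E3).prod (Measure.count : Measure ℕ))
    (f := fun p => ENNReal.ofReal (dens p)) (measurable_dens.ennreal_ofReal)
    (ae_of_all _ fun _ => ENNReal.ofReal_lt_top) (g := g)
  simp only [ENNReal.toReal_ofReal (dens_nonneg _), Complex.real_smul] at h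
  exact h

theorem integral_nu (g : Dual → ℂ) :
    ∫ p, g p ∂nu = ∫ p, (dens p : ℂ) * g p
      ∂((volume : Measure E3).prod (Measure.count : Measure ℕ)) := by
  have h := integral_withDensity_eq_integral_toReal_smul
    (μ := (volume : Measure E3).prod (Measure.count : Measure ℕ))
    (f := fun p => ENNReal.ofReal (dens p)) (measurable_dens.ennreal_ofReal)
    (ae_of_all _ fun _ => ENNReal.ofReal_lt_top) g
  simp only [ENNReal.toReal_ofReal (dens_nonneg _), Complex.real_smul] at h
  exact h

theorem integral_count_nat {g : ℕ → ℂ} (hg : Integrable g Measure.count) :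
    ∫ n, g n ∂Measure.count = ∑' n, g n := by
  rw [integral_countable hg]
  simp [measureReal_def]

theorem integral_nu_eq_tsum {g : Dual → ℂ} (hg : Integrable g nu) :
    ∫ p, g p ∂nu = ∫ lam : E3, ∑' n : ℕ, (dens (lam, n) : ℂ) * g (lam, n) := by
  have h := integrable_nu_iff.1 hg
  rw [integral_nu, integral_prod _ h]
  refine integral_congr_ae ?_
  filter_upwards [h.prod_right_ae] with lam hl
  exact integral_count_nat hl

theorem ae_fst_ne_zero : ∀ᵐ p ∂nu, p.1 ≠ 0 := by
  have h : ∀ᵐ p ∂((volume : Measure E3).prod (Measure.count : Measure ℕ)), p.1 ≠ 0 :=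
    Measure.quasiMeasurePreserving_fst.ae (Measure.ae_ne volume (0 : E3))
  exact (withDensity_absolutelyContinuous _ _).ae_le h

theorem ae_nu_of_ae {P : Dual → Prop} (h : ∀ᵐ lam : E3, ∀ n, P (lam, n)) : ∀ᵐ p ∂nu, P p := by
  refine (withDensity_absolutelyContinuous _ _).ae_le ?_
  have := (Measure.quasiMeasurePreserving_fst (μ := (volume : Measure E3))
    (ν := (Measure.count : Measure ℕ))).ae h
  filter_upwards [this] with p hp
  exact hp p.2

/-- Polynomial weight on the parameters. -/
def weight₂ (lam : E3) : ℝ := (1 + ‖lam‖ ^ 2)⁻¹ ^ 3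

theorem weight₂_pos (lam : E3) : 0 < weight₂ lam := by
  unfold weight₂
  positivity

theorem contDiff_weight₂ : ContDiff ℝ (⊤ : ℕ∞) weight₂ := by
  unfold weight₂
  refine ContDiff.pow (ContDiff.inv (contDiff_const.add (contDiff_norm_sq ℝ)) fun t => ?_) 3
  positivity

theorem measurable_gam (a : ℝ) : Measurable fun p : Dual => gam a ‖p.1‖ p.2 := by
  have h1 : Measurable fun p : Dual => ‖p.1‖ := measurable_fst.norm
  exact (((h1.const_add a).pow_const 2).const_div _).mul
    (((h1.const_sub a).div (h1.const_add a)).pow measurable_snd)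

/-- The series `∑ (n+1) r^n = (1-r)⁻²` at `r = |a-l|/(a+l)`, for which `1 - r = 2 min(a,l)/(a+l)`.
The sum stays bounded as `lam → 0` and grows quadratically at infinity. -/
theorem hasSum_dens_mul_gam {a : ℝ} (ha : 0 < a) {lam : E3} (hl : lam ≠ 0) :
    HasSum (fun n : ℕ => dens (lam, n) * |gam a ‖lam‖ n|)
      (‖lam‖ ^ 2 / (8 * Real.pi ^ 3 * min a ‖lam‖ ^ 2)) := by
  have hl0 : 0 < ‖lam‖ := norm_pos_iff.2 hl
  set l := ‖lam‖
  have hal : 0 < a + l := by linarith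
  have hr : |(|a - l| / (a + l))| < 1 := by
    rw [abs_div, abs_abs, abs_of_pos hal, div_lt_one hal, abs_lt]
    constructor <;> linarith
  have h := (hasSum_choose_mul_geometric_of_norm_lt_one 1
    (r := |a - l| / (a + l)) (by rwa [Real.norm_eq_abs])).mul_left
    (l ^ 2 / (2 * Real.pi ^ 5) * (Real.pi ^ 2 / (a + l) ^ 2))
  have hm : 0 < min a l := lt_min ha hl0
  have e : 1 - |a - l| / (a + l) = 2 * min a l / (a + l) := by
    rw [min_def]
    split_ifs with hc
    · rw [abs_of_nonpos (by linarith)]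
      field_simp
      ring
    · rw [abs_of_pos (by linarith)]
      field_simp
      ring
  convert! h using 1
  · ext n
    rw [gam, abs_mul, abs_of_pos (by positivity : 0 < Real.pi ^ 2 / (a + l) ^ 2), abs_pow, abs_div,
      abs_of_pos hal, dens, Nat.choose_one_right]
    push_cast
    ring
  · rw [e, div_pow]
    field_simp
    ring

theorem integrable_gam_mul_weight {a : ℝ} (ha : 0 < a) :
    Integrable (fun p : Dual => ((gam a ‖p.1‖ p.2 * weight₂ p.1 : ℝ) : ℂ)) nu := by
  rw [integrable_nu_iff]
  have hm : Measurable fun p : Dual => (dens p : ℂ) * ((gam a ‖p.1‖ p.2 * weight₂ p.1 : ℝ) : ℂ) :=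
    (Complex.measurable_ofReal.comp measurable_dens).mul (Complex.measurable_ofReal.comp
      ((measurable_gam a).mul (contDiff_weight₂.continuous.measurable.comp measurable_fst)))
  have e : ∀ (lam : E3) (n : ℕ), ‖(dens (lam, n) : ℂ) * ((gam a ‖lam‖ n * weight₂ lam : ℝ) : ℂ)‖ =
      dens (lam, n) * |gam a ‖lam‖ n| * weight₂ lam := by
    intro lam n
    rw [← Complex.ofReal_mul, Complex.norm_real, Real.norm_eq_abs, abs_mul, abs_mul,
      abs_of_nonneg (dens_nonneg _), abs_of_pos (weight₂_pos _), mul_assoc]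
  have hsum : ∀ lam : E3, lam ≠ 0 → HasSum (fun n : ℕ =>
      ‖(dens (lam, n) : ℂ) * ((gam a ‖lam‖ n * weight₂ lam : ℝ) : ℂ)‖)
      (‖lam‖ ^ 2 / (8 * Real.pi ^ 3 * min a ‖lam‖ ^ 2) * weight₂ lam) := by
    intro lam hl
    simp only [e]
    exact (hasSum_dens_mul_gam ha hl).mul_right _
  have h0 : ∀ᵐ lam : E3, lam ≠ 0 := Measure.ae_ne volume (0 : E3)
  refine (integrable_prod_iff hm.aestronglyMeasurable).2 ⟨?_, ?_⟩
  · filter_upwards [h0] with lam hl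
    rw [integrable_count_iff]
    exact (hsum lam hl).summable
  · refine (integrable_weight.const_mul ((1 + 1 / a ^ 2) / (8 * Real.pi ^ 3))).mono'
      hm.aestronglyMeasurable.norm.integral_prod_right' ?_
    filter_upwards [h0] with lam hl
    have hint : Integrable (fun n : ℕ =>
        ‖(dens (lam, n) : ℂ) * ((gam a ‖lam‖ n * weight₂ lam : ℝ) : ℂ)‖) Measure.count := by
      rw [integrable_count_iff]
      simpa using (hsum lam hl).summable
    rw [Real.norm_of_nonneg (integral_nonneg fun _ => norm_nonneg _), integral_countable hint]
    simp only [measureReal_def, Measure.count_singleton, ENNReal.toReal_one, one_smul]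
    rw [(hsum lam hl).tsum_eq]
    have hl0 : 0 < ‖lam‖ := norm_pos_iff.2 hl
    -- One of the three powers in `weight₂` absorbs the quadratic growth of the sum over `n`; the
    -- remaining two are integrable on `ℝ³`.
    have hw : (1 + ‖lam‖ ^ 2) * weight₂ lam = weight lam := by
      unfold weight weight₂
      field_simp
    rw [← hw, ← mul_assoc]
    refine mul_le_mul_of_nonneg_right ?_ (weight₂_pos lam).le
    have h3 : ‖lam‖ ^ 2 / min a ‖lam‖ ^ 2 ≤ (1 + 1 / a ^ 2) * (1 + ‖lam‖ ^ 2) := by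
      rw [min_def]
      split_ifs
      · rw [div_eq_mul_one_div]
        have : 0 < 1 / a ^ 2 := by positivity
        nlinarith [sq_nonneg ‖lam‖]
      · rw [div_self (by positivity)]
        have : 0 < 1 / a ^ 2 := by positivity
        nlinarith [sq_nonneg ‖lam‖]
    calc _ = ‖lam‖ ^ 2 / min a ‖lam‖ ^ 2 / (8 * Real.pi ^ 3) := by
          rw [div_div, mul_comm (8 * _)]
      _ ≤ _ := by
          rw [div_mul_eq_mul_div]
          gcongr

theorem abs_gam_le {a l : ℝ} (ha : 0 < a) (hl : 0 ≤ l) (n : ℕ) :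
    |gam a l n| ≤ Real.pi ^ 2 / a ^ 2 := by
  have hal : 0 < a + l := by linarith
  rw [gam, abs_mul, abs_of_pos (by positivity : 0 < Real.pi ^ 2 / (a + l) ^ 2), abs_pow, abs_div,
    abs_of_pos hal]
  have h1 : |a - l| / (a + l) ≤ 1 := by
    rw [div_le_one hal, abs_le]
    constructor <;> linarith
  refine (mul_le_of_le_one_right (by positivity) (pow_le_one₀ (by positivity) h1)).trans ?_
  gcongr
  linarith

theorem schwartz_bound (G : 𝓢(E3, ℂ)) (N : ℕ) :
    ∃ C : ℝ, 0 ≤ C ∧ ∀ v, ‖G v‖ ≤ C * (1 + ‖v‖ ^ 2)⁻¹ ^ N := by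
  set C := 2 ^ (2 * N) * (Finset.Iic (2 * N, 0)).sup
    (fun m => SchwartzMap.seminorm ℝ m.1 m.2) G with hC
  have h := SchwartzMap.one_add_le_sup_seminorm_apply (𝕜 := ℝ) (m := (2 * N, 0)) (k := 2 * N)
    (n := 0) le_rfl le_rfl G
  simp only [norm_iteratedFDeriv_zero] at h
  refine ⟨C, le_trans (by positivity) (h 0), fun v => ?_⟩
  have h1 : (1 + ‖v‖ ^ 2) ^ N ≤ (1 + ‖v‖) ^ (2 * N) := by
    rw [pow_mul]
    refine pow_le_pow_left₀ (by positivity) ?_ N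
    nlinarith [norm_nonneg v]
  rw [inv_pow, ← div_eq_mul_inv, le_div_iff₀ (by positivity), mul_comm]
  exact (mul_le_mul_of_nonneg_right h1 (norm_nonneg _)).trans (h v)

/-! ### Gaussian–Schwartz test functions and their transforms. -/

/-- The test functions on the group. -/
def sig (a : ℝ) (G : 𝓢(E3, ℂ)) : Hq → ℂ := gaussTensor a (𝓕⁻ G : 𝓢(E3, ℂ))

/-- The spherical transforms (up to conjugation) of the test functions. -/
def tau (a : ℝ) (G : 𝓢(E3, ℂ)) (p : Dual) : ℂ :=
  (gam a ‖p.1‖ p.2 : ℂ) * G ((2 * Real.pi)⁻¹ • p.1)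

theorem measurable_tau (a : ℝ) (G : 𝓢(E3, ℂ)) : Measurable (tau a G) :=
  (Complex.measurable_ofReal.comp (measurable_gam a)).mul
    (G.continuous.measurable.comp (measurable_fst.const_smul (2 * Real.pi)⁻¹))

theorem schwartz_scaled_bound (G : 𝓢(E3, ℂ)) :
    ∃ C : ℝ, 0 ≤ C ∧ ∀ lam, ‖G ((2 * Real.pi)⁻¹ • lam)‖ ≤ C * weight₂ lam := by
  obtain ⟨C, hC0, hC⟩ := schwartz_bound G 3
  refine ⟨C * ((2 * Real.pi) ^ 2) ^ 3, by positivity, fun lam => (hC _).trans ?_⟩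
  rw [mul_assoc, weight₂, ← mul_pow]
  refine mul_le_mul_of_nonneg_left (pow_le_pow_left₀ (by positivity) ?_ 3) hC0
  rw [norm_smul, mul_pow, norm_inv, Real.norm_of_nonneg (by positivity), inv_pow]
  have hpi : 1 ≤ (2 * Real.pi) ^ 2 := by
    have := Real.pi_gt_three
    nlinarith
  rw [inv_le_iff_one_le_mul₀ (by positivity), mul_right_comm, ← div_eq_mul_inv,
    le_div_iff₀ (by positivity), one_mul]
  have e : ((2 * Real.pi) ^ 2) * (1 + ((2 * Real.pi) ^ 2)⁻¹ * ‖lam‖ ^ 2) =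
      (2 * Real.pi) ^ 2 + ‖lam‖ ^ 2 := by
    field_simp
  linarith

theorem norm_tau_le (a : ℝ) (G : 𝓢(E3, ℂ)) :
    ∃ C : ℝ, 0 ≤ C ∧ ∀ p, ‖tau a G p‖ ≤ C * |gam a ‖p.1‖ p.2 * weight₂ p.1| := by
  obtain ⟨C, hC0, hC⟩ := schwartz_scaled_bound G
  refine ⟨C, hC0, fun p => ?_⟩
  rw [tau, norm_mul, Complex.norm_real, Real.norm_eq_abs, abs_mul, abs_of_pos (weight₂_pos _),
    mul_left_comm]
  exact mul_le_mul_of_nonneg_left (hC _) (abs_nonneg _)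

theorem integrable_tau {a : ℝ} (ha : 0 < a) (G : 𝓢(E3, ℂ)) : Integrable (tau a G) nu := by
  obtain ⟨C, hC0, hC⟩ := norm_tau_le a G
  refine ((integrable_gam_mul_weight ha).norm.const_mul C).mono'
    (measurable_tau a G).aestronglyMeasurable (ae_of_all _ fun p => ?_)
  rw [Complex.norm_real]
  exact hC p

theorem weight₂_le_one (lam : E3) : weight₂ lam ≤ 1 :=
  pow_le_one₀ (by positivity) (inv_le_one_of_one_le₀ (by nlinarith [sq_nonneg ‖lam‖]))

theorem memLp_two_of_integrable_of_bounded {α : Type*} [MeasurableSpace α] {μ : Measure α}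
    {f : α → ℂ} (hf : Integrable f μ) {C : ℝ} (hC : ∀ᵐ x ∂μ, ‖f x‖ ≤ C) : MemLp f 2 μ := by
  rw [memLp_two_iff_integrable_sq_norm hf.aestronglyMeasurable]
  refine (hf.norm.const_mul C).mono' (hf.aestronglyMeasurable.norm.pow 2) ?_
  filter_upwards [hC] with x hx
  rw [norm_pow, norm_norm, sq]
  exact mul_le_mul_of_nonneg_right hx (norm_nonneg _)

theorem memLp_gam_mul_weight {a : ℝ} (ha : 0 < a) :
    MemLp (fun p : Dual => ((gam a ‖p.1‖ p.2 * weight₂ p.1 : ℝ) : ℂ)) 2 nu := by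
  refine memLp_two_of_integrable_of_bounded (integrable_gam_mul_weight ha)
    (C := Real.pi ^ 2 / a ^ 2) (ae_of_all _ fun p => ?_)
  rw [Complex.norm_real, Real.norm_eq_abs, abs_mul, abs_of_pos (weight₂_pos _)]
  exact (mul_le_of_le_one_right (abs_nonneg _) (weight₂_le_one _)).trans
    (abs_gam_le ha (norm_nonneg _) _)

theorem memLp_tau {a : ℝ} (ha : 0 < a) (G : 𝓢(E3, ℂ)) : MemLp (tau a G) 2 nu := by
  obtain ⟨C, hC0, hC⟩ := norm_tau_le a G
  refine (memLp_gam_mul_weight ha).of_le_mul (c := C) (measurable_tau a G).aestronglyMeasurable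
    (ae_of_all _ fun p => ?_)
  rw [Complex.norm_real]
  exact hC p

theorem integrable_sig {a : ℝ} (ha : 0 < a) (G : 𝓢(E3, ℂ)) : Integrable (sig a G) :=
  integrable_gaussTensor ha (𝓕⁻ G : 𝓢(E3, ℂ)).integrable

/-! ### Inversion and Parseval -/

/-- The spherical functions carry `exp (i⟨lam, t⟩)`, while `𝓕⁻` uses `exp (2πi⟨v, t⟩)`. This
accounts for the dilation by `(2π)⁻¹` in `tau` and the Jacobian `(2π)³`. -/
theorem fourierInv_scaled (G : 𝓢(E3, ℂ)) (t : E3) :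
    ∫ lam : E3, Complex.exp (Complex.I * ((inner ℝ lam t : ℝ) : ℂ)) * G ((2 * Real.pi)⁻¹ • lam) =
      (2 * Real.pi) ^ 3 * (𝓕⁻ G : 𝓢(E3, ℂ)) t := by
  have hpi : (2 * Real.pi) ≠ 0 := by positivity
  have h := Measure.integral_comp_inv_smul_of_nonneg (volume : Measure E3)
    (fun v => Complex.exp (((2 * Real.pi * inner ℝ v t : ℝ) : ℂ) * Complex.I) • G v)
    (R := 2 * Real.pi) (by positivity)
  rw [SchwartzMap.fourierInv_coe, Real.fourierInv_eq']
  simp only [finrank_euclideanSpace, Fintype.card_fin, Complex.real_smul] at h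
  push_cast at h ⊢
  rw [← h]
  refine integral_congr_ae (ae_of_all _ fun lam => ?_)
  simp only [inner_smul_left, smul_eq_mul, RCLike.conj_to_real]
  congr 2
  push_cast
  have : (Real.pi : ℂ) ≠ 0 := by exact_mod_cast Real.pi_ne_zero
  field_simp

theorem integrable_phi_mul_tau {a : ℝ} (ha : 0 < a) (G : 𝓢(E3, ℂ)) (x : Hq) :
    Integrable (fun p => phi p x * tau a G p) nu :=
  (integrable_tau ha G).bdd_mul (c := 1)
    (measurable_phi.comp measurable_prodMk_right).aestronglyMeasurable
    (ae_of_all _ fun p => norm_phi_le_one p x)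

/-- The inversion formula for the test functions. -/
theorem integral_phi_mul_tau {a : ℝ} (ha : 0 < a) (G : 𝓢(E3, ℂ)) (x : Hq) :
    ∫ p, phi p x * tau a G p ∂nu = sig a G x := by
  rw [integral_nu_eq_tsum (integrable_phi_mul_tau ha G x)]
  -- Summing over `n` first leaves a Gaussian in `u` that does not depend on `lam`. Its constant
  -- `(2π⁵)⁻¹ · π²/4 = (2π)⁻³` cancels the Jacobian of the Fourier inversion.
  have h1 : ∀ lam : E3, lam ≠ 0 →
      ∑' n : ℕ, (dens (lam, n) : ℂ) * (phi (lam, n) x * tau a G (lam, n)) =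
      ((1 / (8 * Real.pi ^ 3) * Real.exp (-(a * ‖x.u‖ ^ 2)) : ℝ) : ℂ) *
        (Complex.exp (Complex.I * ((inner ℝ lam x.t : ℝ) : ℂ)) *
          G ((2 * Real.pi)⁻¹ • lam)) := by
    intro lam hl
    have h2 := (Complex.hasSum_ofReal.2
      (hasSum_gam_mul_psi ha (norm_pos_iff.2 hl) (‖x.u‖ ^ 2))).mul_left
      (((1 / (2 * Real.pi ^ 5) : ℝ) : ℂ) * (Complex.exp (Complex.I * ((inner ℝ lam x.t : ℝ) : ℂ)) *
          G ((2 * Real.pi)⁻¹ • lam)))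
    have hpi : (Real.pi : ℂ) ≠ 0 := by exact_mod_cast Real.pi_ne_zero
    calc _ = ∑' n : ℕ, ((1 / (2 * Real.pi ^ 5) : ℝ) : ℂ) *
          (Complex.exp (Complex.I * ((inner ℝ lam x.t : ℝ) : ℂ)) * G ((2 * Real.pi)⁻¹ • lam)) *
          (((n + 1) * ‖lam‖ ^ 2 * (gam a ‖lam‖ n * psi ‖lam‖ n (‖x.u‖ ^ 2)) : ℝ) : ℂ) := by
          refine tsum_congr fun n => ?_
          rw [phi_eq, tau, dens]
          push_cast
          ring
      _ = _ := by
          rw [h2.tsum_eq]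
          push_cast
          field_simp
          ring
  have h0 : ∀ᵐ lam : E3, lam ≠ 0 := Measure.ae_ne volume (0 : E3)
  rw [integral_congr_ae (h0.mono fun lam hl => h1 lam hl), integral_const_mul, fourierInv_scaled,
    sig, gaussTensor]
  have hpi : (Real.pi : ℂ) ≠ 0 := by exact_mod_cast Real.pi_ne_zero
  push_cast
  field_simp
  ring

theorem norm_sphericalTransform_le {f : Hq → ℂ} (hf : Integrable f) (p : Dual) :
    ‖sphericalTransform f p‖ ≤ ∫ x, ‖f x‖ := by
  refine norm_integral_le_of_norm_le hf.norm (ae_of_all _ fun z => ?_)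
  rw [norm_mul]
  exact mul_le_of_le_one_right (norm_nonneg _) (norm_phi_le_one p z)

/-- The Parseval identity against the test functions. -/
theorem integral_mul_sig {f : Hq → ℂ} (hf : Integrable f) {a : ℝ} (ha : 0 < a) (G : 𝓢(E3, ℂ)) :
    ∫ x, f x * sig a G x = ∫ p, sphericalTransform f p * tau a G p ∂nu := by
  have hint : Integrable (fun q : Hq × Dual => f q.1 * tau a G q.2 * phi q.2 q.1)
      (volume.prod nu) :=
    (hf.mul_prod (integrable_tau ha G)).mul_bdd (c := 1)
      (measurable_phi.comp measurable_swap).aestronglyMeasurable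
      (ae_of_all _ fun q => norm_phi_le_one q.2 q.1)
  calc _ = ∫ x, ∫ p, f x * tau a G p * phi p x ∂nu := by
        refine integral_congr_ae (ae_of_all _ fun x => ?_)
        simp only [← integral_phi_mul_tau ha G x, ← integral_const_mul]
        refine integral_congr_ae (ae_of_all _ fun p => ?_)
        simp only
        ring
    _ = ∫ p, (∫ x, f x * tau a G p * phi p x) ∂nu := integral_integral_swap hint
    _ = _ := by
        refine integral_congr_ae (ae_of_all _ fun p => ?_)
        simp only [sphericalTransform, ← integral_mul_const]
        refine integral_congr_ae (ae_of_all _ fun x => ?_)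
        simp only
        ring

/-- The spherical transform of a conjugate test function. -/
theorem sphericalTransform_star_sig {a : ℝ} (ha : 0 < a) (G : 𝓢(E3, ℂ)) (p : Dual) :
    sphericalTransform (fun x => star (sig a G x)) p = star (tau a G p) := by
  have h1 : (fun x => star (sig a G x)) =
      gaussTensor a (fun t => star ((𝓕⁻ G : 𝓢(E3, ℂ)) t)) := by
    ext x
    simp only [sig, gaussTensor, star_mul', Complex.star_def, Complex.conj_ofReal]
  have h2 : G = 𝓕 (𝓕⁻ G : 𝓢(E3, ℂ)) := (FourierTransform.fourier_fourierInv_eq G).symm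
  rw [h1, sphericalTransform_gaussTensor ha, tau, star_mul', Complex.star_def, Complex.conj_ofReal]
  congr 1
  conv_rhs => rw [h2, SchwartzMap.fourier_coe, Real.fourier_eq']
  rw [← integral_conj]
  refine integral_congr_ae (ae_of_all _ fun t => ?_)
  simp only [smul_eq_mul, map_mul, ← Complex.exp_conj, inner_smul_right, Complex.conj_ofReal,
    Complex.conj_I]
  rw [mul_comm, real_inner_comm]
  congr 2
  push_cast
  have : (Real.pi : ℂ) ≠ 0 := by exact_mod_cast Real.pi_ne_zero
  field_simp

theorem L1sharp_star_sig {a : ℝ} (ha : 0 < a) (G : 𝓢(E3, ℂ)) :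
    L1sharp fun x => star (sig a G x) :=
  ⟨(Complex.conjLIE.toContinuousLinearEquiv.integrable_comp_iff (φ := sig a G)).2
    (integrable_sig ha G), fun k => ae_of_all _ fun x => by simp only [sig, gaussTensor_act]⟩

/-- Every smooth compactly supported function of the central variable gives a test function. -/
theorem exists_sig_eq (χ : E3 → ℝ) (hχ : ContDiff ℝ (⊤ : ℕ∞) χ) (hs : HasCompactSupport χ) :
    ∃ G : 𝓢(E3, ℂ), ∀ a, sig a G = gaussTensor a fun t => χ t := by
  have hs' : HasCompactSupport fun t => (χ t : ℂ) := hs.comp_left Complex.ofReal_zero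
  refine ⟨𝓕 (hs'.toSchwartzMap (Complex.ofRealCLM.contDiff.comp hχ)), fun a => ?_⟩
  rw [sig, FourierTransform.fourierInv_fourier_eq]
  rfl

theorem exists_tau_eq (χ : E3 → ℝ) (hχ : ContDiff ℝ (⊤ : ℕ∞) χ) (hs : HasCompactSupport χ) :
    ∃ G : 𝓢(E3, ℂ), ∀ a p, tau a G p = (gam a ‖p.1‖ p.2 : ℂ) * (χ p.1 : ℂ) := by
  have hpi : (2 * Real.pi) ≠ 0 := by positivity
  have hs' : HasCompactSupport fun v : E3 => (χ ((2 * Real.pi) • v) : ℂ) :=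
    (hs.comp_homeomorph (Homeomorph.smulOfNeZero (2 * Real.pi) hpi)).comp_left Complex.ofReal_zero
  refine ⟨hs'.toSchwartzMap (Complex.ofRealCLM.contDiff.comp
    (hχ.comp (contDiff_const_smul (2 * Real.pi)))), fun a p => ?_⟩
  rw [tau]
  congr 1
  change ((χ ((2 * Real.pi) • (2 * Real.pi)⁻¹ • p.1) : ℝ) : ℂ) = _
  rw [smul_smul, mul_inv_cancel₀ hpi, one_smul]

/-! ### Completeness of the test transforms on the dual side. -/

/-- A power series vanishing at the points `(a - l) / (a + l)`, `a` rational, is zero. -/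
theorem coeff_eq_zero_of_tsum_eq_zero {c : ℕ → ℂ} {l : ℝ} (hl : 0 < l)
    (hs : ∀ a : ℚ, 0 < a → Summable fun n => ‖c n * (((a - l) / (a + l) : ℝ) : ℂ) ^ n‖)
    (h0 : ∀ a : ℚ, 0 < a → ∑' n, c n * (((a - l) / (a + l) : ℝ) : ℂ) ^ n = 0) (n : ℕ) :
    c n = 0 := by
  -- Rational `a` tending to `l` from above make the nodes positive and convergent to `0`.
  -- Rationality lets the caller choose one null set of `lam` for all `a`.
  have hq : ∀ k : ℕ, ∃ a : ℚ, l < a ∧ (a : ℝ) < l + 1 / (k + 1) := fun k =>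
    exists_rat_btwn (by linarith [Nat.one_div_pos_of_nat (α := ℝ) (n := k)])
  choose a ha1 ha2 using hq
  set r : ℕ → ℝ := fun k => (a k - l) / (a k + l) with hr
  have hapos : ∀ k, 0 < a k := fun k => by exact_mod_cast hl.trans (ha1 k)
  have hrpos : ∀ k, 0 < r k := fun k => div_pos (sub_pos.2 (ha1 k)) (by linarith [ha1 k])
  have halim : Tendsto (fun k => (a k : ℝ)) atTop (𝓝 l) := by
    refine tendsto_of_tendsto_of_tendsto_of_le_of_le tendsto_const_nhds ?_
      (fun k => (ha1 k).le) (fun k => (ha2 k).le)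
    simpa using (tendsto_const_nhds (x := l)).add (tendsto_one_div_add_atTop_nhds_zero_nat (𝕜 := ℝ))
  have hrlim : Tendsto r atTop (𝓝 0) := by
    have := (halim.sub_const l).div (halim.add_const l) (by positivity)
    rwa [sub_self, zero_div] at this
  have hev : ∀ᶠ k in atTop, r k / r 0 ≤ 1 / 2 := by
    have := hrlim.div_const (r 0)
    rw [zero_div] at this
    exact (this.eventually_lt_const (by norm_num : (0 : ℝ) < 1 / 2)).mono fun _ h => h.le
  induction n using Nat.strong_induction_on with
  | _ n ih =>
    set M := ∑' m, ‖c m * (r 0 : ℂ) ^ m‖ with hM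
    have hMb : ∀ m, ‖c m * (r 0 : ℂ) ^ m‖ ≤ M := fun m =>
      (hs (a 0) (hapos 0)).le_tsum m fun _ _ => norm_nonneg _
    -- The lower coefficients vanish by induction, so the series may be divided by `r_k ^ n`.
    -- Letting `k → ∞` isolates `c n`; the terms are dominated geometrically because eventually `r_k
    -- ≤ r_0 / 2`.
    have hzero : ∀ k, ∑' m, c (m + n) * (r k : ℂ) ^ m = 0 := by
      intro k
      have h1 := h0 (a k) (hapos k)
      have h2 := (hs (a k) (hapos k)).of_norm
      rw [← h2.sum_add_tsum_nat_add n, Finset.sum_eq_zero, zero_add] at h1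
      · have h3 : ∀ m, c (m + n) * (((a k - l) / (a k + l) : ℝ) : ℂ) ^ (m + n) =
            (r k : ℂ) ^ n * (c (m + n) * (r k : ℂ) ^ m) := fun m => by
          rw [pow_add]
          simp only [hr]
          ring
        simp only [h3, tsum_mul_left] at h1
        refine (mul_eq_zero.1 h1).resolve_left (pow_ne_zero _ ?_)
        exact_mod_cast (hrpos k).ne'
      · intro m hm
        rw [ih m (Finset.mem_range.1 hm), zero_mul]
    have hlim : Tendsto (fun k => ∑' m, c (m + n) * (r k : ℂ) ^ m) atTop
        (𝓝 (∑' m, c (m + n) * (0 : ℂ) ^ m)) := by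
      refine tendsto_tsum_of_dominated_convergence
        (bound := fun m => M / r 0 ^ n * (1 / 2 : ℝ) ^ m)
        (summable_geometric_two.mul_left _) (fun m => ?_) ?_
      · refine Tendsto.const_mul _ (Tendsto.pow ?_ m)
        exact_mod_cast (Complex.continuous_ofReal.tendsto 0).comp hrlim
      · filter_upwards [hev] with k hk m
        have h1 := hMb (m + n)
        rw [norm_mul, norm_pow, Complex.norm_real, Real.norm_of_nonneg (hrpos _).le] at h1 ⊢
        have h2 : r k ^ m ≤ (1 / 2) ^ m * r 0 ^ m := by
          rw [← mul_pow]
          exact pow_le_pow_left₀ (hrpos k).le ((div_le_iff₀ (hrpos 0)).1 hk) m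
        calc ‖c (m + n)‖ * r k ^ m ≤ ‖c (m + n)‖ * ((1 / 2) ^ m * r 0 ^ m) := by gcongr
          _ = (‖c (m + n)‖ * r 0 ^ (m + n)) / r 0 ^ n * (1 / 2) ^ m := by
              have := (hrpos 0).ne'
              rw [pow_add]
              field_simp
          _ ≤ _ := by
              have := hrpos 0
              gcongr
    simp only [hzero] at hlim
    have h4 := tendsto_nhds_unique hlim tendsto_const_nhds
    rw [tsum_eq_single 0 (fun m hm => by rw [zero_pow hm, mul_zero])] at h4
    simpa using h4

/-- A function of the parameters orthogonal to all `tau` vanishes. -/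
theorem eq_zero_of_integral_tau {b : Dual → ℂ}
    (hint : ∀ a : ℝ, 0 < a →
      Integrable (fun p => b p * ((gam a ‖p.1‖ p.2 * weight₂ p.1 : ℝ) : ℂ)) nu)
    (h0 : ∀ a : ℝ, 0 < a → ∀ G : 𝓢(E3, ℂ), ∫ p, b p * tau a G p ∂nu = 0) :
    b =ᵐ[nu] 0 := by
  -- For fixed `a`, the sum over `n` is a locally integrable function of `lam` that vanishes against
  -- every bump `χ`, since `χ * weight₂` comes from some `tau`.
  have hD : ∀ a : ℝ, 0 < a → ∀ᵐ lam : E3, ∫ n, (dens (lam, n) : ℂ) *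
      (b (lam, n) * ((gam a ‖lam‖ n * weight₂ lam : ℝ) : ℂ)) ∂(Measure.count : Measure ℕ) = 0 := by
    intro a ha
    have hi := integrable_nu_iff.1 (hint a ha)
    refine ae_eq_zero_of_integral_contDiff_smul_eq_zero
      hi.integral_prod_left.locallyIntegrable fun χ hχ hχs => ?_
    obtain ⟨G, hG⟩ := exists_tau_eq (fun t => χ t * weight₂ t) (hχ.mul contDiff_weight₂)
      hχs.mul_right
    have hχi : Integrable (fun p : Dual => (χ p.1 : ℂ) * ((dens p : ℂ) *
        (b p * ((gam a ‖p.1‖ p.2 * weight₂ p.1 : ℝ) : ℂ))))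
        ((volume : Measure E3).prod (Measure.count : Measure ℕ)) := by
      obtain ⟨C, hC⟩ := hχs.exists_bound_of_continuous hχ.continuous
      refine hi.bdd_mul (c := C) ?_ (ae_of_all _ fun p => ?_)
      · exact (Complex.measurable_ofReal.comp
          (hχ.continuous.measurable.comp measurable_fst)).aestronglyMeasurable
      · rw [Complex.norm_real]
        exact hC _
    rw [← h0 a ha G, integral_nu]
    calc _ = ∫ p : Dual, (χ p.1 : ℂ) * ((dens p : ℂ) *
        (b p * ((gam a ‖p.1‖ p.2 * weight₂ p.1 : ℝ) : ℂ)))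
        ∂((volume : Measure E3).prod (Measure.count : Measure ℕ)) := by
          rw [integral_prod _ hχi]
          refine integral_congr_ae (ae_of_all _ fun lam => ?_)
          simp only [Complex.real_smul, integral_const_mul]
      _ = _ := by
          refine integral_congr_ae (ae_of_all _ fun p => ?_)
          simp only [hG]
          push_cast
          ring
  have hD' : ∀ᵐ lam : E3, ∀ a : ℚ, 0 < a → ∫ n, (dens (lam, n) : ℂ) *
      (b (lam, n) * ((gam a ‖lam‖ n * weight₂ lam : ℝ) : ℂ)) ∂(Measure.count : Measure ℕ) = 0 := by
    rw [ae_all_iff]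
    intro a
    by_cases ha : 0 < a
    · filter_upwards [hD a (by exact_mod_cast ha)] with lam hlam _
      exact hlam
    · exact ae_of_all _ fun _ h => absurd h ha
  have hI' : ∀ᵐ lam : E3, ∀ a : ℚ, 0 < a → Integrable (fun n => (dens (lam, n) : ℂ) *
      (b (lam, n) * ((gam a ‖lam‖ n * weight₂ lam : ℝ) : ℂ))) (Measure.count : Measure ℕ) := by
    rw [ae_all_iff]
    intro a
    by_cases ha : 0 < a
    · filter_upwards [(integrable_nu_iff.1 (hint a (by exact_mod_cast ha))).prod_right_ae]
        with lam hlam _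
      exact hlam
    · exact ae_of_all _ fun _ h => absurd h ha
  refine ae_nu_of_ae ?_
  filter_upwards [hD', hI', Measure.ae_ne volume (0 : E3)] with lam h1 h2 hl n
  have hl0 : 0 < ‖lam‖ := norm_pos_iff.2 hl
  have hw := weight₂_pos lam
  set κ : ℚ → ℝ := fun a => ‖lam‖ ^ 2 / (2 * Real.pi ^ 5) * weight₂ lam *
    (Real.pi ^ 2 / (a + ‖lam‖) ^ 2) with hκ
  have hκ0 : ∀ a : ℚ, 0 < a → (κ a : ℂ) ≠ 0 := by
    intro a ha
    have : (0 : ℝ) < a := by exact_mod_cast ha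
    exact_mod_cast (by positivity : κ a ≠ 0)
  have e : ∀ (a : ℚ) (n : ℕ), (dens (lam, n) : ℂ) *
      (b (lam, n) * ((gam a ‖lam‖ n * weight₂ lam : ℝ) : ℂ)) =
      (κ a : ℂ) * (((n + 1 : ℕ) : ℂ) * b (lam, n) *
        (((a - ‖lam‖) / (a + ‖lam‖) : ℝ) : ℂ) ^ n) := by
    intro a n
    simp only [dens, gam, hκ]
    push_cast
    ring
  have h3 := coeff_eq_zero_of_tsum_eq_zero (c := fun n => ((n + 1 : ℕ) : ℂ) * b (lam, n)) hl0
    (fun a ha => by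
      have := h2 a ha
      simp only [e] at this
      rw [integrable_count_iff] at this
      simpa only [norm_mul, summable_mul_left_iff (norm_ne_zero_iff.2 (hκ0 a ha))] using this)
    (fun a ha => by
      have h4 := h1 a ha
      rw [integral_count_nat (h2 a ha)] at h4
      simp only [e, tsum_mul_left] at h4
      exact (mul_eq_zero.1 h4).resolve_left (hκ0 a ha)) n
  exact (mul_eq_zero.1 h3).resolve_left (by exact_mod_cast Nat.succ_ne_zero n)

/-! ### The weak form of the spherical transform -/

theorem enorm_integral_mul_le {α : Type*} [MeasurableSpace α] {μ : Measure α} {f g : α → ℂ}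
    (hf : AEStronglyMeasurable f μ) (hg : AEStronglyMeasurable g μ) :
    ‖∫ x, f x * g x ∂μ‖ₑ ≤ eLpNorm f 2 μ * eLpNorm g 2 μ := by
  refine (enorm_integral_le_lintegral_enorm _).trans ?_
  rw [← eLpNorm_one_eq_lintegral_enorm]
  refine (eLpNorm_le_eLpNorm_mul_eLpNorm_of_nnnorm (p := 2) (q := 2) (r := 1) hf hg
    (fun a b : ℂ => a * b) 1 (ae_of_all _ fun y => by simp)).trans ?_
  simp

theorem tendsto_integral_mul {α : Type*} [MeasurableSpace α] {μ : Measure α} {f : ℕ → α → ℂ}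
    {F g : α → ℂ} (hf : ∀ j, AEStronglyMeasurable (f j) μ) (hF : AEStronglyMeasurable F μ)
    (hg : MemLp g 2 μ) (hi : ∀ j, Integrable (fun x => f j x * g x) μ)
    (hiF : Integrable (fun x => F x * g x) μ)
    (h : Tendsto (fun j => eLpNorm (fun x => f j x - F x) 2 μ) atTop (𝓝 0)) :
    Tendsto (fun j => ∫ x, f j x * g x ∂μ) atTop (𝓝 (∫ x, F x * g x ∂μ)) := by
  rw [tendsto_iff_edist_tendsto_0]
  have hlim : Tendsto (fun j => eLpNorm (fun x => f j x - F x) 2 μ * eLpNorm g 2 μ) atTop (𝓝 0) := by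
    have := ENNReal.Tendsto.mul_const h (Or.inr hg.2.ne)
    rwa [zero_mul] at this
  refine tendsto_of_tendsto_of_tendsto_of_le_of_le tendsto_const_nhds hlim (fun _ => zero_le)
    fun j => ?_
  rw [edist_eq_enorm_sub, ← integral_sub (hi j) hiF]
  simp only [← sub_mul]
  exact enorm_integral_mul_le ((hf j).sub hF) hg.1

/-- The relation `F ↦ b` tested against `sig` and `tau`. -/
structure WeakTransform (F : Hq → ℂ) (b : Dual → ℂ) : Prop where
  aesm : AEStronglyMeasurable F
  invariant : KInvariant F
  integrable : ∀ a : ℝ, 0 < a → Integrable fun x => F x * gaussTensor a (fun t => weight t) x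
  integrable' : ∀ a : ℝ, 0 < a →
    Integrable (fun p => b p * ((gam a ‖p.1‖ p.2 * weight₂ p.1 : ℝ) : ℂ)) nu
  pairing : ∀ a : ℝ, 0 < a → ∀ G : 𝓢(E3, ℂ), ∫ x, F x * sig a G x = ∫ p, b p * tau a G p ∂nu

/-- A Schwartz function is a bounded multiple of `weight`, so a single weighted condition for each
`a` covers all test functions. -/
theorem integrable_mul_sig {F : Hq → ℂ} {a : ℝ}
    (h : Integrable fun x => F x * gaussTensor a (fun t => weight t) x) (G : 𝓢(E3, ℂ)) :
    Integrable fun x => F x * sig a G x := by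
  obtain ⟨C, hC0, hC⟩ := schwartz_bound (𝓕⁻ G : 𝓢(E3, ℂ)) 2
  have hm : Measurable fun t : E3 => (𝓕⁻ G : 𝓢(E3, ℂ)) t / (weight t : ℂ) :=
    (𝓕⁻ G : 𝓢(E3, ℂ)).continuous.measurable.div
      (Complex.measurable_ofReal.comp contDiff_weight.continuous.measurable)
  refine (h.mul_bdd (c := C) (hm.comp measurable_t).aestronglyMeasurable
    (ae_of_all _ fun x => ?_)).congr (ae_of_all _ fun x => ?_)
  · simp only [Function.comp, norm_div, Complex.norm_real, Real.norm_of_nonneg (weight_pos _).le]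
    rw [div_le_iff₀ (weight_pos _)]
    exact hC _
  · have : (weight x.t : ℂ) ≠ 0 := by exact_mod_cast (weight_pos x.t).ne'
    simp only [sig, gaussTensor, Function.comp]
    field_simp

theorem integrable_mul_tau {b : Dual → ℂ} {a : ℝ}
    (h : Integrable (fun p => b p * ((gam a ‖p.1‖ p.2 * weight₂ p.1 : ℝ) : ℂ)) nu)
    (G : 𝓢(E3, ℂ)) : Integrable (fun p => b p * tau a G p) nu := by
  obtain ⟨C, hC0, hC⟩ := schwartz_scaled_bound G
  have hm : Measurable fun t : E3 => G ((2 * Real.pi)⁻¹ • t) / (weight₂ t : ℂ) :=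
    (G.continuous.measurable.comp (measurable_id.const_smul (2 * Real.pi)⁻¹)).div
      (Complex.measurable_ofReal.comp contDiff_weight₂.continuous.measurable)
  refine (h.mul_bdd (c := C) (hm.comp measurable_fst).aestronglyMeasurable
    (ae_of_all _ fun x => ?_)).congr (ae_of_all _ fun x => ?_)
  · simp only [Function.comp, norm_div, Complex.norm_real, Real.norm_of_nonneg (weight₂_pos _).le]
    rw [div_le_iff₀ (weight₂_pos _)]
    exact hC _
  · have : (weight₂ x.1 : ℂ) ≠ 0 := by exact_mod_cast (weight₂_pos x.1).ne'
    simp only [tau, Function.comp]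
    push_cast
    field_simp

theorem WeakTransform.linear {F F' : Hq → ℂ} {b b' : Dual → ℂ} (h : WeakTransform F b)
    (h' : WeakTransform F' b') (c : ℂ) :
    WeakTransform (fun x => F x + c * F' x) (fun p => b p + c * b' p) where
  aesm := h.aesm.add (h'.aesm.const_mul c)
  invariant := h.invariant.add (h'.invariant.const_mul c)
  integrable a ha := by
    simp only [add_mul, mul_assoc]
    exact (h.integrable a ha).add ((h'.integrable a ha).const_mul c)
  integrable' a ha := by
    simp only [add_mul, mul_assoc]
    exact (h.integrable' a ha).add ((h'.integrable' a ha).const_mul c)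
  pairing a ha G := by
    simp only [add_mul, mul_assoc]
    rw [integral_add (integrable_mul_sig (h.integrable a ha) G)
        ((integrable_mul_sig (h'.integrable a ha) G).const_mul c),
      integral_add (integrable_mul_tau (h.integrable' a ha) G)
        ((integrable_mul_tau (h'.integrable' a ha) G).const_mul c),
      integral_const_mul, integral_const_mul, h.pairing a ha, h'.pairing a ha]

theorem WeakTransform.congr {F F' : Hq → ℂ} {b b' : Dual → ℂ} (h : WeakTransform F b)
    (hF : F =ᵐ[volume] F') (hb : b =ᵐ[nu] b') : WeakTransform F' b' where
  aesm := h.aesm.congr hF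
  invariant := h.invariant.congr hF
  integrable a ha := (h.integrable a ha).congr (hF.mono fun x hx => by simp only [hx])
  integrable' a ha := (h.integrable' a ha).congr (hb.mono fun x hx => by simp only [hx])
  pairing a ha G := by
    rw [← integral_congr_ae (hF.mono fun x hx => show F x * sig a G x = F' x * sig a G x by rw [hx]),
      ← integral_congr_ae (hb.mono fun x hx => show b x * tau a G x = b' x * tau a G x by rw [hx]),
      h.pairing a ha]

/-- Injectivity of the transform: the test functions include all Gaussians times bumps in `t`.
`eq_zero_right` is the dual statement. -/
theorem WeakTransform.eq_zero_left {F : Hq → ℂ} (h : WeakTransform F 0) : F =ᵐ[volume] 0 := by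
  refine eq_zero_of_integral_gaussTensor h.aesm h.invariant h.integrable fun a ha χ hχ hs => ?_
  obtain ⟨G, hG⟩ := exists_sig_eq χ hχ hs
  rw [← hG, h.pairing a ha]
  simp

theorem WeakTransform.eq_zero_right {b : Dual → ℂ} (h : WeakTransform 0 b) : b =ᵐ[nu] 0 :=
  eq_zero_of_integral_tau h.integrable' fun a ha G => by
    rw [← h.pairing a ha]
    simp

theorem WeakTransform.unique_left {F F' : Hq → ℂ} {b b' : Dual → ℂ} (h : WeakTransform F b)
    (h' : WeakTransform F' b') (hb : b =ᵐ[nu] b') : F =ᵐ[volume] F' := by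
  have := ((h.linear h' (-1)).congr (Filter.EventuallyEq.refl _ _)
    (b' := 0) (hb.mono fun p hp => by simp [hp])).eq_zero_left
  filter_upwards [this] with x hx
  simpa [← sub_eq_add_neg, sub_eq_zero] using hx

theorem WeakTransform.unique_right {F F' : Hq → ℂ} {b b' : Dual → ℂ} (h : WeakTransform F b)
    (h' : WeakTransform F' b') (hF : F =ᵐ[volume] F') : b =ᵐ[nu] b' := by
  have := ((h.linear h' (-1)).congr (F' := 0) (hF.mono fun p hp => by simp [hp])
    (Filter.EventuallyEq.refl _ _)).eq_zero_right
  filter_upwards [this] with x hx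
  simpa [← sub_eq_add_neg, sub_eq_zero] using hx

theorem integrable_mul_gaussTensor_of_integrable {F : Hq → ℂ} (hF : Integrable F) {a : ℝ}
    (ha : 0 < a) : Integrable fun x => F x * gaussTensor a (fun t => weight t) x := by
  have hm : Measurable (gaussTensor a fun t => (weight t : ℂ)) := by
    have h1 : Measurable fun x : Hq => Real.exp (-(a * ‖x.u‖ ^ 2)) :=
      (((measurable_u.norm.pow_const 2).const_mul a).neg).exp
    exact (Complex.measurable_ofReal.comp h1).mul (Complex.measurable_ofReal.comp
      (contDiff_weight.continuous.measurable.comp measurable_t))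
  refine hF.mul_bdd (c := 1) hm.aestronglyMeasurable (ae_of_all _ fun x => ?_)
  rw [gaussTensor, norm_mul, Complex.norm_real, Complex.norm_real,
    Real.norm_of_nonneg (Real.exp_pos _).le, Real.norm_of_nonneg (weight_pos _).le]
  refine mul_le_one₀ (Real.exp_le_one_iff.2 ?_) (weight_pos _).le ?_
  · rw [neg_nonpos]
    positivity
  · exact pow_le_one₀ (by positivity) (inv_le_one_of_one_le₀ (by nlinarith [sq_nonneg ‖x.t‖]))

theorem norm_gaussTensor_le {a : ℝ} (ha : 0 < a) {h : E3 → ℂ} {C : ℝ} (hC : ∀ t, ‖h t‖ ≤ C)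
    (x : Hq) : ‖gaussTensor a h x‖ ≤ C := by
  rw [gaussTensor, norm_mul, Complex.norm_real, Real.norm_of_nonneg (Real.exp_pos _).le]
  refine (mul_le_of_le_one_left (norm_nonneg _) (Real.exp_le_one_iff.2 ?_)).trans (hC _)
  rw [neg_nonpos]
  positivity

theorem memLp_gaussTensor_weight {a : ℝ} (ha : 0 < a) :
    MemLp (gaussTensor a fun t => (weight t : ℂ)) 2 :=
  memLp_two_of_integrable_of_bounded (integrable_gaussTensor ha integrable_weight.ofReal)
    (ae_of_all _ (norm_gaussTensor_le ha (C := 1) fun t => by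
      rw [Complex.norm_real, Real.norm_of_nonneg (weight_pos _).le]
      exact pow_le_one₀ (by positivity) (inv_le_one_of_one_le₀ (by nlinarith [sq_nonneg ‖t‖]))))

theorem memLp_sig {a : ℝ} (ha : 0 < a) (G : 𝓢(E3, ℂ)) : MemLp (sig a G) 2 := by
  obtain ⟨C, -, hC⟩ := schwartz_bound (𝓕⁻ G : 𝓢(E3, ℂ)) 0
  exact memLp_two_of_integrable_of_bounded (integrable_sig ha G)
    (ae_of_all _ (norm_gaussTensor_le ha (C := C) fun t => by simpa using hC t))

theorem L1sharp.weakTransform {f : Hq → ℂ} (hf : L1sharp f) :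
    WeakTransform f (sphericalTransform f) where
  aesm := hf.1.aestronglyMeasurable
  invariant := hf.2
  integrable _ ha := integrable_mul_gaussTensor_of_integrable hf.1 ha
  integrable' _ ha := (integrable_gam_mul_weight ha).bdd_mul (c := ∫ x, ‖f x‖)
    (stronglyMeasurable_sphericalTransform hf.1.aestronglyMeasurable).aestronglyMeasurable
    (ae_of_all _ (norm_sphericalTransform_le hf.1))
  pairing _ ha G := integral_mul_sig hf.1 ha G

/-- Parseval for the approximants passes to the limit, since test functions and their transforms are
in `L²`. -/
theorem HasPlancherelTransform.weakTransform {F : Hq → ℂ} {b : Dual → ℂ}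
    (h : HasPlancherelTransform F b) : WeakTransform F b := by
  obtain ⟨hF, hb, f, hf, hlim, hlim'⟩ := h
  have h1 : ∀ a : ℝ, 0 < a → Integrable fun x => F x * gaussTensor a (fun t => weight t) x :=
    fun _ ha => hF.1.integrable_mul (memLp_gaussTensor_weight ha)
  have h2 : ∀ a : ℝ, 0 < a →
      Integrable (fun p => b p * ((gam a ‖p.1‖ p.2 * weight₂ p.1 : ℝ) : ℂ)) nu :=
    fun _ ha => hb.integrable_mul (memLp_gam_mul_weight ha)
  refine ⟨hF.1.1, hF.2, h1, h2, fun _ ha G => ?_⟩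
  have l1 := tendsto_integral_mul (fun j => (hf j).2.1.1) hF.1.1 (memLp_sig ha G)
    (fun j => integrable_mul_sig ((hf j).1.weakTransform.integrable _ ha) G)
    (integrable_mul_sig (h1 _ ha) G) hlim
  have l2 := tendsto_integral_mul
    (fun j => (stronglyMeasurable_sphericalTransform
      (hf j).1.1.aestronglyMeasurable).aestronglyMeasurable) hb.1 (memLp_tau ha G)
    (fun j => integrable_mul_tau ((hf j).1.weakTransform.integrable' _ ha) G)
    (integrable_mul_tau (h2 _ ha) G) hlim'
  simp only [fun j => (hf j).1.weakTransform.pairing _ ha G] at l1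
  exact tendsto_nhds_unique l1 l2

theorem HasTransform.weakTransform {F : Hq → ℂ} {b : Dual → ℂ} (h : HasTransform F b) :
    WeakTransform F b := by
  obtain ⟨F₁, F₂, a₂, h1, h2, h3, h4⟩ := h
  refine (h1.weakTransform.linear h2.weakTransform 1).congr ?_ ?_
  · filter_upwards [h3] with x hx
    rw [hx, one_mul]
  · filter_upwards [h4] with x hx
    rw [hx, one_mul]

/-! ### The Plancherel theorem -/

/-- `L²` of the group. -/
abbrev L2G : Type := Lp ℂ 2 (volume : Measure Hq)

/-- `L²` of the Plancherel measure. -/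
abbrev L2D : Type := Lp ℂ 2 nu

theorem memLp_star {α : Type*} [MeasurableSpace α] {μ : Measure α} {f : α → ℂ}
    (hf : MemLp f 2 μ) : MemLp (fun x => star (f x)) 2 μ :=
  hf.star

/-- The pair of a conjugate test function and its spherical transform. -/
def testPair (q : {a : ℝ // 0 < a} × 𝓢(E3, ℂ)) : L2G × L2D :=
  ((memLp_star (memLp_sig q.1.2 q.2)).toLp, (memLp_star (memLp_tau q.1.2 q.2)).toLp)

/-- The span of the test pairs. -/
def testSpan : Submodule ℂ (L2G × L2D) := Submodule.span ℂ (Set.range testPair)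

/-- The graph of the spherical Plancherel transform. -/
def graph : Submodule ℂ (L2G × L2D) := testSpan.topologicalClosure

theorem inner_testPair_fst (q : {a : ℝ // 0 < a} × 𝓢(E3, ℂ)) (f : L2G) :
    inner ℂ (testPair q).1 f = ∫ x, f x * sig q.1 q.2 x := by
  rw [L2.inner_def]
  refine integral_congr_ae ?_
  filter_upwards [(memLp_star (memLp_sig q.1.2 q.2)).coeFn_toLp] with x hx
  simp only [testPair, RCLike.inner_apply]
  rw [hx, Complex.star_def, Complex.conj_conj]

theorem inner_testPair_snd (q : {a : ℝ // 0 < a} × 𝓢(E3, ℂ)) (b : L2D) :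
    inner ℂ (testPair q).2 b = ∫ p, b p * tau q.1 q.2 p ∂nu := by
  rw [L2.inner_def]
  refine integral_congr_ae ?_
  filter_upwards [(memLp_star (memLp_tau q.1.2 q.2)).coeFn_toLp] with x hx
  simp only [testPair, RCLike.inner_apply]
  rw [hx, Complex.star_def, Complex.conj_conj]

theorem sphericalTransform_linear {f g : Hq → ℂ} (hf : Integrable f) (hg : Integrable g) (c : ℂ)
    (p : Dual) : sphericalTransform (fun x => f x + c * g x) p =
      sphericalTransform f p + c * sphericalTransform g p := by
  simp only [sphericalTransform, add_mul, mul_assoc]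
  rw [integral_add (integrable_mul_phi hf p) ((integrable_mul_phi hg p).const_mul c),
    integral_const_mul]

theorem L1sharp.linear {f g : Hq → ℂ} (hf : L1sharp f) (hg : L1sharp g) (c : ℂ) :
    L1sharp fun x => f x + c * g x :=
  ⟨hf.1.add (hg.1.const_mul c), hf.2.add (hg.2.const_mul c)⟩

theorem L2sharp.linear {f g : Hq → ℂ} (hf : L2sharp f) (hg : L2sharp g) (c : ℂ) :
    L2sharp fun x => f x + c * g x :=
  ⟨hf.1.add (hg.1.const_mul c), hf.2.add (hg.2.const_mul c)⟩

theorem L1sharp_zero : L1sharp fun _ => 0 :=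
  ⟨integrable_zero _ _ _, fun _ => ae_of_all _ fun _ => rfl⟩

theorem L2sharp_zero : L2sharp fun _ => 0 :=
  ⟨MemLp.zero, fun _ => ae_of_all _ fun _ => rfl⟩

/-- Elements of the span are pairs of a function in `L^{1,#} ∩ L^{2,#}` and its transform. -/
theorem exists_of_mem_testSpan {x : L2G × L2D} (hx : x ∈ testSpan) :
    ∃ h : Hq → ℂ, L1sharp h ∧ L2sharp h ∧ x.1 =ᵐ[volume] h ∧
      x.2 =ᵐ[nu] sphericalTransform h := by
  induction hx using Submodule.span_induction with
  | mem x hx =>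
    obtain ⟨q, rfl⟩ := hx
    refine ⟨fun x => star (sig q.1 q.2 x), L1sharp_star_sig q.1.2 q.2,
      ⟨memLp_star (memLp_sig q.1.2 q.2), (L1sharp_star_sig q.1.2 q.2).2⟩,
      (memLp_star (memLp_sig q.1.2 q.2)).coeFn_toLp, ?_⟩
    refine (memLp_star (memLp_tau q.1.2 q.2)).coeFn_toLp.trans (ae_of_all _ fun p => ?_)
    exact (sphericalTransform_star_sig q.1.2 q.2 p).symm
  | zero =>
    refine ⟨fun _ => 0, L1sharp_zero, L2sharp_zero, Lp.coeFn_zero _ _ _, ?_⟩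
    refine (Lp.coeFn_zero _ _ _).trans (ae_of_all _ fun p => ?_)
    simp [sphericalTransform]
  | add x y _ _ hx hy =>
    obtain ⟨h, h1, h2, h3, h4⟩ := hx
    obtain ⟨k, k1, k2, k3, k4⟩ := hy
    refine ⟨_, h1.linear k1 1, h2.linear k2 1, ?_, ?_⟩
    · filter_upwards [h3, k3, Lp.coeFn_add x.1 y.1] with t ht kt e
      rw [Prod.fst_add, e, Pi.add_apply, ht, kt, one_mul]
    · filter_upwards [h4, k4, Lp.coeFn_add x.2 y.2] with t ht kt e
      rw [Prod.snd_add, e, Pi.add_apply, ht, kt, sphericalTransform_linear h1.1 k1.1, one_mul]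
  | smul c x _ hx =>
    obtain ⟨h, h1, h2, h3, h4⟩ := hx
    refine ⟨_, L1sharp_zero.linear h1 c, L2sharp_zero.linear h2 c, ?_, ?_⟩
    · filter_upwards [h3, Lp.coeFn_smul c x.1] with t ht e
      rw [Prod.smul_fst, e, Pi.smul_apply, ht, smul_eq_mul, zero_add]
    · filter_upwards [h4, Lp.coeFn_smul c x.2] with t ht e
      rw [Prod.smul_snd, e, Pi.smul_apply, ht,
        sphericalTransform_linear L1sharp_zero.1 h1.1, smul_eq_mul]
      simp [sphericalTransform]

/-- The Parseval identity; test pairs carry conjugates so that the bilinear pairing becomes an inner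
product. -/
theorem inner_eq_of_mem_testSpan {x y : L2G × L2D} (hx : x ∈ testSpan) (hy : y ∈ testSpan) :
    inner ℂ y.1 x.1 = inner ℂ y.2 x.2 := by
  induction hy using Submodule.span_induction with
  | mem y hy =>
    obtain ⟨q, rfl⟩ := hy
    obtain ⟨h, h1, -, h3, h4⟩ := exists_of_mem_testSpan hx
    rw [inner_testPair_fst, inner_testPair_snd,
      integral_congr_ae (h3.mono fun t ht => show x.1 t * sig q.1 q.2 t = h t * sig q.1 q.2 t by
        rw [ht]),
      integral_congr_ae (h4.mono fun t ht => show x.2 t * tau q.1 q.2 t =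
        sphericalTransform h t * tau q.1 q.2 t by rw [ht]), integral_mul_sig h1.1 q.1.2]
  | zero => simp
  | add y z _ _ hy hz => simp only [Prod.fst_add, Prod.snd_add, inner_add_left, hy, hz]
  | smul c y _ hy => simp only [Prod.smul_fst, Prod.smul_snd, inner_smul_left, hy]

theorem norm_eq_of_mem_graph {x : L2G × L2D} (hx : x ∈ graph) : ‖x.1‖ = ‖x.2‖ := by
  have hcl : IsClosed {x : L2G × L2D | ‖x.1‖ = ‖x.2‖} := isClosed_eq (by fun_prop) (by fun_prop)
  refine closure_minimal (fun y hy => ?_) hcl hx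
  have h := inner_eq_of_mem_testSpan hy hy
  rw [inner_self_eq_norm_sq_to_K, inner_self_eq_norm_sq_to_K] at h
  have h2 : ‖y.1‖ ^ 2 = ‖y.2‖ ^ 2 := by exact_mod_cast h
  exact (sq_eq_sq₀ (norm_nonneg _) (norm_nonneg _)).1 h2

/-- Invariance survives `L²` limits because composition with `act k` is an isometry. -/
theorem L2sharp_of_mem_graph {x : L2G × L2D} (hx : x ∈ graph) : L2sharp x.1 := by
  refine ⟨Lp.memLp _, fun k => ?_⟩
  have hcl : IsClosed {x : L2G × L2D |
      Lp.compMeasurePreserving (act k) (measurePreserving_act k) x.1 = x.1} :=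
    isClosed_eq ((Lp.isometry_compMeasurePreserving _).continuous.comp continuous_fst)
      continuous_fst
  have h : Lp.compMeasurePreserving (act k) (measurePreserving_act k) x.1 = x.1 := by
    refine closure_minimal (fun y hy => ?_) hcl hx
    obtain ⟨h, -, h2, h3, -⟩ := exists_of_mem_testSpan hy
    refine Lp.ext ((Lp.coeFn_compMeasurePreserving _ _).trans ?_)
    exact h2.2.congr h3.symm k
  have h2 := Lp.coeFn_compMeasurePreserving x.1 (measurePreserving_act k)
  rw [h] at h2
  exact h2.symm

theorem hasPlancherelTransform_of_mem_graph {x : L2G × L2D} (hx : x ∈ graph) :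
    HasPlancherelTransform x.1 x.2 := by
  obtain ⟨s, hs, hlim⟩ := mem_closure_iff_seq_limit.1 hx
  choose h h1 h2 h3 h4 using fun j => exists_of_mem_testSpan (hs j)
  refine ⟨L2sharp_of_mem_graph hx, Lp.memLp _, h, fun j => ⟨h1 j, h2 j⟩, ?_, ?_⟩
  · have := (Lp.tendsto_Lp_iff_tendsto_eLpNorm' _ _).1 ((continuous_fst.tendsto x).comp hlim)
    refine this.congr fun j => eLpNorm_congr_ae ?_
    filter_upwards [h3 j] with t ht
    rw [← ht]
    rfl
  · have := (Lp.tendsto_Lp_iff_tendsto_eLpNorm' _ _).1 ((continuous_snd.tendsto x).comp hlim)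
    refine this.congr fun j => eLpNorm_congr_ae ?_
    filter_upwards [h4 j] with t ht
    rw [← ht]
    rfl

theorem testPair_mem_graph (q : {a : ℝ // 0 < a} × 𝓢(E3, ℂ)) : testPair q ∈ graph :=
  testSpan.le_topologicalClosure (Submodule.subset_span ⟨q, rfl⟩)

theorem isClosed_graph : IsClosed (graph : Set (L2G × L2D)) :=
  testSpan.isClosed_topologicalClosure

/-- On the graph both components have equal norm, so the projection is an isometry from a complete
space. -/
theorem isClosed_map_fst : IsClosed (graph.map (LinearMap.fst ℂ L2G L2D) : Set L2G) := by
  have : CompleteSpace graph := isClosed_graph.completeSpace_coe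
  have hi : Isometry fun x : graph => (x : L2G × L2D).1 := by
    refine AddMonoidHomClass.isometry_of_norm
      ((LinearMap.fst ℂ L2G L2D).domRestrict graph) fun x => ?_
    change ‖x.1.1‖ = max ‖x.1.1‖ ‖x.1.2‖
    rw [← norm_eq_of_mem_graph x.2, max_self]
  convert hi.isClosedEmbedding.isClosed_range using 1
  ext y
  simp

theorem isClosed_map_snd : IsClosed (graph.map (LinearMap.snd ℂ L2G L2D) : Set L2D) := by
  have : CompleteSpace graph := isClosed_graph.completeSpace_coe
  have hi : Isometry fun x : graph => (x : L2G × L2D).2 := by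
    refine AddMonoidHomClass.isometry_of_norm
      ((LinearMap.snd ℂ L2G L2D).domRestrict graph) fun x => ?_
    change ‖x.1.2‖ = max ‖x.1.1‖ ‖x.1.2‖
    rw [norm_eq_of_mem_graph x.2, max_self]
  convert hi.isClosedEmbedding.isClosed_range using 1
  ext y
  simp

/-- The part of `F` orthogonal to the closed image is `K`-invariant and orthogonal to every test
function, hence zero by completeness. -/
theorem exists_mem_graph_fst {F : Hq → ℂ} (hF : L2sharp F) :
    ∃ x ∈ graph, x.1 =ᵐ[volume] F := by
  set L : Submodule ℂ L2G := graph.map (LinearMap.fst ℂ L2G L2D)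
  have : CompleteSpace L := isClosed_map_fst.completeSpace_coe
  set f : L2G := hF.1.toLp
  obtain ⟨y, hy, hyx⟩ := Submodule.mem_map.1 (L.starProjection_apply_mem f)
  have hyx : y.1 = L.starProjection f := hyx
  refine ⟨y, hy, ?_⟩
  have horth : ∀ q, inner ℂ (testPair q).1 (f - y.1) = 0 := fun q => by
    rw [hyx]
    exact (Submodule.mem_orthogonal L _).1 (L.sub_starProjection_mem_orthogonal f) _
      (Submodule.mem_map_of_mem (testPair_mem_graph q))
  have hyL := L2sharp_of_mem_graph hy
  have hfK : KInvariant f := hF.2.congr hF.1.coeFn_toLp.symm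
  have hsub := Lp.coeFn_sub f y.1
  have hW : WeakTransform (f - y.1 : L2G) 0 := by
    refine ⟨(Lp.memLp _).1, ?_, fun a ha => (Lp.memLp _).integrable_mul
      (memLp_gaussTensor_weight ha), fun a ha => by simp, fun a ha G => ?_⟩
    · refine (hfK.add (hyL.2.const_mul (-1))).congr ?_
      filter_upwards [hsub] with t ht
      rw [ht, Pi.sub_apply]
      ring
    · rw [← inner_testPair_fst (⟨a, ha⟩, G), horth]
      simp
  filter_upwards [hW.eq_zero_left, hsub, hF.1.coeFn_toLp] with t h1 h2 h3
  rw [h2, Pi.sub_apply, Pi.zero_apply, sub_eq_zero] at h1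
  rw [← h1, h3]

theorem exists_mem_graph_snd {b : Dual → ℂ} (hb : MemLp b 2 nu) :
    ∃ x ∈ graph, x.2 =ᵐ[nu] b := by
  set L : Submodule ℂ L2D := graph.map (LinearMap.snd ℂ L2G L2D)
  have : CompleteSpace L := isClosed_map_snd.completeSpace_coe
  set f : L2D := hb.toLp
  obtain ⟨y, hy, hyx⟩ := Submodule.mem_map.1 (L.starProjection_apply_mem f)
  have hyx : y.2 = L.starProjection f := hyx
  refine ⟨y, hy, ?_⟩
  have horth : ∀ q, inner ℂ (testPair q).2 (f - y.2) = 0 := fun q => by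
    rw [hyx]
    exact (Submodule.mem_orthogonal L _).1 (L.sub_starProjection_mem_orthogonal f) _
      (Submodule.mem_map_of_mem (testPair_mem_graph q))
  have h0 := eq_zero_of_integral_tau (b := (f - y.2 : L2D))
    (fun a ha => (Lp.memLp _).integrable_mul (memLp_gam_mul_weight ha))
    (fun a ha G => by rw [← inner_testPair_snd (⟨a, ha⟩, G), horth])
  filter_upwards [h0, Lp.coeFn_sub f y.2, hb.coeFn_toLp] with t h1 h2 h3
  rw [h2, Pi.sub_apply, Pi.zero_apply, sub_eq_zero] at h1
  rw [← h1, h3]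

theorem L2sharp.congr {F F' : Hq → ℂ} (h : L2sharp F) (hF : F =ᵐ[volume] F') : L2sharp F' :=
  ⟨(memLp_congr_ae hF).1 h.1, h.2.congr hF⟩

theorem HasPlancherelTransform.congr {F F' : Hq → ℂ} {b b' : Dual → ℂ}
    (h : HasPlancherelTransform F b) (hF : F =ᵐ[volume] F') (hb : b =ᵐ[nu] b') :
    HasPlancherelTransform F' b' := by
  obtain ⟨h1, h2, f, hf, l1, l2⟩ := h
  refine ⟨h1.congr hF, (memLp_congr_ae hb).1 h2, f, hf, ?_, ?_⟩
  · refine l1.congr fun j => eLpNorm_congr_ae ?_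
    filter_upwards [hF] with t ht
    rw [ht]
  · refine l2.congr fun j => eLpNorm_congr_ae ?_
    filter_upwards [hb] with t ht
    rw [ht]

theorem exists_plancherelTransform {F : Hq → ℂ} (hF : L2sharp F) :
    ∃ b, HasPlancherelTransform F b := by
  obtain ⟨x, hx, h⟩ := exists_mem_graph_fst hF
  exact ⟨x.2, (hasPlancherelTransform_of_mem_graph hx).congr h (Filter.EventuallyEq.refl _ _)⟩

theorem exists_of_plancherelTransform {b : Dual → ℂ} (hb : MemLp b 2 nu) :
    ∃ F, HasPlancherelTransform F b := by
  obtain ⟨x, hx, h⟩ := exists_mem_graph_snd hb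
  exact ⟨x.1, (hasPlancherelTransform_of_mem_graph hx).congr (Filter.EventuallyEq.refl _ _) h⟩

theorem HasPlancherelTransform.eLpNorm_eq {F : Hq → ℂ} {b : Dual → ℂ}
    (h : HasPlancherelTransform F b) : eLpNorm F 2 volume = eLpNorm b 2 nu := by
  obtain ⟨x, hx, hxF⟩ := exists_mem_graph_fst h.1
  have hb := (hasPlancherelTransform_of_mem_graph hx).weakTransform.unique_right h.weakTransform hxF
  rw [← eLpNorm_congr_ae hxF, ← eLpNorm_congr_ae hb,
    ← ENNReal.toReal_eq_toReal_iff' (Lp.memLp _).2.ne (Lp.memLp _).2.ne]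
  exact norm_eq_of_mem_graph hx

/-- On `L^{1,#} ∩ L^{2,#}` the Plancherel transform is the spherical transform. -/
theorem hasPlancherelTransform_sphericalTransform {f : Hq → ℂ} (h1 : L1sharp f) (h2 : L2sharp f) :
    HasPlancherelTransform f (sphericalTransform f) := by
  obtain ⟨b, hb⟩ := exists_plancherelTransform h2
  exact hb.congr (Filter.EventuallyEq.refl _ _)
    (hb.weakTransform.unique_right h1.weakTransform (Filter.EventuallyEq.refl _ _))

/-! ### Transforms of convolutions -/

theorem WeakTransform.hasPlancherelTransform {F : Hq → ℂ} {b : Dual → ℂ} (h : WeakTransform F b)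
    (hF : L2sharp F) : HasPlancherelTransform F b := by
  obtain ⟨b', hb⟩ := exists_plancherelTransform hF
  exact hb.congr (Filter.EventuallyEq.refl _ _)
    (hb.weakTransform.unique_right h (Filter.EventuallyEq.refl _ _))

theorem HasPlancherelTransform.linear {F F' : Hq → ℂ} {b b' : Dual → ℂ}
    (h : HasPlancherelTransform F b) (h' : HasPlancherelTransform F' b') (c : ℂ) :
    HasPlancherelTransform (fun x => F x + c * F' x) (fun p => b p + c * b' p) :=
  (h.weakTransform.linear h'.weakTransform c).hasPlancherelTransform (h.1.linear h'.1 c)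

theorem sphericalTransform_zero (p : Dual) : sphericalTransform (fun _ => 0) p = 0 := by
  simp [sphericalTransform]

theorem HasTransform.congr {F F' : Hq → ℂ} {b b' : Dual → ℂ} (h : HasTransform F b)
    (hF : F =ᵐ[volume] F') (hb : b =ᵐ[nu] b') : HasTransform F' b' := by
  obtain ⟨F₁, F₂, a₂, h1, h2, h3, h4⟩ := h
  exact ⟨F₁, F₂, a₂, h1, h2, hF.symm.trans h3, hb.symm.trans h4⟩

theorem HasTransform.linear {F F' : Hq → ℂ} {b b' : Dual → ℂ} (h : HasTransform F b)
    (h' : HasTransform F' b') (c : ℂ) :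
    HasTransform (fun x => F x + c * F' x) (fun p => b p + c * b' p) := by
  obtain ⟨F₁, F₂, a₂, h1, h2, h3, h4⟩ := h
  obtain ⟨G₁, G₂, b₂, k1, k2, k3, k4⟩ := h'
  refine ⟨_, _, _, h1.linear k1 c, h2.linear k2 c, ?_, ?_⟩
  · filter_upwards [h3, k3] with x hx kx
    rw [hx, kx]
    ring
  · filter_upwards [h4, k4] with x hx kx
    rw [hx, kx, sphericalTransform_linear h1.1 k1.1]
    ring

theorem L1sharp.hasTransform {f : Hq → ℂ} (hf : L1sharp f) :
    HasTransform f (sphericalTransform f) := by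
  refine ⟨f, fun _ => 0, _, hf, hasPlancherelTransform_sphericalTransform L1sharp_zero
    L2sharp_zero, ae_of_all _ fun x => (add_zero _).symm, ae_of_all _ fun p => ?_⟩
  rw [sphericalTransform_zero, add_zero]

theorem HasPlancherelTransform.hasTransform {F : Hq → ℂ} {b : Dual → ℂ}
    (h : HasPlancherelTransform F b) : HasTransform F b := by
  refine ⟨fun _ => 0, F, b, L1sharp_zero, h, ae_of_all _ fun x => (zero_add _).symm,
    ae_of_all _ fun p => ?_⟩
  rw [sphericalTransform_zero, zero_add]

theorem conv_linear_right {f g h : Hq → ℂ} (hg : ConvExists f g) (hh : ConvExists f h) (c : ℂ) :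
    (conv f fun x => g x + c * h x) =ᵐ[volume] fun x => conv f g x + c * conv f h x := by
  filter_upwards [hg, hh] with x h1 h2
  simp only [conv]
  rw [← integral_const_mul, ← integral_add h1 (h2.const_mul c)]
  exact integral_congr_ae (ae_of_all _ fun y => by ring)

theorem conv_linear_left {f g h : Hq → ℂ} (hf : ConvExists f h) (hg : ConvExists g h) (c : ℂ) :
    conv (fun x => f x + c * g x) h =ᵐ[volume] fun x => conv f h x + c * conv g h x := by
  filter_upwards [hf, hg] with x h1 h2
  simp only [conv]
  rw [← integral_const_mul, ← integral_add h1 (h2.const_mul c)]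
  exact integral_congr_ae (ae_of_all _ fun y => by ring)

theorem ConvExists.linear_right {f g h : Hq → ℂ} (hg : ConvExists f g) (hh : ConvExists f h)
    (c : ℂ) : ConvExists f fun x => g x + c * h x := by
  filter_upwards [hg, hh] with x h1 h2
  exact (h1.add (h2.const_mul c)).congr (ae_of_all _ fun y => by simp only [Pi.add_apply]; ring)

theorem ConvExists.linear_left {f g h : Hq → ℂ} (hf : ConvExists f h) (hg : ConvExists g h)
    (c : ℂ) : ConvExists (fun x => f x + c * g x) h := by
  filter_upwards [hf, hg] with x h1 h2
  exact (h1.add (h2.const_mul c)).congr (ae_of_all _ fun y => by simp only [Pi.add_apply]; ring)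

theorem kernel_congr {f f' g g' : Hq → ℂ} (hf : f =ᵐ[volume] f') (hg : g =ᵐ[volume] g') (x : Hq) :
    (fun y => f y * g (y⁻¹ * x)) =ᵐ[volume] fun y => f' y * g' (y⁻¹ * x) := by
  filter_upwards [hf, (measurePreserving_inv_mul x).quasiMeasurePreserving.ae hg] with y h1 h2
  rw [h1, h2]

theorem conv_congr {f f' g g' : Hq → ℂ} (hf : f =ᵐ[volume] f') (hg : g =ᵐ[volume] g') :
    conv f g = conv f' g' :=
  funext fun x => integral_congr_ae (kernel_congr hf hg x)

theorem ConvExists.congr {f f' g g' : Hq → ℂ} (h : ConvExists f g) (hf : f =ᵐ[volume] f')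
    (hg : g =ᵐ[volume] g') : ConvExists f' g' :=
  h.mono fun x hx => hx.congr (kernel_congr hf hg x)

/-- A closedness property of the Plancherel transform. -/
theorem HasPlancherelTransform.of_tendsto {F : ℕ → Hq → ℂ} {b : ℕ → Dual → ℂ} {G : Hq → ℂ}
    {a : Dual → ℂ} (h : ∀ j, HasPlancherelTransform (F j) (b j))
    (hF : TendstoInMeasure volume F atTop G) (ha : MemLp a 2 nu)
    (hb : Tendsto (fun j => eLpNorm (fun p => b j p - a p) 2 nu) atTop (𝓝 0)) :
    HasPlancherelTransform G a := by
  obtain ⟨Q, hQ⟩ := exists_of_plancherelTransform ha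
  have hlim : Tendsto (fun j => eLpNorm (F j - Q) 2 volume) atTop (𝓝 0) := by
    refine hb.congr fun j => ?_
    have := ((h j).linear hQ (-1)).eLpNorm_eq
    simp only [neg_mul, one_mul, ← sub_eq_add_neg] at this
    exact this.symm
  -- Surjectivity gives a function `Q` with transform `a`, and isometry gives `F j → Q` in `L²`.
  -- Comparing limits in measure allows the convergence to `G` to be in another norm, such as the
  -- uniform one below.
  have h2 := tendstoInMeasure_of_tendsto_eLpNorm two_ne_zero (fun j => (h j).1.1.1) hQ.1.1.1 hlim
  exact hQ.congr (tendstoInMeasure_ae_unique h2 hF) (Filter.EventuallyEq.refl _ _)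

theorem memLp_mul_of_bounded {a b : Dual → ℂ} (ha : AEStronglyMeasurable a nu) {C : ℝ}
    (hC : ∀ᵐ p ∂nu, ‖a p‖ ≤ C) (hb : MemLp b 2 nu) : MemLp (fun p => a p * b p) 2 nu := by
  refine hb.of_le_mul (c := C) (ha.mul hb.1) ?_
  filter_upwards [hC] with p hp
  rw [norm_mul]
  gcongr

theorem tendsto_eLpNorm_mul {a b : Dual → ℂ} {β : ℕ → Dual → ℂ} {C : ℝ}
    (hC : ∀ᵐ p ∂nu, ‖a p‖ ≤ C)
    (hb : Tendsto (fun j => eLpNorm (fun p => β j p - b p) 2 nu) atTop (𝓝 0)) :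
    Tendsto (fun j => eLpNorm (fun p => a p * β j p - a p * b p) 2 nu) atTop (𝓝 0) := by
  have hlim := ENNReal.Tendsto.const_mul hb (Or.inr (ENNReal.ofReal_ne_top (r := C)))
  rw [mul_zero] at hlim
  refine tendsto_of_tendsto_of_tendsto_of_le_of_le tendsto_const_nhds hlim (fun _ => zero_le)
    fun j => eLpNorm_le_mul_eLpNorm_of_ae_le_mul ?_ 2
  filter_upwards [hC] with p hp
  rw [← mul_sub, norm_mul]
  gcongr

theorem aestronglyMeasurable_sphericalTransform {f : Hq → ℂ} (hf : L1sharp f) :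
    AEStronglyMeasurable (sphericalTransform f) nu :=
  (stronglyMeasurable_sphericalTransform hf.1.aestronglyMeasurable).aestronglyMeasurable

theorem L1sharp.conv_hasPlancherelTransform {f h : Hq → ℂ} {b : Dual → ℂ} (hf : L1sharp f)
    (hh : HasPlancherelTransform h b) :
    HasPlancherelTransform (QHeis.conv f h) (fun p => sphericalTransform f p * b p) := by
  have hbd := ae_of_all nu (norm_sphericalTransform_le hf.1)
  obtain ⟨hh1, hb, s, hs, l1, l2⟩ := hh
  refine .of_tendsto (F := fun j => QHeis.conv f (s j))
    (b := fun j p => sphericalTransform f p * sphericalTransform (s j) p) (fun j => ?_) ?_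
    (memLp_mul_of_bounded (aestronglyMeasurable_sphericalTransform hf) hbd hb)
    (tendsto_eLpNorm_mul hbd l2)
  · rw [← funext (sphericalTransform_conv hf (hs j).1)]
    exact hasPlancherelTransform_sphericalTransform (hf.conv (hs j).1)
      ⟨memLp_conv hf.1 (hs j).2.1, hf.2.conv (hs j).1.2⟩
  · refine tendstoInMeasure_of_tendsto_eLpNorm two_ne_zero
      (fun j => (memLp_conv hf.1 (hs j).2.1).1) (memLp_conv hf.1 hh1.1).1 ?_
    have hlim := ENNReal.Tendsto.const_mul l1 (Or.inr (memLp_one_iff_integrable.2 hf.1).2.ne)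
    rw [mul_zero] at hlim
    refine tendsto_of_tendsto_of_tendsto_of_le_of_le tendsto_const_nhds hlim (fun _ => zero_le)
      fun j => ?_
    refine le_trans (eLpNorm_congr_ae ?_).le
      (eLpNorm_conv_le hf.1 ((hs j).2.1.sub hh1.1).1)
    have := conv_linear_right (convExists_L1_L2 hf.1 (hs j).2.1) (convExists_L1_L2 hf.1 hh1.1) (-1)
    simp only [neg_mul, one_mul, ← sub_eq_add_neg] at this
    exact this.symm

theorem HasPlancherelTransform.conv_L1sharp {F g : Hq → ℂ} {b : Dual → ℂ}
    (hF : HasPlancherelTransform F b) (hg : L1sharp g) :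
    HasPlancherelTransform (conv F g) (fun p => b p * sphericalTransform g p) := by
  have hbd := ae_of_all nu (norm_sphericalTransform_le hg.1)
  obtain ⟨hF1, hb, s, hs, l1, l2⟩ := hF
  simp only [mul_comm (b _)]
  refine .of_tendsto (F := fun j => conv (s j) g)
    (b := fun j p => sphericalTransform g p * sphericalTransform (s j) p) (fun j => ?_) ?_
    (memLp_mul_of_bounded (aestronglyMeasurable_sphericalTransform hg) hbd hb)
    (tendsto_eLpNorm_mul hbd l2)
  · simp only [mul_comm (sphericalTransform g _)]
    rw [← funext (sphericalTransform_conv (hs j).1 hg)]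
    exact hasPlancherelTransform_sphericalTransform ((hs j).1.conv hg)
      ⟨memLp_conv' (hs j).2.1 hg.1, (hs j).1.2.conv hg.2⟩
  · refine tendstoInMeasure_of_tendsto_eLpNorm two_ne_zero
      (fun j => (memLp_conv' (hs j).2.1 hg.1).1) (memLp_conv' hF1.1 hg.1).1 ?_
    have hlim := ENNReal.Tendsto.mul_const l1 (Or.inr (memLp_one_iff_integrable.2 hg.1).2.ne)
    rw [zero_mul] at hlim
    refine tendsto_of_tendsto_of_tendsto_of_le_of_le tendsto_const_nhds hlim (fun _ => zero_le)
      fun j => ?_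
    refine le_trans (eLpNorm_congr_ae ?_).le
      (eLpNorm_conv_le' ((hs j).2.1.sub hF1.1) hg.1)
    have := conv_linear_left (convExists_L2_L1 (hs j).2.1 hg.1) (convExists_L2_L1 hF1.1 hg.1) (-1)
    simp only [neg_mul, one_mul, ← sub_eq_add_neg] at this
    exact this.symm

/-- `F * s_j` tends to `F * G` uniformly, while the transforms converge in `L²(ν)` because `a` is
bounded. Without that bound the convolution need not be in `L²`. -/
theorem HasPlancherelTransform.conv {F G : Hq → ℂ} {a b : Dual → ℂ}
    (hF : HasPlancherelTransform F a) (hG : HasPlancherelTransform G b) {C : ℝ}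
    (hC : ∀ᵐ p ∂nu, ‖a p‖ ≤ C) :
    HasPlancherelTransform (conv F G) (fun p => a p * b p) := by
  obtain ⟨hG1, hb, s, hs, l1, l2⟩ := hG
  refine .of_tendsto (F := fun j => QHeis.conv F (s j)) (fun j => hF.conv_L1sharp (hs j).1) ?_
    (memLp_mul_of_bounded hF.2.1.1 hC hb) (tendsto_eLpNorm_mul hC l2)
  refine tendstoInMeasure_of_tendsto_eLpNorm ENNReal.top_ne_zero
    (fun j => aestronglyMeasurable_conv hF.1.1.1 (hs j).2.1.1)
    (aestronglyMeasurable_conv hF.1.1.1 hG1.1.1) ?_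
  have hlim := ENNReal.Tendsto.const_mul l1 (Or.inr hF.1.1.2.ne)
  rw [mul_zero] at hlim
  refine tendsto_of_tendsto_of_tendsto_of_le_of_le tendsto_const_nhds hlim (fun _ => zero_le)
    fun j => ?_
  rw [eLpNorm_exponent_top]
  refine eLpNormEssSup_le_of_ae_enorm_bound ?_
  have := conv_linear_right (convExists_L2_L2 hF.1.1 (hs j).2.1)
    (convExists_L2_L2 hF.1.1 hG1.1) (-1)
  simp only [neg_mul, one_mul, ← sub_eq_add_neg] at this
  filter_upwards [this] with x hx
  rw [Pi.sub_apply, ← hx]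
  exact enorm_conv_le_L2 hF.1.1 ((hs j).2.1.sub hG1.1) x

/-- The transform maps convolutions to products as soon as one of the transforms is bounded. -/
theorem HasTransform.conv {F G : Hq → ℂ} {a b : Dual → ℂ} (hF : HasTransform F a)
    (hG : HasTransform G b) {C : ℝ} (hC : ∀ᵐ p ∂nu, ‖a p‖ ≤ C) :
    ConvExists F G ∧ HasTransform (conv F G) (fun p => a p * b p) := by
  obtain ⟨F₁, F₂, a₂, h1, h2, h3, h4⟩ := hF
  obtain ⟨G₁, G₂, b₂, k1, k2, k3, k4⟩ := hG
  -- The `L²` part of the first factor has a bounded transform, as the difference of the bounded `a`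
  -- and the transform of an integrable function. This makes the `L² * L²` term harmless.
  have hbd : ∀ᵐ p ∂nu, ‖a₂ p‖ ≤ C + ∫ x, ‖F₁ x‖ := by
    filter_upwards [hC, h4] with p hp h
    have e : a₂ p = a p - sphericalTransform F₁ p := by
      rw [h]
      ring
    rw [e]
    exact (norm_sub_le _ _).trans (add_le_add hp (norm_sphericalTransform_le h1.1 p))
  have hF' : (fun x => F₁ x + 1 * F₂ x) =ᵐ[volume] F := by
    filter_upwards [h3] with x hx
    rw [hx, one_mul]
  have hG' : (fun x => G₁ x + 1 * G₂ x) =ᵐ[volume] G := by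
    filter_upwards [k3] with x hx
    rw [hx, one_mul]
  have c11 := convExists_of_integrable h1.1 k1.1
  have c12 := convExists_L1_L2 h1.1 k2.1.1
  have c21 := convExists_L2_L1 h2.1.1 k1.1
  have c22 := convExists_L2_L2 h2.1.1 k2.1.1
  refine ⟨((c11.linear_right c12 1).linear_left (c21.linear_right c22 1) 1).congr hF' hG', ?_⟩
  have ht := ((h1.conv k1).hasTransform.linear (h1.conv_hasPlancherelTransform k2).hasTransform
    1).linear ((h2.conv_L1sharp k1).hasTransform.linear (h2.conv k2 hbd).hasTransform 1) 1
  refine ht.congr ?_ ?_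
  · rw [← conv_congr hF' hG']
    filter_upwards [conv_linear_left (c11.linear_right c12 1) (c21.linear_right c22 1) 1,
      conv_linear_right c11 c12 1, conv_linear_right c21 c22 1] with x e1 e2 e3
    rw [e1, e2, e3]
  · filter_upwards [h4, k4] with p e1 e2
    rw [e1, e2, sphericalTransform_conv h1 k1]
    ring

/-! ### Multipliers -/

theorem IsSymbol.ae_bound {m : Dual → ℂ} {C : ℝ}
    (hC : ∀ lam : E3, lam ≠ 0 → ∀ n : ℕ, ‖m (lam, n)‖ ≤ C) : ∀ᵐ p ∂nu, ‖m p‖ ≤ C :=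
  ae_fst_ne_zero.mono fun p hp => hC p.1 hp p.2

theorem InDomain.isMultiplierImage {m : Dual → ℂ} {f : Hq → ℂ} (h : InDomain m f) :
    IsMultiplierImage m f (T m f) := by
  rw [T, dif_pos h]
  exact h.choose_spec

/-- Uniqueness is used twice: the transform of `f` does not depend on its decomposition, and the
product then determines the image. -/
theorem IsMultiplierImage.ae_eq_T {m : Dual → ℂ} {f F : Hq → ℂ} (h : IsMultiplierImage m f F) :
    F =ᵐ[volume] T m f := by
  obtain ⟨a', ha', hT⟩ := InDomain.isMultiplierImage ⟨F, h⟩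
  obtain ⟨a, ha, hF⟩ := h
  refine hF.weakTransform.unique_left hT.weakTransform ?_
  filter_upwards [ha.weakTransform.unique_right ha'.weakTransform
    (Filter.EventuallyEq.refl _ _)] with p hp
  rw [hp]

/-- On `L^{1,#}` the transform of the multiplier image is the symbol times the spherical
transform. -/
theorem InDomain.hasTransform {m : Dual → ℂ} {f : Hq → ℂ} (h : InDomain m f) (hf : L1sharp f) :
    HasTransform (T m f) fun p => m p * sphericalTransform f p := by
  obtain ⟨a, ha, hT⟩ := h.isMultiplierImage
  refine hT.congr (Filter.EventuallyEq.refl _ _) ?_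
  filter_upwards [ha.weakTransform.unique_right hf.weakTransform
    (Filter.EventuallyEq.refl _ _)] with p hp
  rw [hp]

/-- A bounded symbol preserves `L²(ν)`, and every element of `L²(ν)` is a Plancherel transform. -/
theorem HasPlancherelTransform.multiplier {m : Dual → ℂ} (hm : IsSymbol m) {f : Hq → ℂ}
    {b : Dual → ℂ} (hf : HasPlancherelTransform f b) :
    InDomain m f ∧ HasPlancherelTransform (T m f) fun p => m p * b p := by
  obtain ⟨hmeas, C, hC⟩ := hm
  obtain ⟨F, hF⟩ := exists_of_plancherelTransform
    (memLp_mul_of_bounded hmeas.aestronglyMeasurable (IsSymbol.ae_bound hC) hf.2.1)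
  have h : IsMultiplierImage m f F := ⟨b, hf.hasTransform, hF.hasTransform⟩
  exact ⟨⟨F, h⟩, hF.congr h.ae_eq_T (Filter.EventuallyEq.refl _ _)⟩

theorem IsSymbol.ae_bound_mul {m : Dual → ℂ} (hm : IsSymbol m) {f : Hq → ℂ} (hf : L1sharp f) :
    ∃ C : ℝ, ∀ᵐ p ∂nu, ‖m p * sphericalTransform f p‖ ≤ C := by
  obtain ⟨-, C, hC⟩ := hm
  refine ⟨|C| * ∫ x, ‖f x‖, ?_⟩
  filter_upwards [IsSymbol.ae_bound hC] with p hp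
  rw [norm_mul]
  gcongr
  · exact hp.trans (le_abs_self C)
  · exact norm_sphericalTransform_le hf.1 p

/-- A function with the right transform is the multiplier image of a convolution. -/
theorem HasTransform.isMultiplierImage_conv {m : Dual → ℂ} {f g F : Hq → ℂ} (hf : L1sharp f)
    (hg : L1sharp g) {a : Dual → ℂ} (hF : HasTransform F a)
    (ha : ∀ p, a p = m p * (sphericalTransform f p * sphericalTransform g p)) :
    IsMultiplierImage m (QHeis.conv f g) F := by
  refine ⟨_, (hf.conv hg).hasTransform, ?_⟩
  simp only [sphericalTransform_conv hf hg, ← ha]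
  exact hF

theorem HasPlancherelTransform.TOp {m : Dual → ℂ} (hm : IsSymbol m) {f h : Hq → ℂ} {b : Dual → ℂ}
    (hf : L1sharp f) (hh : HasPlancherelTransform h b) :
    HasPlancherelTransform (TOp m f h) fun p => m p * (sphericalTransform f p * b p) :=
  ((hf.conv_hasPlancherelTransform hh).multiplier hm).2

theorem IsSymbol.mul {m₁ m₂ : Dual → ℂ} (h₁ : IsSymbol m₁) (h₂ : IsSymbol m₂) :
    IsSymbol fun p => m₁ p * m₂ p := by
  obtain ⟨hm₁, C₁, hC₁⟩ := h₁
  obtain ⟨hm₂, C₂, hC₂⟩ := h₂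
  refine ⟨hm₁.mul hm₂, |C₁| * |C₂|, fun lam hlam n => ?_⟩
  rw [norm_mul]
  gcongr
  · exact (hC₁ lam hlam n).trans (le_abs_self _)
  · exact (hC₂ lam hlam n).trans (le_abs_self _)

end QHeis

end

/-! ### The theorem, by comparison of transforms. -/

theorem mainTheorem1 (m m₁ m₂ : QHeis.Dual → ℂ)
    (hm : QHeis.IsSymbol m) (hm₁ : QHeis.IsSymbol m₁) (hm₂ : QHeis.IsSymbol m₂) :
    -- `T_m` is well defined, everywhere defined on `L^{2,#}`, and bounded there
    ((∀ f F : QHeis.Hq → ℂ, QHeis.IsMultiplierImage m f F → F =ᵐ[volume] QHeis.T m f) ∧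
      (∀ f : QHeis.Hq → ℂ, QHeis.L2sharp f →
        QHeis.InDomain m f ∧ QHeis.L2sharp (QHeis.T m f) ∧
        ∀ C : ℝ≥0, (∀ lam : QHeis.E3, lam ≠ 0 → ∀ n : ℕ, ‖m (lam, n)‖ ≤ C) →
          eLpNorm (QHeis.T m f) 2 volume ≤ C * eLpNorm f 2 volume)) ∧
    -- the two identities for functions
    (∀ f g : QHeis.Hq → ℂ, QHeis.L1sharp f → QHeis.L1sharp g →
      (QHeis.InDomain m f →
        QHeis.InDomain m (QHeis.conv f g) ∧ QHeis.ConvExists (QHeis.T m f) g ∧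
        QHeis.T m (QHeis.conv f g) =ᵐ[volume] QHeis.conv (QHeis.T m f) g) ∧
      (QHeis.InDomain m₁ f → QHeis.InDomain m₂ g →
        QHeis.InDomain (fun p => m₁ p * m₂ p) (QHeis.conv f g) ∧
        QHeis.ConvExists (QHeis.T m₁ f) (QHeis.T m₂ g) ∧
        QHeis.conv (QHeis.T m₁ f) (QHeis.T m₂ g) =ᵐ[volume]
          QHeis.T (fun p => m₁ p * m₂ p) (QHeis.conv f g))) ∧
    -- convolution operators on `L^{2,#}`: they extend `T_m f`, and satisfy the same identities
    -- for all `f, g` in `L^{1,#}`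
    (∀ f g h : QHeis.Hq → ℂ, QHeis.L1sharp f → QHeis.L1sharp g → QHeis.L2sharp h →
      QHeis.L2sharp (QHeis.conv f h) ∧
      (QHeis.InDomain m f →
        QHeis.ConvExists (QHeis.T m f) h ∧
        QHeis.TOp m f h =ᵐ[volume] QHeis.conv (QHeis.T m f) h) ∧
      QHeis.TOp m (QHeis.conv f g) h =ᵐ[volume] QHeis.TOp m f (QHeis.conv g h) ∧
      QHeis.TOp m₁ f (QHeis.TOp m₂ g h) =ᵐ[volume]
        QHeis.TOp (fun p => m₁ p * m₂ p) (QHeis.conv f g) h) := by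
  refine ⟨⟨fun f F h => h.ae_eq_T, fun f hf => ?_⟩, fun f g hf hg => ⟨fun hd => ?_, fun h1 h2 => ?_⟩,
    fun f g h hf hg hh => ?_⟩
  · obtain ⟨b, hb⟩ := QHeis.exists_plancherelTransform hf
    obtain ⟨hd, hT⟩ := hb.multiplier hm
    refine ⟨hd, hT.1, fun C hC => ?_⟩
    rw [hT.eLpNorm_eq, hb.eLpNorm_eq]
    refine eLpNorm_le_nnreal_smul_eLpNorm_of_ae_le_mul ?_ 2
    filter_upwards [QHeis.IsSymbol.ae_bound hC] with p hp
    rw [nnnorm_mul]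
    gcongr
    exact hp
  · obtain ⟨C, hC⟩ := hm.ae_bound_mul hf
    obtain ⟨hc, ht⟩ := (hd.hasTransform hf).conv hg.hasTransform hC
    have hi := ht.isMultiplierImage_conv hf hg fun p => mul_assoc _ _ _
    exact ⟨⟨_, hi⟩, hc, hi.ae_eq_T.symm⟩
  -- It is enough that the transform of one factor, here `m₁ f̂`, is bounded.
  · obtain ⟨C, hC⟩ := hm₁.ae_bound_mul hf
    obtain ⟨hc, ht⟩ := (h1.hasTransform hf).conv (h2.hasTransform hg) hC
    have hi := ht.isMultiplierImage_conv (m := fun p => m₁ p * m₂ p) hf hg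
      fun p => mul_mul_mul_comm _ _ _ _
    exact ⟨⟨_, hi⟩, hc, hi.ae_eq_T⟩
  · obtain ⟨b, hb⟩ := QHeis.exists_plancherelTransform hh
    have hfg := hf.conv hg
    refine ⟨(hf.conv_hasPlancherelTransform hb).1, fun hd => ?_, ?_, ?_⟩
    · obtain ⟨C, hC⟩ := hm.ae_bound_mul hf
      obtain ⟨hc, ht⟩ := (hd.hasTransform hf).conv hb.hasTransform hC
      exact ⟨hc, (hb.TOp hm hf).weakTransform.unique_left ht.weakTransform
        (ae_of_all _ fun p => (mul_assoc _ _ _).symm)⟩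
    -- All operators applied to `h` stay in `L^{2,#}`, where multipliers are defined everywhere, so
    -- no existence condition on `f` or `g` enters.
    · have ht := (hg.conv_hasPlancherelTransform hb).TOp hm hf
      refine (hb.TOp hm hfg).weakTransform.unique_left ht.weakTransform (ae_of_all _ fun p => ?_)
      simp only [QHeis.sphericalTransform_conv hf hg, mul_assoc]
    · refine ((hb.TOp hm₂ hg).TOp hm₁ hf).weakTransform.unique_left
        (hb.TOp (hm₁.mul hm₂) hfg).weakTransform (ae_of_all _ fun p => ?_)
      simp only [QHeis.sphericalTransform_conv hf hg]
      ring
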